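/- Logarithms are to base 2. An $l$-substring edit of a binary string replaces a substring $u$ by a string $v$ with $|u|,|v|\le l$ (either may be empty). For $x\in\{0,1\}^n$ let $\mathcal E_{k,l}(x)$ be the set of strings obtainable from $x$ by $k$ successive $l$-substring edits. **Theorem.** Let $k$ be a fixed positive integer and let $l=l(n)$ be a function from natural numbers to natural numbers. (a) Suppose $l=O(\log n)$ or $l=\omega(\log n)$. Then there are functions $\Phi=\Phi_n:\{0,1\}^n\to\{0,1\}^{\rho(n)}$ with $$\rho(n)\le 4k\log n+4kl+8k\log(l+1)+O(\log\log n)$$ such that, for every $n$, $\{(x,\Phi(x)):x\in\{0,1\}^n\}$ is a systematic code correcting $k$ $l$-substring edits over the synchronization channel (only $x$ is subject to errors, $\Phi(x)$ is received intact), that is, $\Phi(x)\ne\Phi(x')$ whenever $x\neq x'$ and $\mathcal E_{k,l}(x)\cap\mathcal E_{k,l}(x')\neq\emptyset$; its redundancy is $\rho(n)$. Consequently, for every $n$ some color class $C=\{x\in\{0,1\}^n:\Phi(x)=a\}$ is a code of length $n$ whose distinct codewords $x,x'$ satisfy $\mathcal E_{k,l}(x)\cap\mathcal E_{k,l}(x')=\emptyset$,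 with redundancy $n-\log|C|\le\rho(n)$. Moreover, there are an encoding algorithm, computing $(x,\Phi(x))$ from $x$, and a decoding algorithm, computing $x$ from any $y\in\mathcal E_{k,l}(x)$ and $\Phi(x)$, both running in time polynomial in $n$ (the algorithms are uniform in $n$; the parameter $l(n)$, and for decoding also $n$, is part of the input). (b) Suppose $l=\omega(\log n)$. Then there are functions $\phi_1:\{0,1\}^n\to\{0,1\}^{\rho_1(n)}$ and $\phi_2:\{0,1\}^n\to\{0,1\}^{\rho_2(n)}$ such that for all sufficiently large $n$: $\phi_1$ and $\phi_2$ are computable in time polynomial in $n$ (uniformly, given also $l(n)$); $\rho_1(n)\le 4kl$ and $\phi_1$ is a syndrome correcting $2k$ bursts of erasures of length $l$ (two words with the same $\phi_1$ that agree outside $2k$ windows of $l$ consecutive positions are equal); $\rho_2(n)\le 4k\log n+8k\log(l+1)+O(\log\log n)$ and $\phi_2$ is a proper coloring of the graph on $\{0,1\}^n$ in which distinct $x,x'$ are adjacent if $\phi_1(x)=\phi_1(x')$ and $\mathcal E_{k,l}(x)\cap\mathcal E_{k,l}(x')\ne\emptyset$; and for $y\in\mathcal E_{k,l}(x)$ one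 can recover $x$ from $y$, $\phi_1(x)$, $\phi_2(x)$ in time polynomial in $n$. -/

import Mathlib

open Filter Asymptotics

namespace SubstringEdits

/-! ### Strings, channels, codes -/

/-- Binary strings of arbitrary length. -/
abbrev Bits : Type := List Bool

/-- Binary strings of length exactly `n`. -/
abbrev Word (n : ℕ) : Type := List.Vector Bool n

/-- `y` arises from `x` by one `l`-substring edit: a substring `u` of `x` is replaced by a
string `v`, where both lengths are at most `l` (either string may be empty). -/
def Edit (l : ℕ) (x y : Bits) : Prop :=
  ∃ a u v b : Bits, x = a ++ u ++ b ∧ y = a ++ v ++ b ∧ u.length ≤ l ∧ v.length ≤ l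

/-- The channel of `k` successive `l`-substring edits: all possible outputs on input `x`.
As an edit may leave the string unchanged, "exactly `k`" and "at most `k`" agree. -/
def channel (l : ℕ) : ℕ → Bits → Set Bits
  | 0, x => {x}
  | k + 1, x => {y | ∃ z, Edit l x z ∧ y ∈ channel l k z}

/-- Confusion graph with vertex set `{0,1}^n` of the channel `E`: two distinct inputs are adjacent
when they can produce a common output. -/
def confusionGraph (E : Bits → Set Bits) (n : ℕ) : SimpleGraph (Word n) where
  Adj x x' := x ≠ x' ∧ ∃ y, y ∈ E x.toList ∧ y ∈ E x'.toList
  symm := ⟨fun _ _ h => ⟨h.1.symm, h.2.imp fun _ hy => ⟨hy.2, hy.1⟩⟩⟩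
  loopless := ⟨fun _ h => h.1 rfl⟩

/-- The subgraph of the confusion graph that keeps only the edges between inputs on which the
syndrome `φ` agrees. -/
def reducedGraph (E : Bits → Set Bits) {n r : ℕ} (φ : Word n → Word r) :
    SimpleGraph (Word n) where
  Adj x x' := (confusionGraph E n).Adj x x' ∧ φ x = φ x'
  symm := ⟨fun _ _ h => ⟨h.1.symm, h.2.symm⟩⟩
  loopless := ⟨fun _ h => h.1.1 rfl⟩

/-- Proper coloring of a graph. -/
def IsColoring {V A : Type} (G : SimpleGraph V) (Φ : V → A) : Prop :=
  ∀ u v, G.Adj u v → Φ u ≠ Φ v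

/-- `{(x, Φ x)}` is a systematic error-correcting code for the synchronization channel `E`, where
`x` is subject to the errors of `E` and `Φ x` arrives unharmed: distinct inputs which can
produce the same output have distinct syndromes. Its redundancy is the length `r` of `Φ x`. -/
def IsSystematicCode (E : Bits → Set Bits) {n r : ℕ} (Φ : Word n → Word r) : Prop :=
  ∀ (x x' : Word n) (y : Bits), x ≠ x' → y ∈ E x.toList → y ∈ E x'.toList → Φ x ≠ Φ x'

/-- `C ⊆ {0,1}^n` is an error-correcting code for `E`: distinct codewords never
produce a common output. -/
def Corrects (E : Bits → Set Bits) {n : ℕ} (C : Set (Word n)) : Prop :=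
  ∀ x ∈ C, ∀ x' ∈ C, x ≠ x' → Disjoint (E x.toList) (E x'.toList)

/-- Redundancy `n - log₂ |C|` of a code `C ⊆ {0,1}^n`. -/
noncomputable def redundancy {n : ℕ} (C : Set (Word n)) : ℝ :=
  (n : ℝ) - Real.logb 2 (C.ncard : ℝ)

/-- `x` and `x'` agree outside `b` windows of `l` consecutive positions, i.e. they become
equal after suitable `b` bursts of at most `l` erasures (at the same positions in both). -/
def AgreeOutsideBursts (b l : ℕ) {n : ℕ} (x x' : Word n) : Prop :=
  ∃ s : Fin b → ℕ, ∀ i : Fin n,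
    (∀ j, ¬ (s j ≤ (i : ℕ) ∧ (i : ℕ) < s j + l)) → x.get i = x'.get i

/-- The syndrome `φ` corrects `b` bursts of erasures of length `l`: a word is determined by its
syndrome together with what the erasures leave of it. -/
def CorrectsBurstErasures (b l : ℕ) {n r : ℕ} (φ : Word n → Word r) : Prop :=
  ∀ x x' : Word n, AgreeOutsideBursts b l x x' → φ x = φ x' → x = x'

/-! ### Machine model

While programs over binary trees (pure LISP data) with unit cost per executed
instruction. Trees are thought of as pointers to immutable cells, so passing on a value, `cons`,
`hd`, `tl` and the test for `nil` are constant-time operations; there is no test of equality on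
whole trees. This textbook model is polynomially equivalent to Turing machines. -/

/-- Data: binary trees. -/
inductive Data : Type
  | nil : Data
  | cons : Data → Data → Data

/-- Programs, each transforming one datum into another. -/
inductive Prog : Type
  /-- return the input -/
  | skip : Prog
  /-- return `nil` -/
  | nil : Prog
  /-- left component -/
  | hd : Prog
  /-- right component -/
  | tl : Prog
  /-- run both programs on the input and pair the results -/
  | cons : Prog → Prog → Prog
  /-- run the first program, then the second one on its result -/
  | seq : Prog → Prog → Prog
  /-- if the first program returns a non-`nil` value, run the second, else run the third -/
  | ite : Prog → Prog → Prog → Prog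
  /-- while the first program returns a non-`nil` value, apply the second one -/
  | loop : Prog → Prog → Prog

/-- `Runs P d e t`: on input `d` the program `P` halts with output `e` after `t` steps. -/
inductive Runs : Prog → Data → Data → ℕ → Prop
  | skip (d : Data) : Runs Prog.skip d d 1
  | nil (d : Data) : Runs Prog.nil d Data.nil 1
  | hd_nil : Runs Prog.hd Data.nil Data.nil 1
  | hd_cons (a b : Data) : Runs Prog.hd (Data.cons a b) a 1
  | tl_nil : Runs Prog.tl Data.nil Data.nil 1
  | tl_cons (a b : Data) : Runs Prog.tl (Data.cons a b) b 1
  | cons {P Q : Prog} {d a b : Data} {s t : ℕ} :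
      Runs P d a s → Runs Q d b t → Runs (Prog.cons P Q) d (Data.cons a b) (s + t + 1)
  | seq {P Q : Prog} {d e f : Data} {s t : ℕ} :
      Runs P d e s → Runs Q e f t → Runs (Prog.seq P Q) d f (s + t + 1)
  | ite_true {B P Q : Prog} {d a b e : Data} {s t : ℕ} :
      Runs B d (Data.cons a b) s → Runs P d e t → Runs (Prog.ite B P Q) d e (s + t + 1)
  | ite_false {B P Q : Prog} {d e : Data} {s t : ℕ} :
      Runs B d Data.nil s → Runs Q d e t → Runs (Prog.ite B P Q) d e (s + t + 1)
  | loop_done {B P : Prog} {d : Data} {s : ℕ} :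
      Runs B d Data.nil s → Runs (Prog.loop B P) d d (s + 1)
  | loop_step {B P : Prog} {d a b e f : Data} {s t u : ℕ} :
      Runs B d (Data.cons a b) s → Runs P d e t → Runs (Prog.loop B P) e f u →
      Runs (Prog.loop B P) d f (s + t + u + 1)

/-- Halting within `T` steps with the given output. -/
def RunsWithin (P : Prog) (d e : Data) (T : ℕ) : Prop := ∃ t ≤ T, Runs P d e t

/-- A bit as a datum. -/
def ofBool : Bool → Data
  | false => Data.nil
  | true => Data.cons Data.nil Data.nil

/-- A bit string as a datum: the list of its bits. -/
def ofBits : Bits → Data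
  | [] => Data.nil
  | b :: s => Data.cons (ofBool b) (ofBits s)

/-- A natural number as a datum, in unary. -/
def ofNat : ℕ → Data
  | 0 => Data.nil
  | m + 1 => Data.cons Data.nil (ofNat m)

/-- Pairing of data. -/
abbrev pair (a b : Data) : Data := Data.cons a b

/-- One program computes `f n x` from `x ∈ {0,1}^n` and the parameter `l n`,
in time polynomial in `n`, for all `n ≥ N`. -/
def PolyTimeComputable (l : ℕ → ℕ) (N : ℕ) {r : ℕ → ℕ} (f : ∀ n, Word n → Word (r n)) : Prop :=
  ∃ (P : Prog) (p : Polynomial ℕ), ∀ n ≥ N, ∀ x : Word n,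
    RunsWithin P (pair (ofNat (l n)) (ofBits x.toList)) (ofBits (f n x).toList) (p.eval n)

/-- Polynomial-time encoder of the codes `{(x, Φ n x) : x ∈ {0,1}^n}`: one program maps the message
`x` (and the parameter `l n`) to the codeword, in time polynomial in `n`. -/
def HasPolyTimeEncoder (l : ℕ → ℕ) {r : ℕ → ℕ} (Φ : ∀ n, Word n → Word (r n)) : Prop :=
  ∃ (P : Prog) (p : Polynomial ℕ), ∀ n, ∀ x : Word n,
    RunsWithin P (pair (ofNat (l n)) (ofBits x.toList))
      (pair (ofBits x.toList) (ofBits (Φ n x).toList)) (p.eval n)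

/-- Polynomial-time decoder for `k` `l n`-substring edits: one program recovers `x ∈ {0,1}^n` from
the parameters `n`, `l n`, any channel output `y` for `x`, and `Φ n x`, in time polynomial
in `n`. -/
def HasPolyTimeDecoder (k : ℕ) (l : ℕ → ℕ) {r : ℕ → ℕ} (Φ : ∀ n, Word n → Word (r n)) : Prop :=
  ∃ (P : Prog) (p : Polynomial ℕ), ∀ n, ∀ x : Word n, ∀ y ∈ channel (l n) k x.toList,
    RunsWithin P
      (pair (pair (ofNat n) (ofNat (l n))) (pair (ofBits y) (ofBits (Φ n x).toList)))
      (ofBits x.toList) (p.eval n)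

/-- Polynomial-time recovery of `x ∈ {0,1}^n`, for all `n ≥ N`, from the parameters `n`, `l n`, any
output `y` of the channel of `k` `l n`-substring edits on input `x`, and the two
syndromes `φ₁ n x` and `φ₂ n x`. -/
def HasPolyTimeRecovery (k : ℕ) (l : ℕ → ℕ) (N : ℕ) {r₁ r₂ : ℕ → ℕ}
    (φ₁ : ∀ n, Word n → Word (r₁ n)) (φ₂ : ∀ n, Word n → Word (r₂ n)) : Prop :=
  ∃ (P : Prog) (p : Polynomial ℕ), ∀ n ≥ N, ∀ x : Word n, ∀ y ∈ channel (l n) k x.toList,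
    RunsWithin P
      (pair (pair (ofNat n) (ofNat (l n)))
        (pair (ofBits y) (pair (ofBits (φ₁ n x).toList) (ofBits (φ₂ n x).toList))))
      (ofBits x.toList) (p.eval n)

end SubstringEdits

open SubstringEdits

/-! Edits are reversible, so two words `x`, `x'` with a common output are `2k` edits apart. Once
every inserted string is replaced by erasures, an edit is given by a position below `R` and two
lengths up to `l`. With `R = (2k+1)n` there are at most `((2k+1)n(l+1)^2)^(2k)` erasure patterns
(masks) around `x`, and `x'` fills one of them (`exists_mask_of_mem_channel₂`). Suppose that a
syndrome `φ` leaves at most `Λ` ways to fill each mask. Then the confusion graph on words of equal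
`φ` has degree at most `Δ = ((2k+1)n(l+1)^2)^(2k) Λ`, its neighbors can be listed in polynomial
time, and a proper coloring with `2 log Δ + O(1)` bits costs `4k log n + 8k log(l+1) + 2 log Λ +
O(1)` on top of `φ`.

The coloring (`color_ne`) is Linial's color reduction. A word is read as a polynomial over a prime
field; its color consists of a point where it differs from all its neighbors, and of its value
there. Polynomials of degree at most `m` agree in at most `m` points, so a field with more than `mΔ`
elements has such a point. This is done twice: with the `n` bits as coefficients, and then with the
four digits of the first color, which give cubics over a field of order `Δ`.

There are two choices of `φ`. If `l = O(log n)`, then `φ` is empty: a mask has at most `2kl`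
erasures, `Λ = 2^(2kl)` is polynomial in `n`, and `2 log Λ = 4kl`. If `l = ω(log n)`, the erasures
of a mask lie in `4k - 1` windows of length `l`, since every edit after the first adds a window and
may split an old one (`covered_maskSteps`). Interleaved Reed-Solomon checks on blocks of about `log
n` bits correct them, so `Λ = 1` (`burstSolve_eq`); their length is `(4k-1)l + o(l)`, hence at most
`4kl` for large `n` (`exists_burst_bound`).

The decoder lists the fillings of the masks around `y` and keeps those with the received `φ` and
color. A survivor other than `x` would be a neighbor of `x` of the same color (`decoder_eq`). If `l
≥ n` or `n` is small, the syndrome is the word itself; `l` and `y` may then be too long to be read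
in full, so `l` is clipped to `n` and `y` is ignored.

Polynomial time is obtained from closure properties of the class `PolyC`, in which all numbers are
unary. -/

namespace SubstringEdits

/-! ### Polynomial-time functions on encoded types -/

/-- Number of cells of a datum. -/
def Data.size : Data → ℕ
  | .nil => 0
  | .cons a b => a.size + b.size + 1

/-- Types whose elements are represented by data. -/
class Enc (α : Type) where
  /-- the representation -/
  enc : α → Data

open Enc

/-- The datum listing the representations of the entries of a list. -/
def encList {α : Type} [Enc α] : List α → Data
  | [] => .nil
  | a :: s => .cons (enc a) (encList s)

instance : Enc Unit := ⟨fun _ => .nil⟩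
instance : Enc Bool := ⟨ofBool⟩
instance : Enc ℕ := ⟨ofNat⟩
instance {α β : Type} [Enc α] [Enc β] : Enc (α × β) := ⟨fun p => .cons (enc p.1) (enc p.2)⟩
instance {α : Type} [Enc α] : Enc (List α) := ⟨encList⟩
instance {α : Type} [Enc α] : Enc (Option α) :=
  ⟨fun o => o.elim .nil (fun a => .cons .nil (enc a))⟩

variable {α β γ σ : Type} [Enc α] [Enc β] [Enc γ] [Enc σ]

/-- Size of the representation. -/
def sz (a : α) : ℕ := (enc a).size

@[simp] theorem enc_pair (p : α × β) : enc p = .cons (enc p.1) (enc p.2) := rfl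
@[simp] theorem enc_nil : enc ([] : List α) = .nil := rfl
@[simp] theorem enc_cons (a : α) (s : List α) : enc (a :: s) = .cons (enc a) (enc s) := rfl
@[simp] theorem enc_zero : enc (0 : ℕ) = .nil := rfl
@[simp] theorem enc_succ (n : ℕ) : enc (n + 1) = .cons .nil (enc n) := rfl
@[simp] theorem enc_unit (u : Unit) : enc u = .nil := rfl
@[simp] theorem enc_true : enc true = .cons .nil .nil := rfl
@[simp] theorem enc_false : enc false = .nil := rfl
@[simp] theorem enc_none : enc (none : Option α) = .nil := rfl
@[simp] theorem enc_some (a : α) : enc (some a) = .cons .nil (enc a) := rfl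

theorem enc_nat (n : ℕ) : enc n = ofNat n := rfl

theorem enc_bits (x : Bits) : enc x = ofBits x := by
  induction x with
  | nil => rfl
  | cons b s ih => rw [enc_cons, ih]; rfl

theorem enc_replicate_unit (n : ℕ) : enc (List.replicate n ()) = enc n := by
  induction n with
  | zero => rfl
  | succ n ih => rw [List.replicate_succ, enc_cons, ih]; rfl

@[simp] theorem sz_pair (p : α × β) : sz p = sz p.1 + sz p.2 + 1 := rfl
@[simp] theorem sz_nil : sz ([] : List α) = 0 := rfl
@[simp] theorem sz_cons (a : α) (s : List α) : sz (a :: s) = sz a + sz s + 1 := rfl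
@[simp] theorem sz_nat (n : ℕ) : sz n = n := by
  induction n with
  | zero => rfl
  | succ n ih => simp only [sz, enc_succ, Data.size] at *; omega
@[simp] theorem sz_unit (u : Unit) : sz u = 0 := rfl
@[simp] theorem sz_none : sz (none : Option α) = 0 := rfl
@[simp] theorem sz_some (a : α) : sz (some a) = sz a + 1 := by simp [sz, Data.size]
theorem sz_bool (b : Bool) : sz b ≤ 1 := by cases b <;> simp [sz, Data.size]

@[simp] theorem sz_append (s t : List α) : sz (s ++ t) = sz s + sz t := by
  induction s with
  | nil => simp
  | cons a s ih => simp [ih]; omega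

theorem sz_eq_sum (s : List α) : sz s = (s.map sz).sum + s.length := by
  induction s with
  | nil => simp
  | cons a s ih => simp [ih]; omega

theorem length_le_sz (s : List α) : s.length ≤ sz s := by rw [sz_eq_sum]; omega

theorem sz_le_of_mem {s : List α} {a : α} (h : a ∈ s) : sz a ≤ sz s := by
  rw [sz_eq_sum]
  have := List.single_le_sum (l := s.map sz) (by simp) (sz a) (List.mem_map_of_mem h)
  omega

theorem sz_le_of_prefix {s t : List α} (h : s <+: t) : sz s ≤ sz t := by
  obtain ⟨u, rfl⟩ := h
  simp

theorem eval_mono (p : Polynomial ℕ) {a b : ℕ} (h : a ≤ b) : p.eval a ≤ p.eval b := by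
  simp only [Polynomial.eval_eq_sum, Polynomial.sum]
  gcongr

/-- Functions computed by a program in time polynomial in the size of the input, with values of
polynomial size. -/
@[fun_prop]
def PolyC (f : α → β) : Prop :=
  ∃ (P : Prog) (p : Polynomial ℕ), ∀ a,
    (∃ t ≤ p.eval (sz a), Runs P (enc a) (enc (f a)) t) ∧ sz (f a) ≤ p.eval (sz a)

theorem PolyC.congr {f g : α → β} (hf : PolyC f) (h : ∀ a, g a = f a) : PolyC g :=
  funext h ▸ hf

theorem PolyC.of_const_time {f : α → β} (P : Prog) (c : ℕ)
    (h : ∀ a, (∃ t ≤ c, Runs P (enc a) (enc (f a)) t) ∧ sz (f a) ≤ sz a + c) : PolyC f := by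
  refine ⟨P, Polynomial.X + Polynomial.C c, fun a => ?_⟩
  obtain ⟨⟨t, ht, hr⟩, hs⟩ := h a
  simp only [Polynomial.eval_add, Polynomial.eval_X, Polynomial.eval_C]
  exact ⟨⟨t, by omega, hr⟩, hs⟩

@[fun_prop]
theorem PolyC.id : PolyC (fun a : α => a) :=
  .of_const_time .skip 1 fun a => ⟨⟨1, le_rfl, .skip _⟩, by simp⟩

/-- The program returning a fixed datum. -/
def constProg : Data → Prog
  | .nil => .nil
  | .cons a b => .cons (constProg a) (constProg b)

theorem runs_constProg (e d : Data) : Runs (constProg e) d e (2 * e.size + 1) := by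
  induction e with
  | nil => exact .nil d
  | cons a b iha ihb =>
    have := Runs.cons iha ihb
    simp only [Data.size, constProg]
    convert this using 1
    ring

@[fun_prop]
theorem PolyC.const (b : β) : PolyC (fun _ : α => b) :=
  .of_const_time (constProg (enc b)) (2 * sz b + 1) fun a =>
    ⟨⟨_, le_rfl, runs_constProg _ _⟩, by omega⟩

@[fun_prop]
theorem PolyC.comp {g : β → γ} {f : α → β} (hg : PolyC g) (hf : PolyC f) :
    PolyC (fun a => g (f a)) := by
  obtain ⟨P, p, hP⟩ := hf
  obtain ⟨Q, q, hQ⟩ := hg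
  refine ⟨.seq P Q, p + q.comp p + 1, fun a => ?_⟩
  obtain ⟨⟨t, ht, hr⟩, hs⟩ := hP a
  obtain ⟨⟨u, hu, hr'⟩, hs'⟩ := hQ (f a)
  have := eval_mono q hs
  simp only [Polynomial.eval_add, Polynomial.eval_comp, Polynomial.eval_one]
  exact ⟨⟨_, by omega, .seq hr hr'⟩, by omega⟩

@[fun_prop]
theorem PolyC.mk {f : α → β} {g : α → γ} (hf : PolyC f) (hg : PolyC g) :
    PolyC (fun a => (f a, g a)) := by
  obtain ⟨P, p, hP⟩ := hf
  obtain ⟨Q, q, hQ⟩ := hg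
  refine ⟨.cons P Q, p + q + 1, fun a => ?_⟩
  obtain ⟨⟨t, ht, hr⟩, hs⟩ := hP a
  obtain ⟨⟨u, hu, hr'⟩, hs'⟩ := hQ a
  simp only [Polynomial.eval_add, Polynomial.eval_one, sz_pair]
  exact ⟨⟨_, by omega, .cons hr hr'⟩, by omega⟩

theorem PolyC.fst' : PolyC (fun p : α × β => p.1) :=
  .of_const_time .hd 1 fun a => ⟨⟨1, le_rfl, .hd_cons _ _⟩, by simp; omega⟩

theorem PolyC.snd' : PolyC (fun p : α × β => p.2) :=
  .of_const_time .tl 1 fun a => ⟨⟨1, le_rfl, .tl_cons _ _⟩, by simp; omega⟩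

@[fun_prop]
theorem PolyC.fst {f : α → β × γ} (hf : PolyC f) : PolyC (fun a => (f a).1) := PolyC.fst'.comp hf

@[fun_prop]
theorem PolyC.snd {f : α → β × γ} (hf : PolyC f) : PolyC (fun a => (f a).2) := PolyC.snd'.comp hf

@[fun_prop]
theorem PolyC.cond {c : α → Bool} {f g : α → β} (hc : PolyC c) (hf : PolyC f) (hg : PolyC g) :
    PolyC (fun a => bif c a then f a else g a) := by
  obtain ⟨P, p, hP⟩ := hf
  obtain ⟨Q, q, hQ⟩ := hg
  obtain ⟨R, r, hR⟩ := hc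
  refine ⟨.ite R P Q, p + q + r + 1, fun a => ?_⟩
  obtain ⟨⟨t, ht, hr⟩, hs⟩ := hP a
  obtain ⟨⟨u, hu, hr'⟩, hs'⟩ := hQ a
  obtain ⟨⟨v, hv, hr''⟩, -⟩ := hR a
  simp only [Polynomial.eval_add, Polynomial.eval_one]
  cases h : c a <;> rw [h] at hr''
  · exact ⟨⟨_, by omega, .ite_false hr'' hr'⟩, by simp only [cond_false]; omega⟩
  · exact ⟨⟨_, by omega, .ite_true hr'' hr⟩, by simp only [cond_true]; omega⟩

/-! Lists -/

@[fun_prop]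
theorem PolyC.cons {f : α → β} {g : α → List β} (hf : PolyC f) (hg : PolyC g) :
    PolyC (fun a => f a :: g a) := by
  have : PolyC (fun p : β × List β => p.1 :: p.2) :=
    .of_const_time .skip 1 fun a => ⟨⟨1, le_rfl, .skip _⟩, by simp⟩
  exact this.comp (hf.mk hg)

@[fun_prop]
theorem PolyC.tail {f : α → List β} (hf : PolyC f) : PolyC (fun a => (f a).tail) := by
  have : PolyC (fun s : List β => s.tail) := .of_const_time .tl 1 fun s => by
    cases s with
    | nil => exact ⟨⟨1, le_rfl, .tl_nil⟩, by simp⟩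
    | cons a s => exact ⟨⟨1, le_rfl, .tl_cons _ _⟩, by simp; omega⟩
  exact this.comp hf

@[fun_prop]
theorem PolyC.isEmpty {f : α → List β} (hf : PolyC f) : PolyC (fun a => (f a).isEmpty) := by
  have : PolyC (fun s : List β => s.isEmpty) :=
    .of_const_time (.ite .skip .nil (constProg (enc true))) 6 fun s => by
      cases s with
      | nil =>
        exact ⟨⟨_, by simp [Data.size], .ite_false (.skip _) (runs_constProg _ _)⟩,
          by have := sz_bool true; simp; omega⟩
      | cons a s => exact ⟨⟨_, by simp, .ite_true (.skip _) (.nil _)⟩, by simp [sz, Data.size]⟩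
  exact this.comp hf

@[fun_prop]
theorem PolyC.headD {f : α → List β} {d : α → β} (hf : PolyC f) (hd : PolyC d) :
    PolyC (fun a => (f a).headD (d a)) := by
  have : PolyC (fun p : List β × β => p.1.headD p.2) :=
    .of_const_time (.ite .hd (.seq .hd .hd) .tl) 6 fun p => by
      obtain ⟨s, d⟩ := p
      cases s with
      | nil => exact ⟨⟨_, by norm_num, .ite_false (.hd_cons _ _) (.tl_cons _ _)⟩, by simp; omega⟩
      | cons a s =>
        exact ⟨⟨_, by norm_num, .ite_true (.hd_cons _ _) (.seq (.hd_cons _ _) (.hd_cons _ _))⟩,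
          by simp; omega⟩
  exact this.comp (hf.mk hd)

@[fun_prop]
theorem PolyC.some {f : α → β} (hf : PolyC f) : PolyC (fun a => some (f a)) := by
  have : PolyC (fun b : β => Option.some b) :=
    .of_const_time (.cons .nil .skip) 3 fun b =>
      ⟨⟨_, le_rfl, .cons (.nil _) (.skip _)⟩, by simp⟩
  exact this.comp hf

@[fun_prop]
theorem PolyC.isNone {f : α → Option β} (hf : PolyC f) : PolyC (fun a => (f a).isNone) := by
  have : PolyC (fun s : Option β => s.isNone) :=
    .of_const_time (.ite .skip .nil (constProg (enc true))) 6 fun s => by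
      cases s with
      | none =>
        exact ⟨⟨_, by simp [Data.size], .ite_false (.skip _) (runs_constProg _ _)⟩,
          by have := sz_bool true; simp; omega⟩
      | some a => exact ⟨⟨_, by simp, .ite_true (.skip _) (.nil _)⟩, by simp [sz, Data.size]⟩
  exact this.comp hf

@[fun_prop]
theorem PolyC.getD_option {f : α → Option β} {d : α → β} (hf : PolyC f) (hd : PolyC d) :
    PolyC (fun a => (f a).getD (d a)) := by
  have : PolyC (fun p : Option β × β => p.1.getD p.2) :=
    .of_const_time (.ite .hd (.seq .hd .tl) .tl) 6 fun p => by
      obtain ⟨s, d⟩ := p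
      cases s with
      | none => exact ⟨⟨_, by norm_num, .ite_false (.hd_cons _ _) (.tl_cons _ _)⟩, by simp; omega⟩
      | some a =>
        exact ⟨⟨_, by norm_num, .ite_true (.hd_cons _ _) (.seq (.hd_cons _ _) (.tl_cons _ _))⟩,
          by simp; omega⟩
  exact this.comp (hf.mk hd)

/-! Folding a list -/

/-- Body of the loop of `foldProg`. -/
def foldBody (S : Prog) : Prog :=
  .cons (.cons (.seq .hd .hd)
    (.seq (.cons (.seq .hd .hd) (.cons (.seq .hd .tl) (.seq .tl .hd))) S)) (.seq .tl .tl)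

/-- The program folding the step `S` over a list. -/
def foldProg (S : Prog) : Prog := .seq (.loop .tl (foldBody S)) (.seq .hd .tl)

/-- The step need only be fast on the states that are actually reached, those belonging to prefixes
of `L`; this is what lets a size bound along the fold give a uniform `T`. The constant 30 covers the
instructions that rearrange environment, state and list. -/
theorem runs_loop_fold (S : Prog) (env : Data) (T : ℕ) (f : σ → β → σ) (L : List β) :
    ∀ s : σ, (∀ L' b, L' ++ [b] <+: L → ∃ t ≤ T,
        Runs S (.cons env (.cons (enc (L'.foldl f s)) (enc b))) (enc (f (L'.foldl f s) b)) t) →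
      ∃ t ≤ L.length * (T + 30) + 2,
        Runs (.loop .tl (foldBody S)) (.cons (.cons env (enc s)) (enc L))
          (.cons (.cons env (enc (L.foldl f s))) .nil) t := by
  induction L with
  | nil => intro s _; exact ⟨_, by simp, .loop_done (.tl_cons _ _)⟩
  | cons b L ih =>
    intro s h
    obtain ⟨t, ht, hr⟩ := h [] b (by simp)
    obtain ⟨u, hu, hr'⟩ := ih (f s b) fun L' b' hL' => by
      have := h (b :: L') b' (by simpa using hL')
      simpa using this
    refine ⟨_, ?_, .loop_step (.tl_cons _ _) (.cons (.cons (.seq (.hd_cons _ _) (.hd_cons _ _))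
      (.seq (.cons (.seq (.hd_cons _ _) (.hd_cons _ _)) (.cons (.seq (.hd_cons _ _) (.tl_cons _ _))
        (.seq (.tl_cons _ _) (.hd_cons _ _)))) hr)) (.seq (.tl_cons _ _) (.tl_cons _ _))) hr'⟩
    simp only [List.length_cons, add_mul, one_mul]
    omega

theorem runs_foldProg (S : Prog) (env : Data) (T : ℕ) (f : σ → β → σ) (L : List β) (s : σ)
    (h : ∀ L' b, L' ++ [b] <+: L → ∃ t ≤ T,
      Runs S (.cons env (.cons (enc (L'.foldl f s)) (enc b))) (enc (f (L'.foldl f s) b)) t) :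
    ∃ t ≤ L.length * (T + 30) + 10,
      Runs (foldProg S) (.cons (.cons env (enc s)) (enc L)) (enc (L.foldl f s)) t := by
  obtain ⟨t, ht, hr⟩ := runs_loop_fold S env T f L s h
  exact ⟨_, by omega, .seq hr (.seq (.hd_cons _ _) (.tl_cons _ _))⟩

/-- The bound `q` on intermediate states cannot be dispensed with: since cells are shared, a step
may double the size of its state in constant time, and later steps would be charged for that size.
-/
theorem PolyC.foldl {F : α → σ → β → σ} {s : α → σ} {L : α → List β}
    (hF : PolyC (fun p : α × σ × β => F p.1 p.2.1 p.2.2)) (hs : PolyC s) (hL : PolyC L)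
    (q : Polynomial ℕ) (hq : ∀ a L', L' <+: L a → sz (L'.foldl (F a) (s a)) ≤ q.eval (sz a)) :
    PolyC (fun a => (L a).foldl (F a) (s a)) := by
  obtain ⟨S, p, hS⟩ := hF
  obtain ⟨Q, r, hQ⟩ := PolyC.mk (PolyC.mk PolyC.id hs) hL
  refine ⟨.seq Q (foldProg S), r + r * (p.comp (Polynomial.X + q + r + 2) + 30) + 11 + q,
    fun a => ?_⟩
  obtain ⟨⟨t, ht, hr⟩, hsz⟩ := hQ a
  simp only [sz_pair] at hsz
  set T := p.eval (sz a + q.eval (sz a) + r.eval (sz a) + 2)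
  obtain ⟨u, hu, hr'⟩ := runs_foldProg S (enc a) T (F a) (L a) (s a) fun L' b hL' => by
    obtain ⟨⟨u, hu, hr'⟩, -⟩ := hS (a, L'.foldl (F a) (s a), b)
    refine ⟨u, hu.trans (eval_mono _ ?_), hr'⟩
    have h1 := hq a L' ((List.prefix_append _ _).trans hL')
    have h2 := sz_le_of_prefix hL'
    simp only [sz_append, sz_cons, sz_nil] at h2
    simp only [sz_pair]
    omega
  have h3 : (L a).length ≤ r.eval (sz a) := (length_le_sz _).trans (by omega)
  have h4 := Nat.mul_le_mul_right (T + 30) h3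
  simp only [Polynomial.eval_add, Polynomial.eval_mul, Polynomial.eval_comp, Polynomial.eval_X,
    Polynomial.eval_ofNat]
  change _ ∧ _ ≤ r.eval (sz a) + r.eval (sz a) * (T + 30) + 11 + q.eval (sz a)
  refine ⟨⟨_, ?_, .seq hr hr'⟩, ?_⟩
  · change _ ≤ r.eval (sz a) + r.eval (sz a) * (T + 30) + 11 + q.eval (sz a)
    omega
  · have := hq a (L a) List.prefix_rfl
    omega

/-- Folding a step that increases the size by an amount independent of the state. -/
theorem PolyC.foldl_add {F : α → σ → β → σ} {s : α → σ} {L : α → List β}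
    (hF : PolyC (fun p : α × σ × β => F p.1 p.2.1 p.2.2)) (hs : PolyC s) (hL : PolyC L)
    (q : Polynomial ℕ) (hq : ∀ a s b, sz (F a s b) ≤ sz s + q.eval (sz a + sz b)) :
    PolyC (fun a => (L a).foldl (F a) (s a)) := by
  have ⟨_, r, hr⟩ := hL
  have ⟨_, p, hp⟩ := hs
  refine PolyC.foldl hF hs hL (p + r * q.comp (Polynomial.X + r)) fun a L' hL' => ?_
  have key : ∀ L' : List β, (∀ b ∈ L', sz b ≤ sz (L a)) → ∀ s,
      sz (L'.foldl (F a) s) ≤ sz s + L'.length * q.eval (sz a + sz (L a)) := by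
    intro L'
    induction L' with
    | nil => simp
    | cons b L' ih =>
      intro h s
      have h1 := ih (fun b hb => h b (by simp [hb])) (F a s b)
      have h2 := hq a s b
      have h3 := eval_mono q (Nat.add_le_add_left (h b (by simp)) (sz a))
      simp only [List.foldl_cons, List.length_cons, add_mul, one_mul]
      omega
  have h1 := key L' (fun b hb => sz_le_of_mem (hL'.subset hb)) (s a)
  have h2 := (hp a).2
  have h3 := (hr a).2
  have h4 : L'.length ≤ r.eval (sz a) := hL'.length_le.trans ((length_le_sz _).trans h3)
  have h5 := eval_mono q (Nat.add_le_add_left h3 (sz a))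
  simp only [Polynomial.eval_add, Polynomial.eval_mul, Polynomial.eval_comp, Polynomial.eval_X]
  have h6 := Nat.mul_le_mul h4 h5
  omega

@[fun_prop]
theorem PolyC.reverse {f : α → List β} (hf : PolyC f) : PolyC (fun a => (f a).reverse) := by
  have : PolyC (fun a => (f a).foldl (fun acc b => b :: acc) []) :=
    PolyC.foldl_add (F := fun _ acc b => b :: acc) (by fun_prop) (by fun_prop) hf
      (Polynomial.X + 1) fun a s b => by simp; omega
  refine this.congr fun a => ?_
  rw [List.foldl_flip_cons_eq_append']
  simp

@[fun_prop]
theorem PolyC.append {f g : α → List β} (hf : PolyC f) (hg : PolyC g) :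
    PolyC (fun a => f a ++ g a) := by
  have : PolyC (fun a => (f a).reverse.foldl (fun acc b => b :: acc) (g a)) :=
    PolyC.foldl_add (F := fun _ acc b => b :: acc) (by fun_prop) hg (by fun_prop)
      (Polynomial.X + 1) fun a s b => by simp; omega
  refine this.congr fun a => ?_
  rw [List.foldl_flip_cons_eq_append']
  simp

@[fun_prop]
theorem PolyC.map {F : α → β → γ} {L : α → List β} (hF : PolyC (fun p : α × β => F p.1 p.2))
    (hL : PolyC L) : PolyC (fun a => (L a).map (F a)) := by
  have ⟨_, q, hq⟩ := hF
  have : PolyC (fun a => (L a).foldl (fun acc b => F a b :: acc) []) :=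
    PolyC.foldl_add (F := fun a acc b => F a b :: acc)
      (.cons (hF.comp (by fun_prop : PolyC fun p : α × List γ × β => (p.1, p.2.2))) (by fun_prop))
      (by fun_prop) hL (q.comp (Polynomial.X + 1) + 1) fun a s b => by
        have := (hq (a, b)).2
        simp at this ⊢
        omega
  refine this.reverse.congr fun a => ?_
  rw [← List.foldr_reverse, ← List.map_eq_foldr]
  simp

@[fun_prop]
theorem PolyC.flatMap {F : α → β → List γ} {L : α → List β}
    (hF : PolyC (fun p : α × β => F p.1 p.2)) (hL : PolyC L) :
    PolyC (fun a => (L a).flatMap (F a)) := by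
  have ⟨_, q, hq⟩ := hF
  have : PolyC (fun a => (L a).foldl (fun acc b => acc ++ F a b) []) :=
    PolyC.foldl_add (F := fun a acc b => acc ++ F a b)
      (.append (by fun_prop) (hF.comp (by fun_prop : PolyC fun p : α × List γ × β => (p.1, p.2.2))))
      (by fun_prop) hL (q.comp (Polynomial.X + 1) + 1) fun a s b => by
        have := (hq (a, b)).2
        simp at this ⊢
        omega
  refine this.congr fun a => ?_
  rw [List.flatMap_eq_foldl]

@[fun_prop]
theorem PolyC.filter {F : α → β → Bool} {L : α → List β}
    (hF : PolyC (fun p : α × β => F p.1 p.2)) (hL : PolyC L) :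
    PolyC (fun a => (L a).filter (F a)) := by
  have : PolyC (fun a => (L a).flatMap (fun b => bif F a b then [b] else [])) := by fun_prop
  refine this.congr fun a => ?_
  induction L a with
  | nil => rfl
  | cons b s ih => cases h : F a b <;> simp [h, ih]

/-! ### Boolean connectives and tests. -/

@[fun_prop]
theorem PolyC.not {f : α → Bool} (hf : PolyC f) : PolyC (fun a => !f a) := by
  have : PolyC (fun a => bif f a then false else true) := by fun_prop
  refine this.congr fun a => ?_
  cases f a <;> rfl

@[fun_prop]
theorem PolyC.and {f g : α → Bool} (hf : PolyC f) (hg : PolyC g) : PolyC (fun a => f a && g a) := by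
  have : PolyC (fun a => bif f a then g a else false) := by fun_prop
  refine this.congr fun a => ?_
  cases f a <;> rfl

@[fun_prop]
theorem PolyC.or {f g : α → Bool} (hf : PolyC f) (hg : PolyC g) : PolyC (fun a => f a || g a) := by
  have : PolyC (fun a => bif f a then true else g a) := by fun_prop
  refine this.congr fun a => ?_
  cases f a <;> rfl

@[fun_prop]
theorem PolyC.beq_bool {f g : α → Bool} (hf : PolyC f) (hg : PolyC g) :
    PolyC (fun a => f a == g a) := by
  have : PolyC (fun a => bif f a then g a else !g a) := by fun_prop
  refine this.congr fun a => ?_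
  cases f a <;> cases g a <;> rfl

@[fun_prop]
theorem PolyC.all {F : α → β → Bool} {L : α → List β}
    (hF : PolyC (fun p : α × β => F p.1 p.2)) (hL : PolyC L) :
    PolyC (fun a => (L a).all (F a)) := by
  have : PolyC (fun a => ((L a).filter (fun b => !F a b)).isEmpty) := by fun_prop
  refine this.congr fun a => ?_
  induction L a with
  | nil => rfl
  | cons b s ih => cases h : F a b <;> simp [h, ih]

/-! Unary arithmetic -/

/-- A number as a list. -/
@[fun_prop]
theorem PolyC.units {f : α → ℕ} (hf : PolyC f) : PolyC (fun a => List.replicate (f a) ()) := by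
  have : PolyC (fun n : ℕ => List.replicate n ()) := .of_const_time .skip 1 fun n =>
    ⟨⟨1, le_rfl, by rw [enc_replicate_unit]; exact .skip _⟩, by
      simp [sz, enc_replicate_unit]⟩
  exact this.comp hf

-- A list of units and its length are the same datum, so once the entries are replaced by units
-- nothing remains to be computed. In the same way unary arithmetic reduces to list operations.
@[fun_prop]
theorem PolyC.length {f : α → List β} (hf : PolyC f) : PolyC (fun a => (f a).length) := by
  have h1 : PolyC (fun s : List Unit => s.length) := .of_const_time .skip 1 fun s => by
    have h : s = List.replicate s.length () := List.eq_replicate_iff.2 ⟨rfl, fun _ _ => rfl⟩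
    have h2 : enc s = enc s.length := by conv_lhs => rw [h, enc_replicate_unit]
    exact ⟨⟨1, le_rfl, by rw [← h2]; exact .skip _⟩, by rw [sz, ← h2, sz]; omega⟩
  have : PolyC (fun a => ((f a).map (fun _ => ())).length) := h1.comp (by fun_prop)
  simpa using this

@[fun_prop]
theorem PolyC.add {f g : α → ℕ} (hf : PolyC f) (hg : PolyC g) : PolyC (fun a => f a + g a) := by
  have : PolyC (fun a => (List.replicate (f a) () ++ List.replicate (g a) ()).length) := by fun_prop
  simpa using this

@[fun_prop]
theorem PolyC.drop {f : α → List β} {n : α → ℕ} (hf : PolyC f) (hn : PolyC n) :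
    PolyC (fun a => (f a).drop (n a)) := by
  have : PolyC (fun a => (List.replicate (n a) ()).foldl (fun s _ => s.tail) (f a)) :=
    PolyC.foldl_add (F := fun _ s _ => s.tail) (by fun_prop) hf (by fun_prop) 0
      fun a s b => by cases s <;> simp; omega
  refine this.congr fun a => ?_
  generalize f a = s
  induction n a generalizing s with
  | zero => rfl
  | succ n ih => rw [List.replicate_succ, List.foldl_cons, ← ih, List.drop_tail]

@[fun_prop]
theorem PolyC.sub {f g : α → ℕ} (hf : PolyC f) (hg : PolyC g) : PolyC (fun a => f a - g a) := by
  have : PolyC (fun a => ((List.replicate (f a) ()).drop (g a)).length) := by fun_prop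
  simpa using this

@[fun_prop]
theorem PolyC.mul {f g : α → ℕ} (hf : PolyC f) (hg : PolyC g) : PolyC (fun a => f a * g a) := by
  have : PolyC (fun a => ((List.replicate (f a) ()).flatMap
    (fun _ => List.replicate (g a) ())).length) := by fun_prop
  simpa using this

@[fun_prop]
theorem PolyC.pow_const {f : α → ℕ} (hf : PolyC f) (c : ℕ) : PolyC (fun a => f a ^ c) := by
  induction c with
  | zero => simpa using PolyC.const 1
  | succ c ih => simp only [pow_succ]; fun_prop

@[fun_prop]
theorem PolyC.decide_le {f g : α → ℕ} (hf : PolyC f) (hg : PolyC g) :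
    PolyC (fun a => decide (f a ≤ g a)) := by
  have : PolyC (fun a => (List.replicate (f a - g a) ()).isEmpty) := by fun_prop
  refine this.congr fun a => ?_
  rw [Bool.eq_iff_iff]
  simp [Nat.sub_eq_zero_iff_le]

@[fun_prop]
theorem PolyC.decide_lt {f g : α → ℕ} (hf : PolyC f) (hg : PolyC g) :
    PolyC (fun a => decide (f a < g a)) := by
  have : PolyC (fun a => decide (f a + 1 ≤ g a)) := by fun_prop
  exact this

@[fun_prop]
theorem PolyC.decide_eq {f g : α → ℕ} (hf : PolyC f) (hg : PolyC g) :
    PolyC (fun a => decide (f a = g a)) := by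
  have : PolyC (fun a => decide (f a ≤ g a) && decide (g a ≤ f a)) := by fun_prop
  refine this.congr fun a => ?_
  rw [Bool.eq_iff_iff]
  simp [le_antisymm_iff]

@[fun_prop]
theorem PolyC.min {f g : α → ℕ} (hf : PolyC f) (hg : PolyC g) : PolyC (fun a => min (f a) (g a)) := by
  have : PolyC (fun a => bif decide (f a ≤ g a) then f a else g a) := by fun_prop
  refine this.congr fun a => ?_
  rcases le_or_gt (f a) (g a) with h | h
  · simp [h]
  · simp [h.le, not_le.2 h]

@[fun_prop]
theorem PolyC.range {f : α → ℕ} (hf : PolyC f) : PolyC (fun a => List.range (f a)) := by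
  have ⟨_, p, hp⟩ := hf
  have key : ∀ n, (List.replicate n ()).foldl (fun s _ => s.length :: s) [] =
      (List.range n).reverse := by
    intro n
    induction n with
    | zero => rfl
    | succ n ih => rw [List.replicate_succ', List.foldl_append, ih, List.range_succ]; simp
  have : PolyC (fun a => (List.replicate (f a) ()).foldl (fun s _ => s.length :: s) []) := by
    refine PolyC.foldl (F := fun _ s _ => s.length :: s) (by fun_prop) (by fun_prop) (by fun_prop)
      (p * p + p) fun a L' hL' => ?_
    obtain ⟨m, rfl⟩ : ∃ m, L' = List.replicate m () :=
      ⟨L'.length, List.eq_replicate_iff.2 ⟨rfl, fun _ _ => rfl⟩⟩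
    have hm : m ≤ p.eval (sz a) := by
      have h1 := hL'.length_le
      have h2 := (hp a).2
      simp at h1 h2
      omega
    rw [key, sz_eq_sum]
    simp only [Polynomial.eval_add, Polynomial.eval_mul, List.length_reverse, List.length_range,
      List.map_reverse, List.sum_reverse]
    have h3 := List.sum_le_card_nsmul ((List.range m).map sz) m (by
      simp only [List.mem_map, List.mem_range, forall_exists_index, and_imp]
      rintro _ x hx rfl
      simp; omega)
    simp only [List.length_map, List.length_range, smul_eq_mul] at h3
    have := Nat.mul_le_mul hm hm
    omega
  refine this.reverse.congr fun a => ?_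
  rw [key, List.reverse_reverse]

@[fun_prop]
theorem PolyC.replicate {f : α → ℕ} {g : α → β} (hf : PolyC f) (hg : PolyC g) :
    PolyC (fun a => List.replicate (f a) (g a)) := by
  have : PolyC (fun a => (List.range (f a)).map (fun _ => g a)) := by fun_prop
  simpa using this

@[fun_prop]
theorem PolyC.take {f : α → List β} {n : α → ℕ} (hf : PolyC f) (hn : PolyC n) :
    PolyC (fun a => (f a).take (n a)) := by
  have : PolyC (fun a => ((f a).reverse.drop ((f a).length - n a)).reverse) := by fun_prop
  refine this.congr fun a => ?_
  rw [List.drop_reverse, List.reverse_reverse]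
  rcases le_total (n a) (f a).length with h | h
  · congr 1; omega
  · rw [Nat.sub_eq_zero_of_le h, Nat.sub_zero, List.take_length, List.take_of_length_le h]

@[fun_prop]
theorem PolyC.getD {f : α → List β} {n : α → ℕ} {d : α → β} (hf : PolyC f) (hn : PolyC n)
    (hd : PolyC d) : PolyC (fun a => (f a).getD (n a) (d a)) := by
  have : PolyC (fun a => ((f a).drop (n a)).headD (d a)) := by fun_prop
  refine this.congr fun a => ?_
  simp [List.getD_eq_getElem?_getD, List.headD_eq_head?_getD, List.head?_drop]

@[fun_prop]
theorem PolyC.list_sum {f : α → List ℕ} (hf : PolyC f) : PolyC (fun a => (f a).sum) := by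
  have : PolyC (fun a => ((f a).flatMap (fun n => List.replicate n ())).length) := by fun_prop
  simpa [List.length_flatMap] using this

@[fun_prop]
theorem PolyC.div {f g : α → ℕ} (hf : PolyC f) (hg : PolyC g) : PolyC (fun a => f a / g a) := by
  have : PolyC (fun a => bif decide (g a = 0) then 0 else
    ((List.range (f a)).filter (fun i => decide ((i + 1) * g a ≤ f a))).length) := by fun_prop
  refine this.congr fun a => ?_
  rcases Nat.eq_zero_or_pos (g a) with h | h
  · simp [h]
  · have h1 : (List.range (f a)).filter (fun i => decide ((i + 1) * g a ≤ f a)) =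
        (List.range (f a)).filter (fun i => decide (i < f a / g a)) := by
      congr 1
      funext i
      rw [decide_eq_decide, ← Nat.le_div_iff_mul_le h]
      exact Iff.rfl
    have h2 : ∀ m n, m ≤ n → ((List.range n).filter (fun i => decide (i < m))).length = m := by
      intro m n hmn
      rw [← List.countP_eq_length_filter]
      induction n with
      | zero => simp; omega
      | succ n ih =>
        rw [List.range_succ, List.countP_append]
        rcases hmn.eq_or_lt with rfl | h
        · rw [List.countP_eq_length.2]
          · simp
          · intro i hi; simp at hi ⊢; omega
        · rw [ih (by omega)]; simp; omega
    simp only [h.ne', decide_false, cond_false]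
    rw [h1, h2 _ _ (Nat.div_le_self _ _)]

@[fun_prop]
theorem PolyC.mod {f g : α → ℕ} (hf : PolyC f) (hg : PolyC g) : PolyC (fun a => f a % g a) := by
  have : PolyC (fun a => f a - g a * (f a / g a)) := by fun_prop
  refine this.congr fun a => ?_
  have := Nat.div_add_mod (f a) (g a)
  omega

/-- Powers, cut off at a bound. -/
@[fun_prop]
theorem PolyC.min_pow {u b e : α → ℕ} (hu : PolyC u) (hb : PolyC b) (he : PolyC e) :
    PolyC (fun a => Min.min (u a) (b a ^ e a)) := by
  have ⟨_, p, hp⟩ := hu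
  have key : ∀ a n, (List.replicate n ()).foldl (fun s _ => Min.min (u a) (s * b a))
      (Min.min (u a) 1) = Min.min (u a) (b a ^ n) := by
    intro a n
    induction n with
    | zero => rfl
    | succ n ih =>
      rw [List.replicate_succ', List.foldl_append, ih, List.foldl_cons, List.foldl_nil, pow_succ]
      rcases Nat.eq_zero_or_pos (b a) with h | h
      · simp [h]
      · rcases le_total (u a) (b a ^ n) with h' | h'
        · rw [min_eq_left h', min_eq_left (Nat.le_mul_of_pos_right _ h),
            min_eq_left (h'.trans (Nat.le_mul_of_pos_right _ h))]
        · rw [min_eq_right h']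
  have : PolyC (fun a => (List.replicate (e a) ()).foldl (fun s _ => Min.min (u a) (s * b a))
      (Min.min (u a) 1)) := by
    refine PolyC.foldl (F := fun a s _ => Min.min (u a) (s * b a)) (by fun_prop) (by fun_prop)
      (by fun_prop) p fun a L' hL' => ?_
    obtain ⟨m, rfl⟩ : ∃ m, L' = List.replicate m () :=
      ⟨L'.length, List.eq_replicate_iff.2 ⟨rfl, fun _ _ => rfl⟩⟩
    have := (hp a).2
    rw [key]
    simp at this ⊢
    omega
  simpa only [key] using this

@[fun_prop]
theorem PolyC.decide_eq_bits {f g : α → Bits} (hf : PolyC f) (hg : PolyC g) :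
    PolyC (fun a => decide (f a = g a)) := by
  have : PolyC (fun a => decide ((f a).length = (g a).length) &&
    (List.range (f a).length).all (fun i => (f a).getD i false == (g a).getD i false)) := by fun_prop
  refine this.congr fun a => ?_
  rw [Bool.eq_iff_iff]
  simp only [decide_eq_true_eq, Bool.and_eq_true, List.all_eq_true, List.mem_range, beq_iff_eq]
  refine ⟨fun h => by simp [h], fun ⟨h1, h2⟩ => List.ext_getElem h1 fun i hi hi' => ?_⟩
  simpa [hi, hi'] using h2 i hi

/-! Primes -/

@[fun_prop]
theorem PolyC.decide_prime {f : α → ℕ} (hf : PolyC f) : PolyC (fun a => decide (f a).Prime) := by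
  have : PolyC (fun a => decide (2 ≤ f a) &&
    (List.range (f a)).all (fun d => decide (d < 2) || !decide (f a % d = 0))) := by fun_prop
  refine this.congr fun a => ?_
  rw [Bool.eq_iff_iff]
  simp only [decide_eq_true_eq, Bool.and_eq_true, List.all_eq_true, List.mem_range, Bool.or_eq_true,
    Bool.not_eq_true', decide_eq_false_iff_not, Nat.prime_def_lt', ← Nat.dvd_iff_mod_eq_zero]
  refine and_congr_right fun _ => ⟨fun h d hd => ?_, fun h d h2 hd => ?_⟩
  · rcases lt_or_ge d 2 with h' | h'
    · exact .inl h'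
    · exact .inr (h d h' hd)
  · exact (h d hd).resolve_left (by omega)

/-- The least prime greater than `v`. -/
def nextPrime (v : ℕ) : ℕ :=
  ((List.range (2 * v + 1)).filter (fun p => decide (v < p) && decide p.Prime)).headD 0

@[fun_prop]
theorem PolyC.nextPrime {f : α → ℕ} (hf : PolyC f) : PolyC (fun a => nextPrime (f a)) := by
  unfold SubstringEdits.nextPrime
  fun_prop

/-- Bertrand's postulate: the search range up to `2 * v` suffices, and the prime costs at most one
bit more than `v`. -/
theorem nextPrime_spec {v : ℕ} (hv : v ≠ 0) :
    (nextPrime v).Prime ∧ v < nextPrime v ∧ nextPrime v ≤ 2 * v := by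
  obtain ⟨p, hp, h1, h2⟩ := Nat.exists_prime_lt_and_le_two_mul v hv
  have hne : (List.range (2 * v + 1)).filter (fun p => decide (v < p) && decide p.Prime) ≠ [] :=
    List.ne_nil_of_mem (a := p) (by simp; exact ⟨by omega, h1, hp⟩)
  have hm : nextPrime v ∈
      (List.range (2 * v + 1)).filter (fun p => decide (v < p) && decide p.Prime) := by
    unfold nextPrime
    cases h : (List.range (2 * v + 1)).filter (fun p => decide (v < p) && decide p.Prime) with
    | nil => exact absurd h hne
    | cons a s => simp
  simp at hm
  exact ⟨hm.2.2, hm.2.1, by omega⟩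

/-! Binary expansions -/

-- A power of two may be too large for unary notation; cutting it off at `f a + 1` does not matter,
-- because the quotient is zero from there on.
@[fun_prop]
theorem PolyC.testBit {f g : α → ℕ} (hf : PolyC f) (hg : PolyC g) :
    PolyC (fun a => (f a).testBit (g a)) := by
  have : PolyC (fun a => decide (f a / Min.min (f a + 1) (2 ^ g a) % 2 = 1)) := by fun_prop
  refine this.congr fun a => ?_
  rw [Nat.testBit_eq_decide_div_mod_eq]
  rcases le_total (f a + 1) (2 ^ g a) with h | h
  · rw [min_eq_left h, Nat.div_eq_of_lt (by omega), Nat.div_eq_of_lt (by omega)]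
  · rw [min_eq_right h]

/-- The `b` lowest binary digits of `v`. -/
def natBits (b v : ℕ) : Bits := (List.range b).map (fun i => v.testBit i)

@[simp] theorem length_natBits (b v : ℕ) : (natBits b v).length = b := by simp [natBits]

@[fun_prop]
theorem PolyC.natBits {f g : α → ℕ} (hf : PolyC f) (hg : PolyC g) :
    PolyC (fun a => natBits (f a) (g a)) := by
  unfold SubstringEdits.natBits
  fun_prop

theorem natBits_inj {b v w : ℕ} (hv : v < 2 ^ b) (hw : w < 2 ^ b) (h : natBits b v = natBits b w) :
    v = w := by
  refine Nat.eq_of_testBit_eq fun i => ?_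
  rcases lt_or_ge i b with hi | hi
  · simp only [natBits, List.map_inj_left, List.mem_range] at h
    exact h i hi
  · have h2 : 2 ^ b ≤ 2 ^ i := Nat.pow_le_pow_right (by norm_num) hi
    rw [Nat.testBit_lt_two_pow (by omega), Nat.testBit_lt_two_pow (by omega)]

@[fun_prop]
theorem PolyC.clog {f : α → ℕ} (hf : PolyC f) : PolyC (fun a => Nat.clog 2 (f a)) := by
  have : PolyC (fun a => ((List.range (f a)).filter
    (fun i => decide (Min.min (f a) (2 ^ i) < f a))).length) := by fun_prop
  refine this.congr fun a => ?_
  have h1 : (List.range (f a)).filter (fun i => decide (Min.min (f a) (2 ^ i) < f a)) =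
      List.range (Nat.clog 2 (f a)) := by
    have h2 : Nat.clog 2 (f a) ≤ f a := Nat.clog_le_of_le_pow Nat.lt_two_pow_self.le
    obtain ⟨m, hm⟩ := Nat.exists_eq_add_of_le h2
    conv_lhs => rw [show List.range (f a) = List.range (Nat.clog 2 (f a) + m) by rw [← hm]]
    rw [List.range_add, List.filter_append, List.filter_eq_self.2, List.filter_eq_nil_iff.2,
      List.append_nil]
    · simp only [List.mem_map, List.mem_range, forall_exists_index, and_imp]
      rintro _ i - rfl
      have := (Nat.le_pow_clog (b := 2) (by norm_num) (f a)).trans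
        (Nat.pow_le_pow_right (by norm_num) (Nat.le_add_right _ i))
      simp [this]
    · intro i hi
      have := (Nat.lt_clog_iff_pow_lt (b := 2) (by norm_num)).1 (List.mem_range.1 hi)
      simp [this]
  rw [h1, List.length_range]

/-! Evaluation of polynomials -/

/-- Value at `a`, modulo `q`, of the polynomial with coefficient list `ds`, highest first. -/
def evalMod (q a : ℕ) (ds : List ℕ) : ℕ := ds.foldl (fun s d => min q ((s * a + d) % q)) 0

/-- The `min` in `evalMod` matters only for `q = 0`, where reduction modulo `q` does nothing: it
keeps the intermediate values at most `q` for all inputs. -/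
theorem PolyC.evalMod {q a : α → ℕ} {ds : α → List ℕ} (hq : PolyC q) (ha : PolyC a)
    (hds : PolyC ds) : PolyC (fun x => evalMod (q x) (a x) (ds x)) := by
  have ⟨_, p, hp⟩ := hq
  refine PolyC.foldl (F := fun x s d => Min.min (q x) ((s * a x + d) % q x)) (by fun_prop)
    (by fun_prop) hds p fun x L' _ => ?_
  have := (hp x).2
  rcases List.eq_nil_or_concat L' with rfl | ⟨L'', b, rfl⟩
  · simp
  · simp at this ⊢
    omega

attribute [fun_prop] PolyC.evalMod

theorem evalMod_cast {q : ℕ} (hq : 0 < q) (a : ℕ) (ds : List ℕ) :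
    (evalMod q a ds : ZMod q) =
      ds.foldl (fun (s : ZMod q) (d : ℕ) => s * (a : ZMod q) + (d : ZMod q)) 0 := by
  unfold evalMod
  have : ∀ s : ℕ, ((ds.foldl (fun s d => min q ((s * a + d) % q)) s : ℕ) : ZMod q) =
      ds.foldl (fun (s : ZMod q) (d : ℕ) => s * (a : ZMod q) + (d : ZMod q)) s := by
    induction ds with
    | nil => intro s; rfl
    | cons d ds ih =>
      intro s
      rw [List.foldl_cons, List.foldl_cons, ih, min_eq_right (Nat.mod_lt _ hq).le]
      simp
  simpa using this 0

theorem evalMod_lt {q : ℕ} (hq : 0 < q) (a : ℕ) (ds : List ℕ) : evalMod q a ds < q := by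
  rcases List.eq_nil_or_concat ds with rfl | ⟨L, b, rfl⟩
  · simpa [evalMod] using hq
  · simp only [evalMod, List.concat_eq_append, List.foldl_append, List.foldl_cons, List.foldl_nil]
    exact (min_le_right _ _).trans_lt (Nat.mod_lt _ hq)

open Polynomial in
/-- Distinct digit lists of length `m + 1` have the same value at no more than `m` points. -/
theorem card_evalMod_eq {q : ℕ} (hq : q.Prime) {m : ℕ} {u v : List ℕ} (hu : u.length = m + 1)
    (hv : v.length = m + 1) (huq : ∀ d ∈ u, d < q) (hvq : ∀ d ∈ v, d < q) (h : u ≠ v) :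
    ((Finset.range q).filter (fun a => evalMod q a u = evalMod q a v)).card ≤ m := by
  have := Fact.mk hq
  let g : List ℕ → (ZMod q)[X] := fun w => w.foldl (fun (s : (ZMod q)[X]) (d : ℕ) => s * X + C (d : ZMod q)) 0
  have g_app : ∀ (w : List ℕ) (d : ℕ), g (w ++ [d]) = g w * X + C (d : ZMod q) := fun w d => by simp [g]
  have g_eval : ∀ w (a : ℕ), (g w).eval (a : ZMod q) = evalMod q a w := by
    intro w a
    rw [evalMod_cast hq.pos]
    induction w using List.reverseRecOn with
    | nil => simp [g]
    | append_singleton w d ih => rw [g_app]; simp [ih]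
  have g_deg : ∀ w, (g w).natDegree ≤ w.length - 1 := by
    intro w
    induction w using List.reverseRecOn with
    | nil => simp [g]
    | append_singleton w d ih =>
      rw [g_app]
      refine (natDegree_add_C).le.trans ?_
      rcases List.eq_nil_or_concat w with rfl | ⟨w', d', rfl⟩
      · simp [g]
      · refine (natDegree_mul_le).trans ?_
        simp at ih ⊢
        omega
  -- The last digit is the constant coefficient, recovered because digits are below `q`; the rest
  -- follows by cancelling `X`.
  have g_inj : ∀ w w' : List ℕ, w.length = w'.length → (∀ d ∈ w, d < q) → (∀ d ∈ w', d < q) →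
      g w = g w' → w = w' := by
    intro w
    induction w using List.reverseRecOn with
    | nil => intro w' hl _ _ _; exact (List.length_eq_zero_iff.1 hl.symm).symm
    | append_singleton w d ih =>
      intro w' hl h1 h2 he
      rcases List.eq_nil_or_concat w' with rfl | ⟨w', d', rfl⟩
      · simp at hl
      · rw [List.concat_eq_append] at *
        rw [g_app, g_app] at he
        have hd : (d : ZMod q) = d' := by simpa using congrArg (fun p => p.coeff 0) he
        rw [hd] at he
        have hw : g w = g w' := mul_right_cancel₀ X_ne_zero (add_right_cancel he)
        have := ih w' (by simpa using hl) (fun x hx => h1 x (by simp [hx]))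
          (fun x hx => h2 x (by simp [hx])) hw
        rw [this]
        congr 2
        have h3 := (ZMod.natCast_eq_natCast_iff' _ _ _).1 hd
        rwa [Nat.mod_eq_of_lt (h1 d (by simp)), Nat.mod_eq_of_lt (h2 d' (by simp))] at h3
  have hne : g u - g v ≠ 0 := fun h0 =>
    h (g_inj u v (by omega) huq hvq (sub_eq_zero.1 h0))
  calc _ ≤ (g u - g v).roots.toFinset.card := by
        refine Finset.card_le_card_of_injOn (fun a => (a : ZMod q)) ?_ ?_
        · intro a ha
          simp only [Finset.coe_filter, Finset.mem_range, Set.mem_ofPred_eq] at ha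
          simp only [Finset.mem_coe, Multiset.mem_toFinset, mem_roots hne, IsRoot.def, eval_sub,
            g_eval, ha.2, sub_self]
        · intro a ha b hb hab
          simp only [Finset.coe_filter, Finset.mem_range, Set.mem_ofPred_eq] at ha hb
          have h3 := (ZMod.natCast_eq_natCast_iff' _ _ _).1 hab
          rwa [Nat.mod_eq_of_lt ha.1, Nat.mod_eq_of_lt hb.1] at h3
    _ ≤ (g u - g v).roots.card := Multiset.toFinset_card_le _
    _ ≤ (g u - g v).natDegree := card_roots' _
    _ ≤ m := by
        refine (natDegree_sub_le _ _).trans (max_le ?_ ?_)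
        · have := g_deg u; omega
        · have := g_deg v; omega

/-! ### Graph coloring by polynomial evaluation -/

/-- The least point at which the polynomial `u` differs modulo `q` from all polynomials of `vs`. -/
def sepPoint (q : ℕ) (u : List ℕ) (vs : List (List ℕ)) : ℕ :=
  ((List.range q).filter (fun a =>
    vs.all (fun v => !decide (evalMod q a v = evalMod q a u)))).headD 0

/-- A point separating `u` from `vs`, and the value of `u` there. -/
def separate (q : ℕ) (u : List ℕ) (vs : List (List ℕ)) : ℕ × ℕ :=
  (sepPoint q u vs, evalMod q (sepPoint q u vs) u)

@[fun_prop]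
theorem PolyC.separate {q : α → ℕ} {u : α → List ℕ} {vs : α → List (List ℕ)} (hq : PolyC q)
    (hu : PolyC u) (hvs : PolyC vs) : PolyC (fun x => separate (q x) (u x) (vs x)) := by
  unfold SubstringEdits.separate sepPoint
  fun_prop

/-- Each member of `vs` spoils at most `m` points, so fewer than `q` points are spoiled altogether
and the search succeeds before its default value is used. -/
theorem sepPoint_spec {q : ℕ} (hq : q.Prime) {m : ℕ} {u : List ℕ} {vs : List (List ℕ)}
    (hu : u.length = m + 1) (huq : ∀ d ∈ u, d < q)
    (hvs : ∀ v ∈ vs, v.length = m + 1 ∧ (∀ d ∈ v, d < q) ∧ v ≠ u) (hm : m * vs.length < q) :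
    sepPoint q u vs < q ∧
      ∀ v ∈ vs, evalMod q (sepPoint q u vs) v ≠ evalMod q (sepPoint q u vs) u := by
  have hne : (List.range q).filter (fun a =>
      vs.all (fun v => !decide (evalMod q a v = evalMod q a u))) ≠ [] := by
    intro h0
    have h1 : Finset.range q ⊆ vs.toFinset.biUnion (fun v =>
        (Finset.range q).filter (fun a => evalMod q a v = evalMod q a u)) := by
      intro a ha
      rw [List.filter_eq_nil_iff] at h0
      have h2 := h0 a (List.mem_range.2 (Finset.mem_range.1 ha))
      simp only [List.all_eq_true, Bool.not_eq_true', decide_eq_false_iff_not, not_forall,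
        not_not] at h2
      obtain ⟨v, hv, h⟩ := h2
      simp only [Finset.mem_biUnion, List.mem_toFinset, Finset.mem_filter]
      exact ⟨v, hv, ha, h⟩
    have h2 := (Finset.card_le_card h1).trans (Finset.card_biUnion_le_card_mul _ _ m fun v hv => by
      obtain ⟨h3, h4, h5⟩ := hvs v (List.mem_toFinset.1 hv)
      exact card_evalMod_eq hq h3 hu h4 huq h5)
    have h3 := Nat.mul_le_mul_right m (List.toFinset_card_le vs)
    rw [Finset.card_range] at h2
    rw [mul_comm] at h3
    lia
  have hmem : sepPoint q u vs ∈ (List.range q).filter (fun a =>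
      vs.all (fun v => !decide (evalMod q a v = evalMod q a u))) := by
    unfold sepPoint
    cases h : (List.range q).filter (fun a =>
      vs.all (fun v => !decide (evalMod q a v = evalMod q a u))) with
    | nil => exact absurd h hne
    | cons a s => simp
  simpa using hmem

/-- Equal colors would have the same point, and at the point chosen for `u` the values differ. As
nothing is required of `vs'`, the neighbor relation need not be symmetric. -/
theorem separate_ne {q : ℕ} {u v : List ℕ} {vs vs' : List (List ℕ)}
    (h : evalMod q (sepPoint q u vs) v ≠ evalMod q (sepPoint q u vs) u) :
    separate q u vs ≠ separate q v vs' := by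
  intro he
  simp only [separate, Prod.mk.injEq] at he
  rw [← he.1] at he
  exact h he.2.symm

/-- The four digits in base `q` of a pair of numbers less than `q ^ 2`. -/
def pairDigits (q : ℕ) (c : ℕ × ℕ) : List ℕ := [c.1 % q, c.1 / q, c.2 % q, c.2 / q]

@[fun_prop]
theorem PolyC.pairDigits {q : α → ℕ} {c : α → ℕ × ℕ} (hq : PolyC q) (hc : PolyC c) :
    PolyC (fun x => pairDigits (q x) (c x)) := by
  unfold SubstringEdits.pairDigits
  fun_prop

theorem pairDigits_inj {q : ℕ} {c d : ℕ × ℕ} (h : pairDigits q c = pairDigits q d) : c = d := by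
  simp only [pairDigits, List.cons.injEq] at h
  obtain ⟨h1, h2, h3, h4, -⟩ := h
  have := Nat.div_add_mod c.1 q
  have := Nat.div_add_mod d.1 q
  have := Nat.div_add_mod c.2 q
  have := Nat.div_add_mod d.2 q
  rw [h1, h2] at *
  rw [h3, h4] at *
  ext <;> omega

theorem pairDigits_lt {q : ℕ} (hq : 0 < q) {c : ℕ × ℕ} (h1 : c.1 < q * q) (h2 : c.2 < q * q) :
    ∀ d ∈ pairDigits q c, d < q := by
  simp only [pairDigits, List.mem_cons, List.not_mem_nil, or_false]
  rintro d (rfl | rfl | rfl | rfl)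
  · exact Nat.mod_lt _ hq
  · exact Nat.div_lt_of_lt_mul h1
  · exact Nat.mod_lt _ hq
  · exact Nat.div_lt_of_lt_mul h2

/-- A bit string as a list of numbers. -/
def bitDigits (x : Bits) : List ℕ := x.map (fun b => bif b then 1 else 0)

@[fun_prop]
theorem PolyC.bitDigits {x : α → Bits} (hx : PolyC x) : PolyC (fun a => bitDigits (x a)) := by
  unfold SubstringEdits.bitDigits
  fun_prop

theorem bitDigits_inj {x y : Bits} (h : bitDigits x = bitDigits y) : x = y := by
  refine List.map_injective_iff.2 ?_ h
  intro a b
  cases a <;> cases b <;> simp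

variable {ι : Type} (nb : ι × Bits → List Bits) (Δ n : ι → ℕ)

/-- The neighbors of `x` other than `x` itself. -/
def properNb (e : ι) (x : Bits) : List Bits := (nb (e, x)).filter (fun z => !decide (z = x))

/-- First coloring, with polynomially many colors. -/
def coarseColor (e : ι) (x : Bits) : ℕ × ℕ :=
  separate (nextPrime (n e * Δ e)) (bitDigits x) ((properNb nb e x).map bitDigits)

/-- Length of the two halves of the final colors, less one. -/
def colorBits (e : ι) : ℕ := Nat.clog 2 (3 * Δ e + 1)

/-- The final coloring, as a pair of numbers. -/
def fineColor (e : ι) (x : Bits) : ℕ × ℕ :=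
  separate (nextPrime (min (8 * Δ e + 8) (2 ^ colorBits Δ e)))
    (pairDigits (nextPrime (min (8 * Δ e + 8) (2 ^ colorBits Δ e))) (coarseColor nb Δ n e x))
    ((properNb nb e x).map (fun z =>
      pairDigits (nextPrime (min (8 * Δ e + 8) (2 ^ colorBits Δ e))) (coarseColor nb Δ n e z)))

/-- The final coloring. -/
def color (e : ι) (x : Bits) : Bits :=
  natBits (colorBits Δ e + 1) (fineColor nb Δ n e x).1 ++
    natBits (colorBits Δ e + 1) (fineColor nb Δ n e x).2

variable {nb Δ n}

@[fun_prop]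
theorem PolyC.properNb [Enc ι] (hnb : PolyC nb) {e : β → ι} {x : β → Bits}
    (he : PolyC e) (hx : PolyC x) : PolyC (fun b => properNb nb (e b) (x b)) := by
  unfold SubstringEdits.properNb
  fun_prop

@[fun_prop]
theorem PolyC.coarseColor [Enc ι] (hnb : PolyC nb) (hΔ : PolyC Δ) (hn : PolyC n) {e : β → ι}
    {x : β → Bits} (he : PolyC e) (hx : PolyC x) :
    PolyC (fun b => coarseColor nb Δ n (e b) (x b)) := by
  unfold SubstringEdits.coarseColor
  fun_prop

@[fun_prop]
theorem PolyC.colorBits [Enc ι] (hΔ : PolyC Δ) {e : β → ι} (he : PolyC e) :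
    PolyC (fun b => colorBits Δ (e b)) := by
  unfold SubstringEdits.colorBits
  fun_prop

@[fun_prop]
theorem PolyC.fineColor [Enc ι] (hnb : PolyC nb) (hΔ : PolyC Δ) (hn : PolyC n) {e : β → ι}
    {x : β → Bits} (he : PolyC e) (hx : PolyC x) :
    PolyC (fun b => fineColor nb Δ n (e b) (x b)) := by
  have h1 : PolyC (fun b =>
      SubstringEdits.nextPrime (Min.min (8 * Δ (e b) + 8) (2 ^ SubstringEdits.colorBits Δ (e b)))) := by fun_prop
  exact PolyC.separate h1 (h1.pairDigits (hnb.coarseColor hΔ hn he hx))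
    (PolyC.map ((h1.comp .fst').pairDigits (hnb.coarseColor hΔ hn (he.comp .fst') .snd'))
      (hnb.properNb he hx))

theorem PolyC.color [Enc ι] (hnb : PolyC nb) (hΔ : PolyC Δ) (hn : PolyC n) {e : β → ι}
    {x : β → Bits} (he : PolyC e) (hx : PolyC x) :
    PolyC (fun b => color nb Δ n (e b) (x b)) :=
  .append (((hΔ.colorBits he).add (.const 1)).natBits (hnb.fineColor hΔ hn he hx).fst)
    (((hΔ.colorBits he).add (.const 1)).natBits (hnb.fineColor hΔ hn he hx).snd)

@[simp] theorem length_color (e : ι) (x : Bits) :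
    (color nb Δ n e x).length = 2 * (colorBits Δ e + 1) := by
  simp [color]; ring

/-- The power is below twice `3 * Δ e + 1`, so the cut-off is not felt; it only serves to make the
power visibly computable in unary. -/
theorem two_pow_colorBits (e : ι) : min (8 * Δ e + 8) (2 ^ colorBits Δ e) = 2 ^ colorBits Δ e := by
  refine min_eq_right ?_
  unfold colorBits
  rcases Nat.eq_zero_or_pos (Δ e) with h | h
  · simp [h]
  · have := Nat.pow_pred_clog_lt_self (b := 2) (by norm_num) (x := 3 * Δ e + 1) (by omega)
    have h1 : 0 < Nat.clog 2 (3 * Δ e + 1) := Nat.clog_pos (by norm_num) (by omega)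
    obtain ⟨m, hm⟩ := Nat.exists_eq_add_of_lt h1
    rw [hm] at this ⊢
    simp [pow_succ] at this ⊢
    omega

/-- The coloring is proper if `Δ` bounds the number of neighbors. -/
theorem color_ne {e : ι} (hn0 : 0 < n e) (hnΔ : n e ≤ Δ e)
    (hnb : ∀ x : Bits, x.length = n e →
      (nb (e, x)).length ≤ Δ e ∧ ∀ z ∈ nb (e, x), z.length = n e)
    {x x' : Bits} (hx : x.length = n e) (hx' : x' ∈ nb (e, x)) (hne : x' ≠ x) :
    color nb Δ n e x ≠ color nb Δ n e x' := by
  have hΔ : 0 < Δ e := by omega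
  obtain ⟨hq, hq1, hq2⟩ := nextPrime_spec (v := n e * Δ e) (by positivity)
  obtain ⟨hr, hr1, hr2⟩ := nextPrime_spec (v := 2 ^ colorBits Δ e) (by positivity)
  have hb : 3 * Δ e + 1 ≤ 2 ^ colorBits Δ e := Nat.le_pow_clog (by norm_num) _
  set q := nextPrime (n e * Δ e) with hqdef
  set r := nextPrime (2 ^ colorBits Δ e) with hrdef
  have hproper : ∀ z, z.length = n e → (properNb nb e z).length ≤ Δ e ∧
      ∀ w ∈ properNb nb e z, w.length = n e ∧ w ≠ z := by
    intro z hz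
    refine ⟨(List.length_filter_le _ _).trans (hnb z hz).1, fun w hw => ?_⟩
    simp only [properNb, List.mem_filter, Bool.not_eq_true', decide_eq_false_iff_not] at hw
    exact ⟨(hnb z hz).2 w hw.1, hw.2⟩
  have hbit : ∀ z, ∀ d ∈ bitDigits z, d < q := by
    intro z d hd
    have := hq.two_le
    simp only [bitDigits, List.mem_map] at hd
    obtain ⟨b, -, rfl⟩ := hd
    cases b <;> simp <;> omega
  have hc : ∀ z : Bits, z.length = n e → sepPoint q (bitDigits z) ((properNb nb e z).map bitDigits) < q ∧
      ∀ v ∈ (properNb nb e z).map bitDigits,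
        evalMod q (sepPoint q (bitDigits z) ((properNb nb e z).map bitDigits)) v ≠
        evalMod q (sepPoint q (bitDigits z) ((properNb nb e z).map bitDigits)) (bitDigits z) := by
    intro z hz
    obtain ⟨h1, h2⟩ := hproper z hz
    refine sepPoint_spec hq (m := n e - 1) (by simp [bitDigits]; omega) (hbit z) ?_ ?_
    · simp only [List.mem_map, forall_exists_index, and_imp]
      rintro _ w hw rfl
      obtain ⟨h3, h4⟩ := h2 w hw
      exact ⟨by simp [bitDigits]; omega, hbit w, fun h => h4 (bitDigits_inj h)⟩
    · rw [List.length_map]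
      have := Nat.mul_le_mul (Nat.sub_le (n e) 1) h1
      omega
  have hcoarse : ∀ z, z.length = n e → ∀ w ∈ properNb nb e z,
      coarseColor nb Δ n e z ≠ coarseColor nb Δ n e w := fun z hz w hw =>
    separate_ne ((hc z hz).2 _ (List.mem_map_of_mem hw))
  -- The first colors are pairs of numbers below `q ≤ 2nΔ ≤ 2Δ²`, and `r > 3Δ`: two digits in base
  -- `r` suffice for each number. This is where `n ≤ Δ` is needed.
  have hqr : q ≤ r * r := by
    have h1 : (3 * Δ e) * (3 * Δ e) ≤ r * r := Nat.mul_le_mul (by omega) (by omega)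
    have h2 : n e * Δ e ≤ Δ e * Δ e := Nat.mul_le_mul_right _ hnΔ
    nlinarith
  have hdig : ∀ z, z.length = n e → ∀ d ∈ pairDigits r (coarseColor nb Δ n e z), d < r := by
    intro z hz
    exact pairDigits_lt hr.pos ((hc z hz).1.trans_le hqr) ((evalMod_lt hq.pos _ _).trans_le hqr)
  obtain ⟨h1, h2⟩ := hproper x hx
  -- Four digits make a cubic, so that `r > 3Δ` leaves a good point.
  have hfine := sepPoint_spec hr (m := 3) (u := pairDigits r (coarseColor nb Δ n e x))
    (vs := (properNb nb e x).map (fun z => pairDigits r (coarseColor nb Δ n e z))) rfl (hdig x hx)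
    (by
      simp only [List.mem_map, forall_exists_index, and_imp]
      rintro _ w hw rfl
      exact ⟨rfl, hdig w (h2 w hw).1, fun h => hcoarse x hx w hw (pairDigits_inj h).symm⟩)
    (by rw [List.length_map]; omega)
  have hxp : x' ∈ properNb nb e x := by simp [properNb, hx', hne]
  have hbd : ∀ z, z.length = n e → (fineColor nb Δ n e z).1 < 2 ^ (colorBits Δ e + 1) ∧
      (fineColor nb Δ n e z).2 < 2 ^ (colorBits Δ e + 1) := by
    intro z hz
    obtain ⟨h1, h2⟩ := hproper z hz
    have hfine := sepPoint_spec hr (m := 3) (u := pairDigits r (coarseColor nb Δ n e z))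
      (vs := (properNb nb e z).map (fun z => pairDigits r (coarseColor nb Δ n e z))) rfl (hdig z hz)
      (by
        simp only [List.mem_map, forall_exists_index, and_imp]
        rintro _ w hw rfl
        exact ⟨rfl, hdig w (h2 w hw).1, fun h => hcoarse z hz w hw (pairDigits_inj h).symm⟩)
      (by rw [List.length_map]; omega)
    rw [fineColor, two_pow_colorBits, ← hrdef, pow_succ]
    have h3 := evalMod_lt hr.pos (sepPoint r (pairDigits r (coarseColor nb Δ n e z))
      ((properNb nb e z).map (fun z => pairDigits r (coarseColor nb Δ n e z))))
      (pairDigits r (coarseColor nb Δ n e z))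
    simp only [separate]
    omega
  intro heq
  obtain ⟨h3, h4⟩ := List.append_inj heq (by simp)
  have h5 := natBits_inj (hbd x hx).1 (hbd x' (h2 x' hxp).1).1 h3
  have h6 := natBits_inj (hbd x hx).2 (hbd x' (h2 x' hxp).1).2 h4
  have h7 := Prod.ext h5 h6
  rw [fineColor, fineColor, two_pow_colorBits, ← hrdef] at h7
  exact separate_ne (hfine.2 _ (List.mem_map_of_mem hxp)) h7

/-! ### Words with erasures -/

/-- Bit strings in which some positions are erased. -/
abbrev Mask : Type := List (Option Bool)

/-- A bit string without erasures. -/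
def lift (x : Bits) : Mask := x.map some

/-- `t` arises from `s` by filling some of the erasures. -/
def Refines (s t : Mask) : Prop := List.Forall₂ (fun o o' => o = none ∨ o = o') s t

theorem Refines.refl (s : Mask) : Refines s s := List.forall₂_same.2 fun _ _ => .inr rfl

theorem Refines.trans {s t u : Mask} (h : Refines s t) (h' : Refines t u) : Refines s u := by
  induction h generalizing u with
  | nil => exact h'
  | cons h1 _ ih =>
    cases h' with
    | cons h2 h3 =>
      refine .cons ?_ (ih h3)
      rcases h1 with rfl | rfl
      · exact .inl rfl
      · exact h2

theorem Refines.length_eq {s t : Mask} (h : Refines s t) : s.length = t.length :=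
  List.Forall₂.length_eq h

theorem refines_lift_iff {s : Mask} {x : Bits} :
    Refines s (lift x) ↔ s.length = x.length ∧
      ∀ i < s.length, s.getD i none = none ∨ s.getD i none = some (x.getD i false) := by
  unfold Refines lift
  rw [List.forall₂_iff_get]
  simp only [List.length_map, List.get_eq_getElem, List.getElem_map]
  refine and_congr_right fun h => ⟨fun h' i hi => ?_, fun h' i hi hi' => ?_⟩
  · simpa [hi, h ▸ hi] using h' i hi (h ▸ hi)
  · simpa [hi, hi'] using h' i hi

@[fun_prop]
theorem PolyC.lift {x : α → Bits} (hx : PolyC x) : PolyC (fun a => lift (x a)) := by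
  unfold SubstringEdits.lift
  fun_prop

open Classical in
@[fun_prop]
theorem PolyC.decide_refines {s : α → Mask} {x : α → Bits} (hs : PolyC s) (hx : PolyC x) :
    PolyC (fun a => decide (Refines (s a) (SubstringEdits.lift (x a)))) := by
  have : PolyC (fun a => decide ((s a).length = (x a).length) &&
    (List.range (s a).length).all (fun i => ((s a).getD i none).isNone ||
      (((s a).getD i none).getD false == (x a).getD i false && !((s a).getD i none).isNone))) := by
    fun_prop
  refine this.congr fun a => ?_
  rw [Bool.eq_iff_iff]
  simp only [decide_eq_true_eq, Bool.and_eq_true, List.all_eq_true, List.mem_range, Bool.or_eq_true,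
    refines_lift_iff]
  refine and_congr_right fun _ => forall₂_congr fun i _ => ?_
  cases (s a).getD i none <;> simp

/-! Substring edits with unknown inserted string -/

/-- All results of replacing a substring of length at most `l`, starting before position `R`, by at
most `l` erasures. -/
def masks1 (R l : ℕ) (s : Mask) : List Mask :=
  (List.range R).flatMap fun i => (List.range (l + 1)).flatMap fun u =>
    (List.range (l + 1)).map fun v => s.take i ++ List.replicate v none ++ s.drop (i + u)

/-- All results of `j` such replacements. -/
def maskSteps (R l : ℕ) : ℕ → Mask → List Mask
  | 0, s => [s]
  | j + 1, s => (masks1 R l s).flatMap (maskSteps R l j)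

@[fun_prop]
theorem PolyC.masks1 {R l : α → ℕ} {s : α → Mask} (hR : PolyC R) (hl : PolyC l) (hs : PolyC s) :
    PolyC (fun a => masks1 (R a) (l a) (s a)) := by
  unfold SubstringEdits.masks1
  fun_prop

@[fun_prop]
theorem PolyC.maskSteps {R l : α → ℕ} {s : α → Mask} (hR : PolyC R) (hl : PolyC l) (hs : PolyC s)
    (j : ℕ) : PolyC (fun a => maskSteps (R a) (l a) j (s a)) := by
  have key : PolyC (fun p : ℕ × ℕ × Mask => SubstringEdits.maskSteps p.1 p.2.1 j p.2.2) := by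
    induction j with
    | zero => unfold SubstringEdits.maskSteps; fun_prop
    | succ j ih =>
      unfold SubstringEdits.maskSteps
      refine PolyC.flatMap (F := fun (p : ℕ × ℕ × Mask) t => SubstringEdits.maskSteps p.1 p.2.1 j t) ?_ (by fun_prop)
      exact ih.comp (by fun_prop : PolyC fun q : (ℕ × ℕ × Mask) × Mask => (q.1.1, q.1.2.1, q.2))
  exact key.comp (hR.mk (hl.mk hs))

theorem mem_masks1 {R l : ℕ} {s t : Mask} : t ∈ masks1 R l s ↔ ∃ i < R, ∃ u ≤ l, ∃ v ≤ l,
    t = s.take i ++ List.replicate v none ++ s.drop (i + u) := by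
  simp only [masks1, List.mem_flatMap, List.mem_map, List.mem_range, Nat.lt_succ_iff, eq_comm]

theorem length_masks1 (R l : ℕ) (s : Mask) : (masks1 R l s).length = R * (l + 1) ^ 2 := by
  simp [masks1, List.length_flatMap, pow_two]

theorem length_maskSteps (R l j : ℕ) (s : Mask) :
    (maskSteps R l j s).length = (R * (l + 1) ^ 2) ^ j := by
  induction j generalizing s with
  | zero => rfl
  | succ j ih =>
    rw [maskSteps, List.length_flatMap, List.map_congr_left (g := fun _ => (R * (l + 1) ^ 2) ^ j)
      fun t _ => ih t]
    simp [length_masks1, pow_succ, mul_comm]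

theorem maskSteps_add {R l i j : ℕ} {s t u : Mask} (h : t ∈ maskSteps R l i s)
    (h' : u ∈ maskSteps R l j t) : u ∈ maskSteps R l (i + j) s := by
  induction i generalizing s with
  | zero => simp only [maskSteps, List.mem_singleton] at h; subst h; simpa using h'
  | succ i ih =>
    simp only [maskSteps, List.mem_flatMap] at h
    obtain ⟨v, hv, h⟩ := h
    rw [Nat.add_right_comm]
    simp only [maskSteps, List.mem_flatMap]
    exact ⟨v, hv, ih h⟩

/-- The definition splits off the first replacement; for counting and covering erasures it is the
last one that has to be split off. -/
theorem maskSteps_succ' {R l j : ℕ} {s u : Mask} : u ∈ maskSteps R l (j + 1) s ↔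
    ∃ t ∈ maskSteps R l j s, u ∈ masks1 R l t := by
  induction j generalizing s with
  | zero => simp [maskSteps]
  | succ j ih =>
    rw [maskSteps, List.mem_flatMap]
    simp only [ih]
    simp only [maskSteps, List.mem_flatMap]
    exact ⟨fun ⟨v, hv, t, ht, hu⟩ => ⟨t, ⟨v, hv, ht⟩, hu⟩,
      fun ⟨t, ⟨v, hv, ht⟩, hu⟩ => ⟨v, hv, t, ht, hu⟩⟩

/-- A replacement depends on a position and two lengths only, not on the symbols, so the same one
can be applied to the less filled mask. Thus later edits can be carried out without knowing what
earlier ones inserted. -/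
theorem Refines.masks1 {R l : ℕ} {s t t' : Mask} (h : Refines s t) (ht : t' ∈ masks1 R l t) :
    ∃ s' ∈ masks1 R l s, Refines s' t' := by
  obtain ⟨i, hi, u, hu, v, hv, rfl⟩ := mem_masks1.1 ht
  refine ⟨_, mem_masks1.2 ⟨i, hi, u, hu, v, hv, rfl⟩, ?_⟩
  exact List.rel_append (List.rel_append (List.forall₂_take i h) (Refines.refl _))
    (List.forall₂_drop _ h)

theorem Refines.maskSteps {R l j : ℕ} {s t t' : Mask} (h : Refines s t)
    (ht : t' ∈ maskSteps R l j t) : ∃ s' ∈ maskSteps R l j s, Refines s' t' := by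
  induction j generalizing s t with
  | zero =>
    simp only [SubstringEdits.maskSteps, List.mem_singleton] at ht
    subst ht
    exact ⟨s, by simp [SubstringEdits.maskSteps], h⟩
  | succ j ih =>
    simp only [SubstringEdits.maskSteps, List.mem_flatMap] at ht
    obtain ⟨v, hv, ht⟩ := ht
    obtain ⟨w, hw, h1⟩ := h.masks1 hv
    obtain ⟨s', hs', h2⟩ := ih h1 ht
    exact ⟨s', List.mem_flatMap.2 ⟨w, hw, hs'⟩, h2⟩

theorem Edit.exists_mask {R l : ℕ} {x y : Bits} (h : Edit l x y) (hR : x.length < R) :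
    ∃ s ∈ masks1 R l (lift x), Refines s (lift y) := by
  obtain ⟨a, u, v, b, rfl, rfl, hu, hv⟩ := h
  simp only [List.length_append] at hR
  refine ⟨_, mem_masks1.2 ⟨a.length, by omega, u.length, hu, v.length, hv, rfl⟩, ?_⟩
  have h1 : (lift (a ++ u ++ b)).take a.length = lift a := by simp [lift]
  have h2 : (lift (a ++ u ++ b)).drop (a.length + u.length) = lift b := by
    rw [← List.length_append, lift, List.map_append, List.drop_append]
    simp [lift]
  have h3 : lift (a ++ v ++ b) = lift a ++ lift v ++ lift b := by simp [lift]
  rw [h1, h2, h3]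
  refine List.rel_append (List.rel_append (Refines.refl _) ?_) (Refines.refl _)
  rw [List.forall₂_iff_get]
  simp [lift]

/-! ### Reversibility of the channel and the masks of its outputs. -/

theorem Edit.symm {l : ℕ} {x y : Bits} (h : Edit l x y) : Edit l y x := by
  obtain ⟨a, u, v, b, hx, hy, hu, hv⟩ := h
  exact ⟨a, v, u, b, hy, hx, hv, hu⟩

theorem Edit.length_le {l : ℕ} {x y : Bits} (h : Edit l x y) : y.length ≤ x.length + l := by
  obtain ⟨a, u, v, b, rfl, rfl, hu, hv⟩ := h
  simp only [List.length_append]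
  omega

theorem channel_length_le {l k : ℕ} {x y : Bits} (h : y ∈ channel l k x) :
    y.length ≤ x.length + k * l := by
  induction k generalizing x with
  | zero => cases h; simp
  | succ k ih =>
    obtain ⟨z, hz, h⟩ := h
    have := ih h
    have := hz.length_le
    rw [add_mul]
    omega

theorem channel_snoc {l k : ℕ} {x y z : Bits} (h : y ∈ channel l k x) (h' : Edit l y z) :
    z ∈ channel l (k + 1) x := by
  induction k generalizing x with
  | zero => cases h; exact ⟨z, h', rfl⟩
  | succ k ih =>
    obtain ⟨w, hw, h⟩ := h
    exact ⟨w, hw, ih h⟩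

theorem channel_symm {l k : ℕ} {x y : Bits} (h : y ∈ channel l k x) : x ∈ channel l k y := by
  induction k generalizing x with
  | zero => cases h; rfl
  | succ k ih =>
    obtain ⟨z, hz, h⟩ := h
    exact channel_snoc (ih h) hz.symm

/-- The length grows by at most `l` per edit, hence under `hR` all edits take place before position
`R`. -/
theorem exists_mask_of_mem_channel {R l k : ℕ} {x y : Bits} (h : y ∈ channel l k x)
    (hR : x.length + k * l < R) : ∃ s ∈ maskSteps R l k (lift x), Refines s (lift y) := by
  induction k generalizing x with
  | zero => cases h; exact ⟨_, by simp [maskSteps], Refines.refl _⟩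
  | succ k ih =>
    obtain ⟨z, hz, h⟩ := h
    have := hz.length_le
    rw [add_mul] at hR
    obtain ⟨s, hs, h1⟩ := ih h (by omega)
    obtain ⟨t, ht, h2⟩ := hz.exists_mask (R := R) (by omega)
    obtain ⟨s', hs', h3⟩ := h2.maskSteps hs
    exact ⟨s', List.mem_flatMap.2 ⟨t, ht, hs'⟩, h3.trans h1⟩

/-- Two inputs of the channel with a common output. -/
theorem exists_mask_of_mem_channel₂ {R l k : ℕ} {x x' y : Bits} {t : Mask}
    (h : y ∈ channel l k x) (ht : t ∈ maskSteps R l k (lift y)) (hx' : Refines t (lift x'))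
    (hR : x.length + k * l < R) :
    ∃ s ∈ maskSteps R l (2 * k) (lift x), Refines s (lift x') := by
  obtain ⟨s, hs, h1⟩ := exists_mask_of_mem_channel h hR
  obtain ⟨s', hs', h2⟩ := h1.maskSteps ht
  exact ⟨s', two_mul k ▸ maskSteps_add hs hs', h2.trans hx'⟩

/-! The erasures after several edits -/

theorem count_none_maskSteps {R l j : ℕ} {s t : Mask} (h : t ∈ maskSteps R l j s) :
    t.count none ≤ s.count none + j * l := by
  induction j generalizing t with
  | zero => simp only [maskSteps, List.mem_singleton] at h; subst h; simp
  | succ j ih =>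
    obtain ⟨u, hu, h⟩ := maskSteps_succ'.1 h
    obtain ⟨i, hi, p, hp, v, hv, rfl⟩ := mem_masks1.1 h
    have h1 := ih hu
    have h2 : (u.drop (i + p)).count none ≤ (u.drop i).count none := by
      rw [← List.drop_drop]
      exact (List.drop_sublist _ _).count_le _
    have h3 : (u.take i).count none + (u.drop i).count none = u.count none := by
      rw [← List.count_append, List.take_append_drop]
    simp only [List.count_append, List.count_replicate_self, add_mul, one_mul]
    omega

/-- All erasures lie in `B` windows of length `l`. -/
def Covered (l B : ℕ) (s : Mask) : Prop :=
  ∃ S : Finset ℕ, S.card ≤ B ∧ ∀ i, s[i]? = some none → ∃ t ∈ S, t ≤ i ∧ i < t + l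

theorem Covered.mono {l B B' : ℕ} {s : Mask} (h : Covered l B s) (hB : B ≤ B') :
    Covered l B' s := by
  obtain ⟨S, h1, h2⟩ := h
  exact ⟨S, h1.trans hB, h2⟩

/-- An erasure comes from the kept prefix, from the inserted block, or from the shifted suffix. The
block starts at `min i s.length`, because `i` may lie beyond the end. -/
theorem getElem?_masks1_cases {s : Mask} {i u v p : ℕ}
    (h : (s.take i ++ List.replicate v none ++ s.drop (i + u))[p]? = some none) :
    s[p]? = some none ∧ p < i ∨ min i s.length ≤ p ∧ p < min i s.length + v ∨
      s[p - (min i s.length + v) + (i + u)]? = some none ∧ min i s.length + v ≤ p := by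
  rw [List.append_assoc, List.getElem?_append] at h
  split_ifs at h with h1
  · rw [List.length_take] at h1
    rw [List.getElem?_take] at h
    split_ifs at h with h2
    exact .inl ⟨h, h2⟩
  · rw [List.length_take] at h1
    rw [List.getElem?_append, List.length_take, List.length_replicate] at h
    split_ifs at h with h2
    · exact .inr (.inl (by omega))
    · rw [List.getElem?_drop] at h
      refine .inr (.inr ⟨?_, by omega⟩)
      convert h using 2
      omega

theorem covered_masks1_lift {R l : ℕ} {x : Bits} {s : Mask} (h : s ∈ masks1 R l (lift x)) :
    Covered l 1 s := by
  obtain ⟨i, hi, u, hu, v, hv, rfl⟩ := mem_masks1.1 h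
  refine ⟨{min i x.length}, by simp, fun p hp => ⟨_, Finset.mem_singleton_self _, ?_⟩⟩
  have hno : ∀ q : ℕ, (lift x)[q]? ≠ some none := by simp [lift]
  rcases getElem?_masks1_cases hp with h | h | h
  · exact absurd h.1 (hno _)
  · simp only [lift, List.length_map] at h
    omega
  · exact absurd h.1 (hno _)

/-- Windows starting before the end of the deleted part stay, the others are shifted. Two windows
are new: one at `c` for the inserted block, and one at `c + v`, which collects the tails of all old
windows that reach across the cut. -/
theorem Covered.masks1 {R l B : ℕ} {s t : Mask} (h : Covered l B s) (ht : t ∈ masks1 R l s) :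
    Covered l (B + 2) t := by
  obtain ⟨i, hi, u, hu, v, hv, rfl⟩ := mem_masks1.1 ht
  obtain ⟨S, h1, h2⟩ := h
  set c := min i s.length
  refine ⟨S.image (fun t => if t < i + u then t else t - (i + u) + (c + v)) ∪ {c, c + v}, ?_, ?_⟩
  · exact (Finset.card_union_le _ _).trans
      (add_le_add (Finset.card_image_le.trans h1) Finset.card_le_two)
  · intro p hp
    simp only [Finset.mem_union, Finset.mem_image, Finset.mem_insert, Finset.mem_singleton]
    rcases getElem?_masks1_cases hp with h | h | h
    · obtain ⟨t, ht, h3, h4⟩ := h2 p h.1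
      exact ⟨t, .inl ⟨t, ht, if_pos (by omega)⟩, h3, h4⟩
    · exact ⟨c, .inr (.inl rfl), by omega, by omega⟩
    · obtain ⟨t, ht, h3, h4⟩ := h2 _ h.1
      rcases lt_or_ge t (i + u) with h5 | h5
      · exact ⟨c + v, .inr (.inr rfl), by omega, by omega⟩
      · exact ⟨_, .inl ⟨t, ht, if_neg (by omega)⟩, by omega, by omega⟩

/-- The first replacement meets no erasures and costs a single window. For `2k` replacements this
yields `4k - 1` instead of `4k`, and the missing window is the slack that keeps the burst syndrome
within `4kl` bits. -/
theorem covered_maskSteps {R l j : ℕ} {x : Bits} {s : Mask}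
    (h : s ∈ maskSteps R l (j + 1) (lift x)) : Covered l (2 * j + 1) s := by
  induction j generalizing s with
  | zero => exact covered_masks1_lift (by simpa [maskSteps] using h)
  | succ j ih =>
    obtain ⟨t, ht, h⟩ := maskSteps_succ'.1 h
    exact (ih ht).masks1 h

/-! Filling the erasures -/

/-- The ways of filling the erasures, cut off at `max M 1`. -/
def fills (M : ℕ) (s : Mask) : List Bits :=
  s.reverse.foldl (fun acc o =>
    (acc.flatMap (fun z => bif o.isNone then [false :: z, true :: z] else [o.getD false :: z])).take
      M) [[]]

theorem fills_cons (M : ℕ) (o : Option Bool) (s : Mask) : fills M (o :: s) = ((fills M s).flatMap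
    (fun z => bif o.isNone then [false :: z, true :: z] else [o.getD false :: z])).take M := by
  simp [fills]

theorem length_fills_le (M : ℕ) (s : Mask) : (fills M s).length ≤ max M 1 := by
  cases s with
  | nil => simp [fills]
  | cons o s => rw [fills_cons, List.length_take]; omega

theorem refines_of_mem_fills {M : ℕ} {s : Mask} {z : Bits} (h : z ∈ fills M s) :
    Refines s (lift z) := by
  induction s generalizing z with
  | nil => simp [fills] at h; subst h; exact .nil
  | cons o s ih =>
    rw [fills_cons] at h
    obtain ⟨w, hw, h⟩ := List.mem_flatMap.1 (List.mem_of_mem_take h)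
    have := ih hw
    cases o <;> simp at h
    · rcases h with rfl | rfl <;> exact .cons (.inl rfl) this
    · subst h
      exact .cons (.inr rfl) this

theorem length_of_mem_fills {M : ℕ} {s : Mask} {z : Bits} (h : z ∈ fills M s) :
    z.length = s.length := by
  simpa [lift] using (refines_of_mem_fills h).length_eq.symm

/-- Under `h` the truncation never removes anything, since the number of fillings only grows along
the way. -/
theorem length_fills {M : ℕ} {s : Mask} (h : 2 ^ s.count none ≤ M) :
    (fills M s).length = 2 ^ s.count none := by
  induction s with
  | nil => simp [fills]
  | cons o s ih =>
    rw [fills_cons]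
    cases o with
    | none =>
      rw [List.count_cons_self] at h ⊢
      have := ih (by rw [pow_succ] at h; omega)
      simp [List.length_flatMap, this]
      rw [← pow_succ]
      omega
    | some b =>
      simp only [List.count_cons, beq_iff_eq, reduceCtorEq, if_false, add_zero] at h ⊢
      have := ih h
      simp [List.length_flatMap, this]
      omega

theorem mem_fills {M : ℕ} {s : Mask} {x : Bits} (h : 2 ^ s.count none ≤ M)
    (hx : Refines s (lift x)) : x ∈ fills M s := by
  induction s generalizing x with
  | nil =>
    have : x = [] := by simpa [lift] using hx.length_eq.symm
    simp [fills, this]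
  | cons o s ih =>
    obtain ⟨b, y, rfl⟩ : ∃ b y, x = b :: y := by
      cases x with
      | nil => simpa [lift] using hx.length_eq
      | cons b y => exact ⟨b, y, rfl⟩
    obtain ⟨h1, h2⟩ := List.forall₂_cons.1 hx
    have hM : 2 ^ s.count none ≤ M :=
      le_trans (Nat.pow_le_pow_right (by norm_num) (List.count_le_count_cons)) h
    have hlen := length_fills h
    have hlen' := length_fills hM
    rw [fills_cons, List.take_of_length_le]
    · refine List.mem_flatMap.2 ⟨y, ih hM h2, ?_⟩
      cases o with
      | none => cases b <;> simp
      | some c => simp at h1; simp [h1]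
    · cases o with
      | none =>
        rw [List.count_cons_self] at h
        simp [List.length_flatMap, hlen']
        rwa [← pow_succ]
      | some c =>
        simp [List.length_flatMap, hlen']
        exact hM

@[fun_prop]
theorem PolyC.fills {M : α → ℕ} {s : α → Mask} (hM : PolyC M) (hs : PolyC s) :
    PolyC (fun a => fills (M a) (s a)) := by
  have ⟨_, p, hp⟩ := hM
  have ⟨_, q, hq⟩ := hs
  refine PolyC.foldl (F := fun a (acc : List Bits) (o : Option Bool) => (acc.flatMap (fun z => bif o.isNone then
    [false :: z, true :: z] else [o.getD false :: z])).take (M a)) (by fun_prop) (by fun_prop)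
    (by fun_prop) ((p + 1) * (2 * q + 1)) fun a L' hL' => ?_
  have h0 : L'.length ≤ q.eval (sz a) :=
    hL'.length_le.trans (by rw [List.length_reverse]; exact (length_le_sz _).trans (hq a).2)
  -- An intermediate state of the fold is the list of fillings of a shorter mask: at most `max (M a)
  -- 1` words, each as long as that mask.
  have h1 := length_fills_le (M a) L'.reverse
  have h2 := fun z (hz : z ∈ SubstringEdits.fills (M a) L'.reverse) => length_of_mem_fills hz
  unfold SubstringEdits.fills at h1 h2
  rw [List.reverse_reverse] at h1 h2
  rw [sz_eq_sum]
  have h3 := List.sum_le_card_nsmul ((L'.foldl (fun (acc : List Bits) (o : Option Bool) => (acc.flatMap (fun z =>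
    bif o.isNone then [false :: z, true :: z] else [o.getD false :: z])).take (M a)) [[]]).map sz)
    (2 * q.eval (sz a)) (by
      simp only [List.mem_map, forall_exists_index, and_imp]
      rintro _ z hz rfl
      have h4 := h2 z hz
      have h5 := List.sum_le_card_nsmul (z.map sz) 1 (by
        simp only [List.mem_map, forall_exists_index, and_imp]
        rintro _ b - rfl
        exact sz_bool b)
      rw [sz_eq_sum]
      simp at h4 h5
      omega)
  have h6 := (hp a).2
  rw [sz_nat] at h6
  simp only [List.length_map, smul_eq_mul] at h3
  simp only [Polynomial.eval_add, Polynomial.eval_mul, Polynomial.eval_one, Polynomial.eval_ofNat]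
  have h7 : max (M a) 1 ≤ p.eval (sz a) + 1 := by omega
  have h8 := Nat.mul_le_mul_right (2 * q.eval (sz a) + 1) (h1.trans h7)
  rw [mul_add, mul_one] at h8
  omega

/-! ### A syndrome correcting bursts of erasures -/

theorem list_sum_range (f : ℕ → ℕ) (n : ℕ) :
    ((List.range n).map f).sum = ∑ i ∈ Finset.range n, f i := by
  induction n with
  | zero => rfl
  | succ n ih => rw [List.range_succ, Finset.sum_range_succ, List.map_append, List.sum_append, ih]; simp

theorem count_none_map_range {A : Type} [DecidableEq A] (f : ℕ → Option A) (n : ℕ) :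
    ((List.range n).map f).count none = ((Finset.range n).filter (fun i => f i = none)).card := by
  induction n with
  | zero => rfl
  | succ n ih =>
    rw [List.range_succ, Finset.range_add_one, List.map_append, List.count_append, ih,
      Finset.filter_insert]
    split_ifs with h <;> simp [h]

open Polynomial in
/-- A vector with at most `B` nonzero entries is determined by `B` Vandermonde parity checks. -/
theorem eq_zero_of_power_sums {F ι : Type} [Field F] (T : Finset ι) (z w : ι → F)
    (hz : Set.InjOn z T) {B : ℕ} (hT : T.card ≤ B)
    (h : ∀ j < B, ∑ b ∈ T, w b * z b ^ j = 0) : ∀ b ∈ T, w b = 0 := by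
  classical
  intro b hb
  -- `P` vanishes at all locators but that of `b`, and its degree is less than `B`. The combination
  -- of the checks with the coefficients of `P` therefore isolates `w b`.
  let P : F[X] := ∏ c ∈ T.erase b, (X - C (z c))
  have hdeg : P.natDegree < B := by
    have h1 : P.natDegree = (T.erase b).card := natDegree_finsetProd_X_sub_C_eq_card _ _
    rw [h1, Finset.card_erase_of_mem hb]
    have := Finset.card_pos.2 ⟨b, hb⟩
    omega
  have h1 : ∑ c ∈ T, w c * P.eval (z c) = 0 := by
    simp only [eval_eq_sum_range' hdeg, Finset.mul_sum]
    rw [Finset.sum_comm]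
    refine Finset.sum_eq_zero fun j hj => ?_
    have := h j (Finset.mem_range.1 hj)
    rw [← mul_zero (P.coeff j), ← this, Finset.mul_sum]
    exact Finset.sum_congr rfl fun c _ => by ring
  rw [Finset.sum_eq_single_of_mem b hb] at h1
  · refine (mul_eq_zero.1 h1).resolve_right ?_
    rw [eval_prod, ← ne_eq, Finset.prod_ne_zero_iff]
    intro c hc
    rw [eval_sub, eval_X, eval_C, sub_ne_zero]
    exact fun h => (Finset.ne_of_mem_erase hc) (hz (Finset.mem_of_mem_erase hc) hb h.symm)
  · intro c hc hcb
    rw [eval_prod, Finset.prod_eq_zero (Finset.mem_erase.2 ⟨hcb, hc⟩), mul_zero]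
    simp

/-- Number of interleaved codes used for the burst length `e.1` and the word length `e.2`. The
words are cut into blocks of `Nat.clog 2 e.2` bits. -/
def depth (e : ℕ × ℕ) : ℕ := e.1 / Nat.clog 2 e.2 + 2

/-- The code to which the position `i` belongs. -/
def posClass (e : ℕ × ℕ) (i : ℕ) : ℕ := i / Nat.clog 2 e.2 % depth e

/-- A power sum of the blocks of class `c`. -/
def classSum (B : ℕ) (e : ℕ × ℕ) (c j : ℕ) (x : Bits) : ℕ :=
  ((List.range e.2).map fun i => bif x.getD i false && decide (posClass e i = c) then
    min (2 * e.2) (2 ^ (i % Nat.clog 2 e.2)) * min (e.2 ^ B) ((i / Nat.clog 2 e.2) ^ j) else 0).sum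

/-- The modulus. -/
def modulus (e : ℕ × ℕ) : ℕ := nextPrime (min (2 * e.2 + 2) (2 ^ Nat.clog 2 e.2))

/-- Parity checks of the blocks of class `c`. -/
def classSynd (B : ℕ) (e : ℕ × ℕ) (c : ℕ) (x : Bits) : Bits :=
  (List.range B).flatMap fun j => natBits (Nat.clog 2 e.2 + 1) (classSum B e c j x % modulus e)

/-- The syndrome correcting bursts of erasures. -/
def burstSynd (B : ℕ) (e : ℕ × ℕ) (x : Bits) : Bits :=
  (List.range (depth e)).flatMap fun c => classSynd B e c x

@[fun_prop]
theorem PolyC.depth {e : α → ℕ × ℕ} (he : PolyC e) : PolyC (fun a => depth (e a)) := by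
  unfold SubstringEdits.depth
  fun_prop

@[fun_prop]
theorem PolyC.posClass {e : α → ℕ × ℕ} {i : α → ℕ} (he : PolyC e) (hi : PolyC i) :
    PolyC (fun a => posClass (e a) (i a)) := by
  unfold SubstringEdits.posClass
  fun_prop

@[fun_prop]
theorem PolyC.classSum (B : ℕ) {e : α → ℕ × ℕ} {c j : α → ℕ} {x : α → Bits} (he : PolyC e)
    (hc : PolyC c) (hj : PolyC j) (hx : PolyC x) :
    PolyC (fun a => classSum B (e a) (c a) (j a) (x a)) := by
  unfold SubstringEdits.classSum
  fun_prop

@[fun_prop]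
theorem PolyC.modulus {e : α → ℕ × ℕ} (he : PolyC e) : PolyC (fun a => modulus (e a)) := by
  unfold SubstringEdits.modulus
  fun_prop

@[fun_prop]
theorem PolyC.classSynd (B : ℕ) {e : α → ℕ × ℕ} {c : α → ℕ} {x : α → Bits} (he : PolyC e)
    (hc : PolyC c) (hx : PolyC x) : PolyC (fun a => classSynd B (e a) (c a) (x a)) := by
  unfold SubstringEdits.classSynd
  fun_prop

@[fun_prop]
theorem PolyC.burstSynd (B : ℕ) {e : α → ℕ × ℕ} {x : α → Bits} (he : PolyC e) (hx : PolyC x) :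
    PolyC (fun a => burstSynd B (e a) (x a)) := by
  unfold SubstringEdits.burstSynd
  fun_prop

@[simp] theorem length_classSynd (B : ℕ) (e : ℕ × ℕ) (c : ℕ) (x : Bits) :
    (classSynd B e c x).length = B * (Nat.clog 2 e.2 + 1) := by
  simp [classSynd, List.length_flatMap]

@[simp] theorem length_burstSynd (B : ℕ) (e : ℕ × ℕ) (x : Bits) :
    (burstSynd B e x).length = depth e * (B * (Nat.clog 2 e.2 + 1)) := by
  simp [burstSynd, List.length_flatMap]

theorem flatMap_range_slice {A : Type} (f : ℕ → List A) (w : ℕ) (hf : ∀ c, (f c).length = w)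
    {c D : ℕ} (hc : c < D) : (((List.range D).flatMap f).drop (c * w)).take w = f c := by
  obtain ⟨m, rfl⟩ := Nat.exists_eq_add_of_lt hc
  rw [show c + m + 1 = c + (m + 1) by ring, List.range_add, List.flatMap_append,
    List.drop_append_of_le_length (by simp [List.length_flatMap, hf]), List.drop_of_length_le
    (by simp [List.length_flatMap, hf]), List.nil_append, List.range_succ_eq_map, List.map_cons,
    List.flatMap_cons, List.take_append_of_le_length (by simp [hf]), List.take_of_length_le
    (by simp [hf]), add_zero]

theorem modulus_eq (e : ℕ × ℕ) : min (2 * e.2 + 2) (2 ^ Nat.clog 2 e.2) = 2 ^ Nat.clog 2 e.2 := by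
  refine min_eq_right ?_
  rcases Nat.lt_or_ge 1 e.2 with h | h
  · have h1 := Nat.pow_pred_clog_lt_self (b := 2) (by norm_num) h
    have h2 : 0 < Nat.clog 2 e.2 := Nat.clog_pos (by norm_num) h
    obtain ⟨m, hm⟩ := Nat.exists_eq_add_of_lt h2
    rw [hm] at h1 ⊢
    simp [pow_succ] at h1 ⊢
    omega
  · rw [Nat.clog_of_right_le_one h]
    simp

theorem modulus_spec (e : ℕ × ℕ) : (modulus e).Prime ∧ 2 ^ Nat.clog 2 e.2 < modulus e ∧
    modulus e ≤ 2 ^ (Nat.clog 2 e.2 + 1) := by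
  rw [modulus, modulus_eq, pow_succ, mul_comm _ 2]
  exact nextPrime_spec (by positivity)

/-- Both cut-offs in `classSum` are harmless: an exponent inside a block is less than `Nat.clog 2
e.2`, and block numbers are less than `e.2`. -/
theorem classSum_eq {B : ℕ} {e : ℕ × ℕ} (he : 2 ≤ e.2) {c j : ℕ} (hj : j < B) (x : Bits) :
    classSum B e c j x = ∑ i ∈ (Finset.range e.2).filter
      (fun i => x.getD i false = true ∧ posClass e i = c),
        2 ^ (i % Nat.clog 2 e.2) * (i / Nat.clog 2 e.2) ^ j := by
  rw [classSum, list_sum_range, Finset.sum_filter]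
  refine Finset.sum_congr rfl fun i hi => ?_
  have h0 : 0 < Nat.clog 2 e.2 := Nat.clog_pos (by norm_num) he
  have h1 : 2 ^ (i % Nat.clog 2 e.2) ≤ 2 * e.2 := by
    have h1 := Nat.pow_pred_clog_lt_self (b := 2) (by norm_num) he
    have h2 : 2 ^ (i % Nat.clog 2 e.2) ≤ 2 ^ (Nat.clog 2 e.2).pred :=
      Nat.pow_le_pow_right (by norm_num) (Nat.le_pred_of_lt (Nat.mod_lt _ h0))
    exact h2.trans (h1.le.trans (by omega))
  have h2 : (i / Nat.clog 2 e.2) ^ j ≤ e.2 ^ B :=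
    (Nat.pow_le_pow_left ((Nat.div_le_self _ _).trans (Finset.mem_range.1 hi).le) j).trans
      (Nat.pow_le_pow_right (by omega) hj.le)
  rw [min_eq_right h1, min_eq_right h2]
  split_ifs with h
  · rw [h.1, h.2]; simp
  · cases h3 : x.getD i false
    · simp
    · have : posClass e i ≠ c := fun h4 => h ⟨h3, h4⟩
      simp [this]

theorem add_div_le_succ (a b : ℕ) {m : ℕ} (hm : 0 < m) : (a + b) / m ≤ a / m + b / m + 1 := by
  rw [Nat.add_div hm]
  split_ifs <;> omega

/-- A burst meets at most one block of each class. -/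
theorem block_eq_of_window {e : ℕ × ℕ} (he : 2 ≤ e.2) {t i i' : ℕ} (hi : t ≤ i ∧ i < t + e.1)
    (hi' : t ≤ i' ∧ i' < t + e.1) (h : posClass e i = posClass e i') :
    i / Nat.clog 2 e.2 = i' / Nat.clog 2 e.2 := by
  wlog hle : i ≤ i' generalizing i i'
  · exact (this hi' hi h.symm (by omega)).symm
  have h0 : 0 < Nat.clog 2 e.2 := Nat.clog_pos (by norm_num) he
  have h1 := Nat.div_le_div_right (c := Nat.clog 2 e.2) (show i' ≤ i + e.1 by omega)
  have h2 := add_div_le_succ i e.1 h0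
  have h3 := Nat.div_le_div_right (c := Nat.clog 2 e.2) hle
  unfold posClass depth at h
  -- The block numbers are congruent modulo the depth `l / m + 2`, where `m` is the block length,
  -- but differ by at most `l / m + 1`.
  have h4 := (Nat.modEq_iff_dvd' h3).1 h
  have h5 := Nat.eq_zero_of_dvd_of_lt h4 (by omega)
  omega

theorem eq_of_flatMap_range_eq {A : Type} {f g : ℕ → List A} {w D : ℕ} (hf : ∀ c, (f c).length = w)
    (hg : ∀ c, (g c).length = w) (h : (List.range D).flatMap f = (List.range D).flatMap g) {c : ℕ}
    (hc : c < D) : f c = g c := by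
  rw [← flatMap_range_slice f w hf hc, h, flatMap_range_slice g w hg hc]

/-- The blocks of class `c`, read as binary numbers `A y b`, are symbols of a Reed-Solomon code over
the field with `p` elements, with block numbers as locators. Every window of `S` meets one block of
the class at most, so no more than `B` symbols differ, and `B` power sums determine them. -/
theorem eq_on_class {B : ℕ} {e : ℕ × ℕ} (he : 2 ≤ e.2) {c : ℕ} {x x' : Bits} {S : Finset ℕ}
    (hS : S.card ≤ B) (hdiff : ∀ i < e.2, posClass e i = c → x.getD i false ≠ x'.getD i false →
      ∃ t ∈ S, t ≤ i ∧ i < t + e.1) (hsynd : classSynd B e c x = classSynd B e c x') :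
    ∀ i < e.2, posClass e i = c → x.getD i false = x'.getD i false := by
  obtain ⟨hp, hp1, hp2⟩ := modulus_spec e
  set p := modulus e with hpdef
  set m := Nat.clog 2 e.2 with hmdef
  have hm0 : 0 < m := Nat.clog_pos (by norm_num) he
  have hnm : e.2 ≤ 2 ^ m := Nat.le_pow_clog (by norm_num) _
  have : Fact p.Prime := ⟨hp⟩
  let U : Bits → ℕ → Finset ℕ := fun y b =>
    (Finset.range e.2).filter (fun i => y.getD i false = true ∧ posClass e i = c ∧ i / m = b)
  let A : Bits → ℕ → ℕ := fun y b => ∑ i ∈ U y b, 2 ^ (i % m)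
  -- As a sum of distinct powers of two, `A y b` is below `2 ^ m < p` and determines the bits of the
  -- block.
  have hA : ∀ y b, A y b = ∑ r ∈ (U y b).image (· % m), 2 ^ r := by
    intro y b
    rw [Finset.sum_image]
    intro i hi i' hi' h
    simp only [U, Finset.coe_filter, Set.mem_ofPred_eq] at hi hi'
    have h1 := Nat.div_add_mod i m
    have h2 := Nat.div_add_mod i' m
    simp only at h
    rw [hi.2.2.2, h] at h1
    rw [hi'.2.2.2] at h2
    omega
  have hAlt : ∀ y b, A y b < p := by
    intro y b
    rw [hA]
    refine lt_trans (Nat.geomSum_lt le_rfl fun r hr => ?_) hp1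
    obtain ⟨i, -, rfl⟩ := Finset.mem_image.1 hr
    exact Nat.mod_lt _ hm0
  have hsum : ∀ y, ∀ j < B, classSum B e c j y = ∑ b ∈ Finset.range e.2, A y b * b ^ j := by
    intro y j hj
    rw [classSum_eq he hj, ← Finset.sum_fiberwise_of_maps_to (g := fun i => i / m)
      (t := Finset.range e.2)]
    · refine Finset.sum_congr rfl fun b _ => ?_
      rw [Finset.sum_mul, Finset.filter_filter]
      refine Finset.sum_congr (by simp only [U, and_assoc]) fun i hi => ?_
      simp only [U, Finset.mem_filter] at hi
      rw [← hmdef, hi.2.2.2]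
    · intro i hi
      simp only [Finset.mem_filter, Finset.mem_range] at hi ⊢
      exact (Nat.div_le_self _ _).trans_lt hi.1
  have hAeq : ∀ b ∈ Finset.range e.2, A x b = A x' b := by
    by_contra hcon
    push Not at hcon
    obtain ⟨b₀, hb₀, hne⟩ := hcon
    let T := (Finset.range e.2).filter (fun b => A x b ≠ A x' b)
    have hex : ∀ b ∈ T, ∃ i < e.2, posClass e i = c ∧ i / m = b ∧
        x.getD i false ≠ x'.getD i false := by
      intro b hb
      by_contra hno
      push Not at hno
      refine (Finset.mem_filter.1 hb).2 (Finset.sum_congr ?_ fun _ _ => rfl)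
      refine Finset.filter_congr fun i hi => and_congr_left fun h => ?_
      rw [hno i (Finset.mem_range.1 hi) h.1 h.2]
    -- Each differing block is assigned a window that meets it. The assignment is injective on `T`,
    -- whence `T.card ≤ B`; the value outside `T` is arbitrary.
    have hex' : ∀ b, ∃ t, b ∈ T → t ∈ S ∧ ∃ i, posClass e i = c ∧ i / m = b ∧
        t ≤ i ∧ i < t + e.1 := by
      intro b
      by_cases hb : b ∈ T
      · obtain ⟨i, h1, h2, h3, h4⟩ := hex b hb
        obtain ⟨t, h5, h6⟩ := hdiff i h1 h2 h4
        exact ⟨t, fun _ => ⟨h5, i, h2, h3, h6⟩⟩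
      · exact ⟨0, fun h => absurd h hb⟩
    choose f hf using hex'
    have hT : T.card ≤ B := by
      refine le_trans (Finset.card_le_card_of_injOn f (fun b hb => (hf b hb).1) ?_) hS
      intro b hb b' hb' h
      obtain ⟨-, i, h1, h2, h3⟩ := hf b hb
      obtain ⟨-, i', h1', h2', h3'⟩ := hf b' hb'
      rw [← h2, ← h2']
      exact block_eq_of_window he h3 (h ▸ h3') (h1.trans h1'.symm)
    refine hne ?_
    have h0 := eq_zero_of_power_sums T (fun b => (b : ZMod p))
      (fun b => (A x b : ZMod p) - (A x' b : ZMod p)) ?_ hT ?_ b₀ (Finset.mem_filter.2 ⟨hb₀, hne⟩)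
    · rw [sub_eq_zero, ZMod.natCast_eq_natCast_iff', Nat.mod_eq_of_lt (hAlt _ _),
        Nat.mod_eq_of_lt (hAlt _ _)] at h0
      exact h0
    · intro b hb b' hb' h
      have h1 := Finset.mem_range.1 (Finset.mem_filter.1 hb).1
      have h2 := Finset.mem_range.1 (Finset.mem_filter.1 hb').1
      simp only at h
      rwa [ZMod.natCast_eq_natCast_iff', Nat.mod_eq_of_lt (by omega),
        Nat.mod_eq_of_lt (by omega)] at h
    · intro j hj
      have h1 := natBits_inj ((Nat.mod_lt _ hp.pos).trans_le hp2) ((Nat.mod_lt _ hp.pos).trans_le hp2)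
        (eq_of_flatMap_range_eq (fun _ => length_natBits _ _) (fun _ => length_natBits _ _) hsynd hj)
      rw [← ZMod.natCast_eq_natCast_iff', hsum x j hj, hsum x' j hj] at h1
      push_cast at h1
      rw [Finset.sum_filter_of_ne]
      · simp only [sub_mul, Finset.sum_sub_distrib]
        exact sub_eq_zero.2 h1
      · intro b _ hb hb'
        rw [hb', sub_self, zero_mul] at hb
        exact hb rfl
  have hU : ∀ i < e.2, posClass e i = c → ∀ y y' : Bits, A y (i / m) = A y' (i / m) →
      y.getD i false = true → y'.getD i false = true := by
    intro i hi hic y y' h hy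
    rw [hA, hA] at h
    have h1 := Finset.geomSum_injective (n := 2) le_rfl h
    have h2 : i % m ∈ (U y' (i / m)).image (· % m) := by
      rw [← h1]
      refine Finset.mem_image_of_mem (· % m) ?_
      simp only [U, Finset.mem_filter, Finset.mem_range]
      exact ⟨hi, hy, hic, trivial⟩
    obtain ⟨i', hi', h3⟩ := Finset.mem_image.1 h2
    simp only [U, Finset.mem_filter] at hi'
    have h4 := Nat.div_add_mod i m
    have h5 := Nat.div_add_mod i' m
    rw [hi'.2.2.2, h3, h4] at h5
    rw [h5]
    exact hi'.2.1
  intro i hi hic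
  have hmem : i / m ∈ Finset.range e.2 := Finset.mem_range.2 ((Nat.div_le_self _ _).trans_lt hi)
  rw [Bool.eq_iff_iff]
  exact ⟨hU i hi hic x x' (hAeq _ hmem), hU i hi hic x' x (hAeq _ hmem).symm⟩

theorem posClass_lt (e : ℕ × ℕ) (i : ℕ) : posClass e i < depth e :=
  Nat.mod_lt _ (Nat.succ_pos _)

theorem eq_of_burstSynd_eq {B : ℕ} {e : ℕ × ℕ} (he : 2 ≤ e.2) {x x' : Bits} (hx : x.length = e.2)
    (hx' : x'.length = e.2) {S : Finset ℕ} (hS : S.card ≤ B)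
    (hdiff : ∀ i < e.2, x.getD i false ≠ x'.getD i false → ∃ t ∈ S, t ≤ i ∧ i < t + e.1)
    (h : burstSynd B e x = burstSynd B e x') : x = x' := by
  refine List.ext_getElem (hx.trans hx'.symm) fun i hi hi' => ?_
  have := eq_on_class he hS (c := posClass e i) (fun i hi _ => hdiff i hi)
    (eq_of_flatMap_range_eq (length_classSynd _ _ · _) (length_classSynd _ _ · _) h
      (posClass_lt e i)) i (hx ▸ hi) rfl
  simpa [hi, hi'] using this

/-! Decoding -/

/-- The erasures in class `c`. -/
def classMask (e : ℕ × ℕ) (c : ℕ) (s : Mask) : Mask :=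
  (List.range e.2).map fun i => bif decide (posClass e i = c) then s.getD i none else some false

/-- A word filling the erasures in class `c` in accordance with the syndrome `v`. -/
def classFill (B : ℕ) (e : ℕ × ℕ) (s : Mask) (v : Bits) (c : ℕ) : Bits :=
  ((fills (min (2 * e.2 + 2) (2 ^ Nat.clog 2 e.2) ^ B) (classMask e c s)).filter fun z =>
    decide (classSynd B e c z = (v.drop (c * (B * (Nat.clog 2 e.2 + 1)))).take
      (B * (Nat.clog 2 e.2 + 1)))).headD []

/-- Correction of bursts of erasures. -/
def burstSolve (B : ℕ) (e : ℕ × ℕ) (s : Mask) (v : Bits) : Bits :=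
  (List.range e.2).map fun i => (classFill B e s v (posClass e i)).getD i false

@[fun_prop]
theorem PolyC.classFill (B : ℕ) {e : α → ℕ × ℕ} {s : α → Mask} {v : α → Bits} {c : α → ℕ}
    (he : PolyC e) (hs : PolyC s) (hv : PolyC v) (hc : PolyC c) :
    PolyC (fun a => classFill B (e a) (s a) (v a) (c a)) := by
  unfold SubstringEdits.classFill classMask
  fun_prop

@[fun_prop]
theorem PolyC.burstSolve (B : ℕ) {e : α → ℕ × ℕ} {s : α → Mask} {v : α → Bits}
    (he : PolyC e) (hs : PolyC s) (hv : PolyC v) :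
    PolyC (fun a => burstSolve B (e a) (s a) (v a)) := by
  unfold SubstringEdits.burstSolve
  fun_prop

/-- Each of the `B` windows meets the class inside a single block. Hence the fillings of one class
are at most `(2 ^ Nat.clog 2 e.2) ^ B` in number, polynomially many as `B` is fixed, and exhaustive
search is affordable. -/
theorem count_none_classMask {B : ℕ} {e : ℕ × ℕ} (he : 2 ≤ e.2) (c : ℕ) {s : Mask}
    (hlen : s.length = e.2) (hs : Covered e.1 B s) :
    (classMask e c s).count none ≤ Nat.clog 2 e.2 * B := by
  obtain ⟨S, hS, hcov⟩ := hs
  have h0 : 0 < Nat.clog 2 e.2 := Nat.clog_pos (by norm_num) he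
  rw [classMask, count_none_map_range]
  refine le_trans (Finset.card_le_card (t := S.biUnion fun t => (Finset.range e.2).filter fun i =>
    posClass e i = c ∧ t ≤ i ∧ i < t + e.1) ?_) ((Finset.card_biUnion_le_card_mul _ _
      (Nat.clog 2 e.2) ?_).trans ?_)
  · intro i hi
    simp only [Finset.mem_filter, Finset.mem_range] at hi
    obtain ⟨h1, h2⟩ := hi
    by_cases h3 : posClass e i = c
    · simp only [h3, decide_true, cond_true] at h2
      have hi' : i < s.length := by omega
      obtain ⟨t, ht, h4⟩ := hcov i (by
        rw [List.getElem?_eq_getElem hi']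
        simpa [hi'] using h2)
      simp only [Finset.mem_biUnion, Finset.mem_filter, Finset.mem_range]
      exact ⟨t, ht, h1, h3, h4⟩
    · simp [h3] at h2
  · intro t _
    rcases Finset.eq_empty_or_nonempty ((Finset.range e.2).filter fun i =>
      posClass e i = c ∧ t ≤ i ∧ i < t + e.1) with h | ⟨i₀, hi₀⟩
    · rw [h]; simp
    · simp only [Finset.mem_filter] at hi₀
      refine le_trans (Finset.card_le_card (t := Finset.Ico (i₀ / Nat.clog 2 e.2 * Nat.clog 2 e.2)
        (i₀ / Nat.clog 2 e.2 * Nat.clog 2 e.2 + Nat.clog 2 e.2)) ?_) (by simp)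
      intro i hi
      simp only [Finset.mem_filter] at hi
      have h1 := block_eq_of_window he hi.2.2 hi₀.2.2 (hi.2.1.trans hi₀.2.1.symm)
      have h2 := Nat.div_add_mod' i (Nat.clog 2 e.2)
      have h3 := Nat.mod_lt i h0
      rw [← h1, Finset.mem_Ico]
      omega
  · rw [mul_comm]
    exact Nat.mul_le_mul_left _ hS

theorem classSynd_congr {B : ℕ} {e : ℕ × ℕ} {c : ℕ} {x x' : Bits}
    (h : ∀ i < e.2, posClass e i = c → x.getD i false = x'.getD i false) :
    classSynd B e c x = classSynd B e c x' := by
  unfold classSynd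
  congr 1
  funext j
  congr 2
  unfold classSum
  congr 1
  refine List.map_congr_left fun i hi => ?_
  by_cases h1 : posClass e i = c
  · rw [h i (List.mem_range.1 hi) h1]
  · simp [h1]

/-- The classes are searched separately. A filling with the right checks exists, and any such
filling agrees with `x` on its class by `eq_on_class`, so it does not matter which one is taken. -/
theorem burstSolve_eq {B : ℕ} {e : ℕ × ℕ} (he : 2 ≤ e.2) {s : Mask} {x : Bits}
    (hx : x.length = e.2) (hs : Covered e.1 B s) (hsx : Refines s (lift x)) :
    burstSolve B e s (burstSynd B e x) = x := by
  have hlen : s.length = e.2 := by rw [hsx.length_eq, lift, List.length_map, hx]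
  have hval := (refines_lift_iff.1 hsx).2
  have key : ∀ c < depth e, ∀ i < e.2, posClass e i = c →
      (classFill B e s (burstSynd B e x) c).getD i false = x.getD i false := by
    intro c hc
    have hsl : ((burstSynd B e x).drop (c * (B * (Nat.clog 2 e.2 + 1)))).take
        (B * (Nat.clog 2 e.2 + 1)) = classSynd B e c x :=
      flatMap_range_slice _ _ (length_classSynd _ _ · _) hc
    -- `x` with all other classes set to zero, as in `classMask`; the checks of class `c` do not see
    -- the difference.
    set xc : Bits := (List.range e.2).map fun i =>
      bif decide (posClass e i = c) then x.getD i false else false with hxc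
    have hxc' : ∀ i < e.2, posClass e i = c → xc.getD i false = x.getD i false := by
      intro i hi hic
      simp [hxc, hi, hic]
    have hmem : xc ∈ fills ((2 ^ Nat.clog 2 e.2) ^ B) (classMask e c s) := by
      refine mem_fills ?_ ?_
      · rw [← pow_mul]
        exact Nat.pow_le_pow_right (by norm_num) (count_none_classMask he c hlen hs)
      · rw [refines_lift_iff]
        refine ⟨by simp [hxc, classMask], fun i hi => ?_⟩
        have hi' : i < e.2 := by simpa [classMask] using hi
        have := hval i (by omega)
        by_cases hic : posClass e i = c
        · simpa [classMask, hxc, hi', hic] using this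
        · simp [classMask, hxc, hi', hic]
    have hcf : classFill B e s (burstSynd B e x) c ∈ (fills ((2 ^ Nat.clog 2 e.2) ^ B)
        (classMask e c s)).filter fun z => decide (classSynd B e c z = classSynd B e c x) := by
      have hmem' : xc ∈ (fills ((2 ^ Nat.clog 2 e.2) ^ B)
          (classMask e c s)).filter fun z => decide (classSynd B e c z = classSynd B e c x) := by
        rw [List.mem_filter]
        exact ⟨hmem, decide_eq_true (classSynd_congr hxc')⟩
      rw [classFill, hsl, modulus_eq]
      revert hmem'
      cases (fills ((2 ^ Nat.clog 2 e.2) ^ B)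
          (classMask e c s)).filter fun z => decide (classSynd B e c z = classSynd B e c x) with
      | nil => simp
      | cons a t => simp
    rw [List.mem_filter] at hcf
    have href := refines_lift_iff.1 (refines_of_mem_fills hcf.1)
    obtain ⟨S, hS, hcov⟩ := hs
    refine eq_on_class he hS ?_ (of_decide_eq_true hcf.2)
    intro i hi hic hne
    have hi' : i < s.length := by omega
    refine hcov i ?_
    rw [List.getElem?_eq_getElem hi']
    by_contra hsome
    have h1 := href.2 i (by simpa [classMask] using hi)
    have h2 := hval i hi'
    simp [classMask, hi, hic, hi'] at h1 h2 hsome hne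
    rcases h2 with h2 | h2
    · exact hsome h2
    · rcases h1 with h1 | h1
      · exact hsome h1
      · rw [h2] at h1
        simp at h1
        exact hne h1.symm
  refine List.ext_getElem (by simp [burstSolve, hx]) fun i hi hi' => ?_
  have := key _ (posClass_lt e i) i (by omega) rfl
  simpa [burstSolve, hi'] using this

/-! ### Codes from erasure syndromes

Parameters are pairs `e = (l, n)` of an edit length and a word length. -/

/-- Bound on the position of an edit. -/
def editRange (k : ℕ) (e : ℕ × ℕ) : ℕ := (2 * k + 1) * e.2

/-- From the syndrome `φ`, the function `solve` recovers a list of at most `Λ` words, containing the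
right one, if erasures result from up to `2 * k` edits. -/
structure Solves (k : ℕ) (φ : (ℕ × ℕ) × Bits → Bits) (solve : (ℕ × ℕ) × Mask × Bits → List Bits)
    (Λ : ℕ × ℕ → ℕ) (e : ℕ × ℕ) : Prop where
  pos : 0 < Λ e
  length_le : ∀ s v, (solve (e, s, v)).length ≤ Λ e
  mem : ∀ (x z : Bits) (j : ℕ) (s : Mask), x.length = e.2 → 0 < j → j ≤ 2 * k →
    s ∈ maskSteps (editRange k e) e.1 j (lift z) → Refines s (lift x) → x ∈ solve (e, s, φ (e, x))

section Scheme

variable (k : ℕ) (φ : (ℕ × ℕ) × Bits → Bits) (solve : (ℕ × ℕ) × Mask × Bits → List Bits)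
  (Λ : ℕ × ℕ → ℕ)

open Classical in
/-- Words obtained from `z` by `j` edits that are compatible with the syndrome `v`. -/
noncomputable def candidates (j : ℕ) (e : ℕ × ℕ) (z v : Bits) : List Bits :=
  (maskSteps (editRange k e) e.1 j (lift z)).flatMap fun s =>
    (solve (e, s, v)).filter fun x => decide (x.length = e.2) && decide (Refines s (lift x))

/-- Superset of the neighbors in the reduced confusion graph. -/
noncomputable def neighbors (p : (ℕ × ℕ) × Bits) : List Bits :=
  candidates k solve (2 * k) p.1 p.2 (φ p)

/-- Bound for the number of neighbors. -/
def degBound (e : ℕ × ℕ) : ℕ := (editRange k e * (e.1 + 1) ^ 2) ^ (2 * k) * Λ e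

/-- The coloring of the reduced confusion graph. -/
noncomputable def syndColor (e : ℕ × ℕ) (x : Bits) : Bits :=
  color (neighbors k φ solve) (degBound k Λ) (fun e => e.2) e x

/-- The decoder. -/
noncomputable def decoder (e : ℕ × ℕ) (y v w : Bits) : Bits :=
  ((candidates k solve k e y v).filter fun x =>
    decide (φ (e, x) = v) && decide (syndColor k φ solve Λ e x = w)).headD []

variable {k φ solve Λ}

/-! ### Running time of the scheme. -/

theorem PolyC.candidates (hs : PolyC solve) (j : ℕ) {e : α → ℕ × ℕ} {z v : α → Bits}
    (he : PolyC e) (hz : PolyC z) (hv : PolyC v) :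
    PolyC (fun a => candidates k solve j (e a) (z a) (v a)) := by
  unfold SubstringEdits.candidates editRange
  fun_prop

theorem PolyC.neighbors (hφ : PolyC φ) (hs : PolyC solve) : PolyC (neighbors k φ solve) :=
  hs.candidates (2 * k) .fst' .snd' hφ

theorem PolyC.degBound (hΛ : PolyC Λ) : PolyC (degBound k Λ) := by
  unfold SubstringEdits.degBound editRange
  fun_prop

@[fun_prop]
theorem PolyC.syndColor (hφ : PolyC φ) (hs : PolyC solve) (hΛ : PolyC Λ) {e : α → ℕ × ℕ}
    {x : α → Bits} (he : PolyC e) (hx : PolyC x) :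
    PolyC (fun a => syndColor k φ solve Λ (e a) (x a)) :=
  PolyC.color (hφ.neighbors hs) hΛ.degBound .snd' he hx

theorem PolyC.decoder (hφ : PolyC φ) (hs : PolyC solve) (hΛ : PolyC Λ) {e : α → ℕ × ℕ}
    {y v w : α → Bits} (he : PolyC e) (hy : PolyC y) (hv : PolyC v) (hw : PolyC w) :
    PolyC (fun a => decoder k φ solve Λ (e a) (y a) (v a) (w a)) := by
  unfold SubstringEdits.decoder
  refine PolyC.headD (PolyC.filter ?_ (hs.candidates k he hy hv)) (by fun_prop)
  refine PolyC.and (by fun_prop) (PolyC.decide_eq_bits ?_ (by fun_prop))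
  exact hφ.syndColor hs hΛ (he.comp .fst') .snd'

/-! ### Correctness of the coloring and of the decoder. -/

theorem mem_candidates {j : ℕ} {e : ℕ × ℕ} {x z v : Bits} :
    x ∈ candidates k solve j e z v ↔ ∃ s ∈ maskSteps (editRange k e) e.1 j (lift z),
      x ∈ solve (e, s, v) ∧ x.length = e.2 ∧ Refines s (lift x) := by
  simp [candidates]

variable {e : ℕ × ℕ}

theorem length_candidates_le (h : Solves k φ solve Λ e) (j : ℕ) (z v : Bits) :
    (candidates k solve j e z v).length ≤ (editRange k e * (e.1 + 1) ^ 2) ^ j * Λ e := by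
  rw [candidates, List.length_flatMap, ← length_maskSteps _ _ _ (lift z)]
  refine (List.sum_le_card_nsmul _ (Λ e) ?_).trans (by simp)
  simp only [List.mem_map, forall_exists_index, and_imp]
  rintro _ s - rfl
  exact (List.length_filter_le _ _).trans (h.length_le _ _)

theorem syndColor_ne (h : Solves k φ solve Λ e) (hk : 0 < k) (hl : e.1 < e.2) {x x' : Bits} (hx : x.length = e.2)
    (hx' : x' ∈ neighbors k φ solve (e, x)) (hne : x' ≠ x) :
    syndColor k φ solve Λ e x ≠ syndColor k φ solve Λ e x' := by
  refine color_ne (n := fun e : ℕ × ℕ => e.2) (Nat.zero_lt_of_lt hl) ?_ (fun z hz => ⟨?_, ?_⟩) hx hx' hne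
  · have h1 : e.2 ≤ editRange k e * (e.1 + 1) ^ 2 :=
      (Nat.le_mul_of_pos_left _ (by omega)).trans (Nat.le_mul_of_pos_right _ (by positivity))
    exact (h1.trans (Nat.le_self_pow (by omega) _)).trans (Nat.le_mul_of_pos_right _ h.pos)
  · exact length_candidates_le h _ _ _
  · intro w hw
    obtain ⟨-, -, -, h1, -⟩ := mem_candidates.1 hw
    exact h1

/-- The word `x'` is only assumed to fill a mask around `y`, not to have `y` as an output. So the
lemma covers rival channel inputs as well as all candidates of the decoder. -/
theorem mem_neighbors (h : Solves k φ solve Λ e) (hk : 0 < k) (hl : e.1 < e.2) {x x' y : Bits} {t : Mask}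
    (hx : x.length = e.2) (hx' : x'.length = e.2) (hy : y ∈ channel e.1 k x)
    (ht : t ∈ maskSteps (editRange k e) e.1 k (lift y)) (htx : Refines t (lift x'))
    (hφ : φ (e, x') = φ (e, x)) : x' ∈ neighbors k φ solve (e, x) := by
  obtain ⟨s, hs, h1⟩ := exists_mask_of_mem_channel₂ hy ht htx (by
    rw [hx, editRange]
    nlinarith [Nat.mul_le_mul_left k hl.le, Nat.mul_pos hk (Nat.zero_lt_of_lt hl)])
  exact mem_candidates.2 ⟨s, hs, hφ ▸ h.mem x' x (2 * k) s hx' (by omega) le_rfl hs h1, hx', h1⟩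

/-- Going back from `y`, of length at most `n + kl`, the words stay within `n + 2kl < (2k+1)n`; this
explains `editRange`. -/
theorem exists_mask_back (hk : 0 < k) (hl : e.1 < e.2) {x y : Bits} (hx : x.length = e.2)
    (hy : y ∈ channel e.1 k x) :
    ∃ t ∈ maskSteps (editRange k e) e.1 k (lift y), Refines t (lift x) := by
  refine exists_mask_of_mem_channel (channel_symm hy) ?_
  have h1 := channel_length_le hy
  rw [hx] at h1
  rw [editRange]
  nlinarith [Nat.mul_lt_mul_of_pos_left hl hk]

theorem syndColor_ne_of_channel (h : Solves k φ solve Λ e) (hk : 0 < k) (hl : e.1 < e.2) {x x' y : Bits}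
    (hx : x.length = e.2) (hx' : x'.length = e.2) (hy : y ∈ channel e.1 k x)
    (hy' : y ∈ channel e.1 k x') (hφ : φ (e, x) = φ (e, x')) (hne : x ≠ x') :
    syndColor k φ solve Λ e x ≠ syndColor k φ solve Λ e x' := by
  obtain ⟨t, ht, h1⟩ := exists_mask_back hk hl hx' hy'
  exact syndColor_ne h hk hl hx (mem_neighbors h hk hl hx hx' hy ht h1 hφ.symm) hne.symm

theorem decoder_eq (h : Solves k φ solve Λ e) (hk : 0 < k) (hl : e.1 < e.2) {x y : Bits} (hx : x.length = e.2)
    (hy : y ∈ channel e.1 k x) :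
    decoder k φ solve Λ e y (φ (e, x)) (syndColor k φ solve Λ e x) = x := by
  have hmem : x ∈ (candidates k solve k e y (φ (e, x))).filter fun x' =>
      decide (φ (e, x') = φ (e, x)) &&
        decide (syndColor k φ solve Λ e x' = syndColor k φ solve Λ e x) := by
    obtain ⟨t, ht, h1⟩ := exists_mask_back hk hl hx hy
    simp only [List.mem_filter, decide_true, Bool.and_self, and_true]
    exact mem_candidates.2 ⟨t, ht, h.mem x y k t hx hk (by omega) ht h1, hx, h1⟩
  have hall : ∀ x' ∈ (candidates k solve k e y (φ (e, x))).filter fun x' =>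
      decide (φ (e, x') = φ (e, x)) &&
        decide (syndColor k φ solve Λ e x' = syndColor k φ solve Λ e x), x' = x := by
    intro x' hx'
    simp only [List.mem_filter, Bool.and_eq_true, decide_eq_true_eq] at hx'
    obtain ⟨h1, h2, h3⟩ := hx'
    obtain ⟨t, ht, -, h4, h5⟩ := mem_candidates.1 h1
    by_contra hne
    exact syndColor_ne h hk hl hx (mem_neighbors h hk hl hx h4 hy ht h5 h2) hne h3.symm
  rw [decoder]
  revert hmem hall
  cases (candidates k solve k e y (φ (e, x))).filter fun x' =>
      decide (φ (e, x') = φ (e, x)) &&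
        decide (syndColor k φ solve Λ e x' = syndColor k φ solve Λ e x) with
  | nil => simp
  | cons a t => intro _ hall; exact hall a (by simp)

end Scheme

/-! The two schemes -/

/-- For `l = O(log n)`: all fillings are tried. -/
theorem solves_fills {k K C : ℕ} {e : ℕ × ℕ} (hK : 2 ^ (2 * k * e.1) ≤ K * (e.2 + 1) ^ C) :
    Solves k (fun _ => []) (fun p => fills (min (K * (p.1.2 + 1) ^ C) (2 ^ (2 * k * p.1.1))) p.2.1)
      (fun e => min (K * (e.2 + 1) ^ C) (2 ^ (2 * k * e.1))) e := by
  have h0 : 0 < 2 ^ (2 * k * e.1) := by positivity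
  refine ⟨lt_min (by omega) h0, fun s v => (length_fills_le _ _).trans (by simp only; omega), ?_⟩
  intro x z j s hx hj0 hj hs hsx
  refine mem_fills ?_ hsx
  simp only
  -- The cut-off keeps the list polynomial for all parameter pairs, as `PolyC` demands; for the
  -- pairs in question it has no effect.
  rw [min_eq_right hK]
  refine Nat.pow_le_pow_right (by norm_num) ((count_none_maskSteps hs).trans ?_)
  rw [List.count_eq_zero_of_not_mem (by simp [lift]), zero_add]
  exact Nat.mul_le_mul_right _ hj

/-- For `l = ω(log n)`: bursts of erasures are corrected. -/
theorem solves_burstSolve {k : ℕ} {e : ℕ × ℕ} (he : 2 ≤ e.2) :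
    Solves k (fun p => burstSynd (4 * k - 1) p.1 p.2)
      (fun p => [burstSolve (4 * k - 1) p.1 p.2.1 p.2.2]) (fun _ => 1) e := by
  refine ⟨by simp, fun s v => by simp, ?_⟩
  intro x z j s hx hj0 hj hs hsx
  obtain ⟨i, rfl⟩ : ∃ i, j = i + 1 := ⟨j - 1, by omega⟩
  -- At most `2k` replacements, hence `i + 1 ≤ 2 * k`.
  have hcov := (covered_maskSteps hs).mono (show 2 * i + 1 ≤ 4 * k - 1 by omega)
  simp only
  rw [burstSolve_eq he hx hcov hsx]
  simp

/-! ### Cutting off the edit length -/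

/-- One step of `clipProg`. -/
def clipStep : Prog :=
  .ite (.seq (.seq .tl .hd) .hd)
    (.cons (.seq (.seq .tl .hd) (.seq .hd .tl)) (.cons .nil (.seq (.seq .tl .hd) .tl)))
    (.seq .tl .hd)

/-- The program computing the minimum of a number and the length of a list, in time linear in the
latter. -/
def clipProg : Prog :=
  .seq (.cons (.cons .nil (.cons .hd .nil)) .tl) (.seq (foldProg clipStep) .tl)

theorem foldl_clip {δ : Type} (L : List δ) (l c : ℕ) :
    L.foldl (fun (s : ℕ × ℕ) _ => if s.1 = 0 then s else (s.1 - 1, s.2 + 1)) (l, c) =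
      (l - L.length, c + min l L.length) := by
  induction L generalizing l c with
  | nil => simp
  | cons b L ih =>
    rw [List.foldl_cons]
    split_ifs with h
    · simp only at h
      subst h
      rw [ih]
      simp
    · rw [ih]
      simp only at h
      simp only [List.length_cons, Prod.mk.injEq]
      omega

/-- The list serves as a clock: one unit per entry is moved from `l` to a counter, so the time does
not depend on `l`, which may be huge. -/
theorem runs_clipProg (l : ℕ) (L : List β) :
    ∃ t ≤ L.length * 80 + 40,
      Runs clipProg (.cons (enc l) (enc L)) (enc (min l L.length)) t := by
  obtain ⟨t, ht, hr⟩ := runs_foldProg clipStep .nil 30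
    (fun (s : ℕ × ℕ) (_ : β) => if s.1 = 0 then s else (s.1 - 1, s.2 + 1)) L (l, 0)
    fun L' b _ => by
      generalize L'.foldl (fun (s : ℕ × ℕ) _ => if s.1 = 0 then s else (s.1 - 1, s.2 + 1)) (l, 0)
        = s
      obtain ⟨m, c⟩ := s
      cases m with
      | zero =>
        exact ⟨_, by norm_num, .ite_false (.seq (.seq (.tl_cons _ _) (.hd_cons _ _))
          (.hd_cons _ _)) (.seq (.tl_cons _ _) (.hd_cons _ _))⟩
      | succ m =>
        exact ⟨_, by norm_num, .ite_true (.seq (.seq (.tl_cons _ _) (.hd_cons _ _))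
          (.hd_cons _ _)) (.cons (.seq (.seq (.tl_cons _ _) (.hd_cons _ _)) (.seq (.hd_cons _ _)
          (.tl_cons _ _))) (.cons (.nil _) (.seq (.seq (.tl_cons _ _) (.hd_cons _ _))
          (.tl_cons _ _))))⟩
  rw [foldl_clip, zero_add] at hr
  exact ⟨_, by omega, .seq (.cons (.cons (.nil _) (.cons (.hd_cons _ _) (.nil _))) (.tl_cons _ _))
    (.seq hr (.tl_cons _ _))⟩

theorem sz_bits_le (x : Bits) : sz x ≤ 2 * x.length := by
  have := List.sum_le_card_nsmul (x.map sz) 1 (by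
    simp only [List.mem_map, forall_exists_index, and_imp]
    rintro _ b - rfl
    exact sz_bool b)
  rw [sz_eq_sum]
  simp at this
  omega

/-- Programs for functions of a word `x` and a parameter `l` that matters only up to `|x|`. -/
theorem exists_clipped {f : ℕ × Bits → β} (hf : PolyC f) :
    ∃ (P : Prog) (p : Polynomial ℕ), ∀ (l : ℕ) (x : Bits),
      RunsWithin P (pair (ofNat l) (ofBits x)) (enc (f (min l x.length, x))) (p.eval x.length) := by
  obtain ⟨P, p, hP⟩ := hf
  refine ⟨.seq (.cons clipProg .tl) P, p.comp (3 * Polynomial.X + 1) + 80 * Polynomial.X + 50,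
    fun l x => ?_⟩
  obtain ⟨t, ht, hr⟩ := runs_clipProg l x
  obtain ⟨⟨u, hu, hr'⟩, -⟩ := hP (min l x.length, x)
  have h1 : sz (min l x.length, x) ≤ 3 * x.length + 1 := by
    have := sz_bits_le x
    simp only [sz_pair, sz_nat]
    omega
  have h2 := hu.trans (eval_mono p h1)
  rw [← enc_nat, ← enc_bits]
  refine ⟨_, ?_, .seq (.cons hr (.tl_cons _ _)) hr'⟩
  simp only [Polynomial.eval_add, Polynomial.eval_comp, Polynomial.eval_mul, Polynomial.eval_X,
    Polynomial.eval_one, Polynomial.eval_ofNat]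
  omega

/-- Programs for decoders, which need not read the received word in the trivial case. -/
theorem exists_clipped_decoder {c : ℕ × ℕ → Bool} {g : (ℕ × ℕ) × Bits × γ → Bits}
    (hc : PolyC c) (hg : PolyC g) {H : Prog} {h : γ → Bits} {T : ℕ}
    (hH : ∀ w, ∃ t ≤ T, Runs H (enc w) (enc (h w)) t) (r : Polynomial ℕ) :
    ∃ (P : Prog) (p : Polynomial ℕ), ∀ (n l : ℕ) (y : Bits) (w : γ),
      (c (min l n, n) = true → sz y + sz w ≤ r.eval n) →
      RunsWithin P (pair (pair (ofNat n) (ofNat l)) (pair (ofBits y) (enc w)))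
        (ofBits (bif c (min l n, n) then g ((min l n, n), y, w) else h w)) (p.eval n) := by
  obtain ⟨P, p, hP⟩ := hg
  obtain ⟨Q, q, hQ⟩ := hc
  refine ⟨.seq (.cons (.cons (.seq (.cons (.seq .hd .tl) (.seq .hd .hd)) clipProg) (.seq .hd .hd))
    .tl) (.ite (.seq .hd Q) P (.seq (.seq .tl .tl) H)),
    q.comp (2 * Polynomial.X + 1) + p.comp (2 * Polynomial.X + 3 + r) + 80 * Polynomial.X + 100 +
      Polynomial.C T, fun n l y w hyw => ?_⟩
  obtain ⟨t, ht, hr⟩ := runs_clipProg l (List.replicate n ())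
  rw [enc_replicate_unit, List.length_replicate] at hr
  rw [List.length_replicate] at ht
  obtain ⟨⟨u, hu, hr'⟩, -⟩ := hQ (min l n, n)
  have h1 : sz (min l n, n) ≤ 2 * n + 1 := by
    simp only [sz_pair, sz_nat]
    omega
  have h2 := hu.trans (eval_mono q h1)
  have hr0 : Runs (.cons (.cons (.seq (.cons (.seq .hd .tl) (.seq .hd .hd)) clipProg)
      (.seq .hd .hd)) .tl) (enc ((n, l), y, w)) (enc ((min l n, n), y, w)) _ :=
    .cons (.cons (.seq (.cons (.seq (.hd_cons _ _) (.tl_cons _ _)) (.seq (.hd_cons _ _)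
      (.hd_cons _ _))) hr) (.seq (.hd_cons _ _) (.hd_cons _ _))) (.tl_cons _ _)
  rw [← enc_nat, ← enc_nat, ← enc_bits, ← enc_bits]
  change RunsWithin _ (enc ((n, l), y, w)) _ _
  simp only [RunsWithin, Polynomial.eval_add, Polynomial.eval_comp, Polynomial.eval_mul,
    Polynomial.eval_X, Polynomial.eval_one, Polynomial.eval_ofNat, Polynomial.eval_C]
  cases hcn : c (min l n, n)
  -- Here `y` is only passed on as a pointer, so no bound on its size is needed.
  · obtain ⟨v, hv, hrv⟩ := hH w
    rw [hcn] at hr'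
    refine ⟨_, ?_, .seq hr0 (.ite_false (.seq (.hd_cons _ _) hr')
      (.seq (.seq (.tl_cons _ _) (.tl_cons _ _)) hrv))⟩
    omega
  · obtain ⟨⟨v, hv, hrv⟩, -⟩ := hP ((min l n, n), y, w)
    have h3 : sz ((min l n, n), y, w) ≤ 2 * n + 3 + r.eval n := by
      have := hyw hcn
      simp only [sz_pair, sz_nat]
      omega
    have h4 := hv.trans (eval_mono p h3)
    rw [hcn] at hr'
    refine ⟨_, ?_, .seq hr0 (.ite_true (.seq (.hd_cons _ _) hr') hrv)⟩
    omega

/-! ### Lengths -/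

/-- Half a color has `m + 2` bits with `2 ^ m ≤ 3Δ ≤ 4Δ`, that is, at most `log Δ + 4`. -/
theorem colorBits_le {ι : Type} (Δ : ι → ℕ) (e : ι) (h : 0 < Δ e) :
    ((2 * (colorBits Δ e + 1) : ℕ) : ℝ) ≤ 2 * Real.logb 2 (Δ e) + 8 := by
  have h0 : (0 : ℝ) < Δ e := by exact_mod_cast h
  have h1 : 0 < Nat.clog 2 (3 * Δ e + 1) := Nat.clog_pos (by norm_num) (by omega)
  have h2 := Nat.pow_pred_clog_lt_self (b := 2) (by norm_num) (x := 3 * Δ e + 1) (by omega)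
  unfold colorBits
  obtain ⟨m, hm⟩ := Nat.exists_eq_add_of_lt h1
  rw [hm] at h2 ⊢
  simp only [zero_add, Nat.pred_eq_sub_one, Nat.add_sub_cancel] at h2 ⊢
  have h3 : ((2 : ℝ) ^ m) ≤ 4 * Δ e := by
    have : 2 ^ m ≤ 4 * Δ e := by omega
    exact_mod_cast this
  have h4 : (m : ℝ) ≤ Real.logb 2 (4 * Δ e) := by
    rw [Real.le_logb_iff_rpow_le (by norm_num) (by positivity), Real.rpow_natCast]
    exact h3
  rw [Real.logb_mul (by norm_num) h0.ne', show (4 : ℝ) = 2 ^ (2 : ℝ) by norm_num,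
    Real.logb_rpow (by norm_num) (by norm_num)] at h4
  push_cast
  linarith

theorem logb_degBound (k : ℕ) (Λ : ℕ × ℕ → ℕ) (e : ℕ × ℕ) (hn : 0 < e.2) (hΛ : 0 < Λ e) :
    2 * Real.logb 2 (degBound k Λ e) = 4 * k * Real.logb 2 e.2 +
      8 * k * Real.logb 2 (e.1 + 1) + 2 * Real.logb 2 (Λ e) + 4 * k * Real.logb 2 (2 * k + 1) := by
  have h1 : (e.2 : ℝ) ≠ 0 := by exact_mod_cast hn.ne'
  have h2 : (Λ e : ℝ) ≠ 0 := by exact_mod_cast hΛ.ne'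
  have h3 : (e.1 + 1 : ℝ) ≠ 0 := by positivity
  have h4 : (2 * k + 1 : ℝ) ≠ 0 := by positivity
  unfold degBound editRange
  push_cast
  rw [Real.logb_mul (by positivity) h2, Real.logb_pow, Real.logb_mul (by positivity) (by positivity),
    Real.logb_mul h4 h1, Real.logb_pow]
  push_cast
  ring

theorem degBound_pos (k : ℕ) (Λ : ℕ × ℕ → ℕ) (e : ℕ × ℕ) (hn : 0 < e.2) (hΛ : 0 < Λ e) :
    0 < degBound k Λ e := by
  unfold degBound editRange
  positivity

theorem logb_logb_three_pos : 0 < Real.logb 2 (Real.logb 2 3) := by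
  refine Real.logb_pos (by norm_num) ?_
  rw [Real.lt_logb_iff_rpow_lt (by norm_num) (by norm_num)]
  norm_num

/-- The schemes lose only a constant, which fits into the `O(log log n)` term because `log log n` is
bounded away from zero for `n ≥ 3`. -/
theorem le_mul_logb_logb {A : ℝ} (hA : 0 ≤ A) {n : ℕ} (hn : 3 ≤ n) :
    A ≤ A / Real.logb 2 (Real.logb 2 3) * Real.logb 2 (Real.logb 2 n) := by
  have h0 := logb_logb_three_pos
  have h3 : (3 : ℝ) ≤ n := by exact_mod_cast hn
  have h1 : Real.logb 2 3 ≤ Real.logb 2 n :=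
    Real.logb_le_logb_of_le (by norm_num) (by norm_num) h3
  have h2 : 0 < Real.logb 2 3 := Real.logb_pos (by norm_num) (by norm_num)
  have h4 := Real.logb_le_logb_of_le (b := 2) (by norm_num) h2 h1
  calc A = A / Real.logb 2 (Real.logb 2 3) * Real.logb 2 (Real.logb 2 3) := by field_simp
    _ ≤ _ := by gcongr

/-- Pigeonhole: some class has at least the average size `2 ^ n / 2 ^ r`. -/
theorem exists_color_class {n r : ℕ} (Φ : Word n → Word r) :
    ∃ a, redundancy {x : Word n | Φ x = a} ≤ r := by
  classical
  obtain ⟨a, ha⟩ := Fintype.exists_le_card_fiber_of_nsmul_le_card (M := ℝ) Φ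
    (b := 2 ^ n / 2 ^ r) (by
      rw [nsmul_eq_mul, card_vector, card_vector]
      simp only [Fintype.card_bool]
      push_cast
      rw [mul_div_cancel₀ _ (by positivity)])
  refine ⟨a, ?_⟩
  have h1 : {x : Word n | Φ x = a}.ncard = (Finset.univ.filter (fun x => Φ x = a)).card := by
    rw [← Set.ncard_coe_finset]
    congr 1
    ext
    simp
  rw [redundancy, h1]
  have h2 := Real.logb_le_logb_of_le (b := 2) (by norm_num) (by positivity) ha
  rw [Real.logb_div (by positivity) (by positivity), Real.logb_pow, Real.logb_pow,
    Real.logb_self_eq_one (by norm_num)] at h2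
  linarith

/-! ### The complete syndromes -/

/-- Parameters for which a syndrome is the whole word. -/
def trivialParam (N : ℕ) (e : ℕ × ℕ) : Bool := decide (e.2 ≤ e.1) || decide (e.2 < N)

theorem trivialParam_min (N l n : ℕ) : trivialParam N (min l n, n) = trivialParam N (l, n) := by
  unfold trivialParam
  congr 1
  simp

theorem trivialParam_eq_false {N : ℕ} {e : ℕ × ℕ} :
    trivialParam N e = false ↔ e.1 < e.2 ∧ N ≤ e.2 := by
  simp [trivialParam]

section

variable (k N : ℕ) (φ : (ℕ × ℕ) × Bits → Bits) (solve : (ℕ × ℕ) × Mask × Bits → List Bits)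
  (Λ r : ℕ × ℕ → ℕ)

/-- First part of the syndrome. -/
def firstSynd (e : ℕ × ℕ) (x : Bits) : Bits := bif trivialParam N e then x else φ (e, x)

/-- Second part of the syndrome. -/
noncomputable def secondSynd (e : ℕ × ℕ) (x : Bits) : Bits :=
  bif trivialParam N e then [] else syndColor k φ solve Λ e x

/-- Length of the first part. -/
def firstLength (e : ℕ × ℕ) : ℕ := bif trivialParam N e then e.2 else r e

/-- Length of the second part. -/
def secondLength (e : ℕ × ℕ) : ℕ :=
  bif trivialParam N e then 0 else 2 * (colorBits (degBound k Λ) e + 1)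

variable {k N φ solve Λ r}

theorem length_firstSynd (hr : ∀ e x, x.length = e.2 → (φ (e, x)).length = r e) {e : ℕ × ℕ}
    {x : Bits} (hx : x.length = e.2) : (firstSynd N φ e x).length = firstLength N r e := by
  unfold firstSynd firstLength
  cases trivialParam N e
  · exact hr e x hx
  · exact hx

theorem length_secondSynd (e : ℕ × ℕ) (x : Bits) :
    (secondSynd k N φ solve Λ e x).length = secondLength k N Λ e := by
  unfold secondSynd secondLength
  cases trivialParam N e
  · rw [cond_false, cond_false, syndColor, length_color]
  · rfl

/-- Clipping changes `l` only if `n < l`, and then the syndrome is trivial and does not depend on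
`l`. -/
theorem firstSynd_min (l n : ℕ) (x : Bits) :
    firstSynd N φ (min l n, n) x = firstSynd N φ (l, n) x := by
  unfold firstSynd
  rw [trivialParam_min]
  cases h : trivialParam N (l, n)
  · rw [min_eq_left (trivialParam_eq_false.1 h).1.le]
  · simp only [cond_true]

theorem secondSynd_min (l n : ℕ) (x : Bits) :
    secondSynd k N φ solve Λ (min l n, n) x = secondSynd k N φ solve Λ (l, n) x := by
  unfold secondSynd
  rw [trivialParam_min]
  cases h : trivialParam N (l, n)
  · rw [min_eq_left (trivialParam_eq_false.1 h).1.le]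
  · simp only [cond_true]

@[fun_prop]
theorem PolyC.trivialParam (N : ℕ) {e : α → ℕ × ℕ} (he : PolyC e) :
    PolyC (fun a => trivialParam N (e a)) := by
  unfold SubstringEdits.trivialParam
  fun_prop

@[fun_prop]
theorem PolyC.firstSynd (hφ : PolyC φ) {e : α → ℕ × ℕ} {x : α → Bits} (he : PolyC e)
    (hx : PolyC x) : PolyC (fun a => firstSynd N φ (e a) (x a)) := by
  unfold SubstringEdits.firstSynd
  fun_prop

@[fun_prop]
theorem PolyC.secondSynd (hφ : PolyC φ) (hs : PolyC solve) (hΛ : PolyC Λ) {e : α → ℕ × ℕ}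
    {x : α → Bits} (he : PolyC e) (hx : PolyC x) :
    PolyC (fun a => secondSynd k N φ solve Λ (e a) (x a)) := by
  unfold SubstringEdits.secondSynd
  exact .cond (by fun_prop) (by fun_prop) (hφ.syndColor hs hΛ he hx)

theorem secondLength_le (hk : 0 < k) {l n : ℕ} (hΛ : trivialParam N (l, n) = false → 0 < Λ (l, n))
    (hn : 3 ≤ n) : (secondLength k N Λ (l, n) : ℝ) ≤ 4 * k * Real.logb 2 n +
      8 * k * Real.logb 2 (l + 1) +
      (bif trivialParam N (l, n) then 0 else 2 * Real.logb 2 (Λ (l, n))) +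
      (4 * k * Real.logb 2 (2 * k + 1) + 8) := by
  have h1 : 0 ≤ Real.logb 2 (n : ℝ) := Real.logb_nonneg (by norm_num) (by exact_mod_cast by omega)
  have h2 : 0 ≤ Real.logb 2 (l + 1 : ℝ) := Real.logb_nonneg (by norm_num) (by simp)
  have h3 : 0 ≤ Real.logb 2 (2 * k + 1 : ℝ) := Real.logb_nonneg (by norm_num) (by
    have : (0 : ℝ) ≤ k := by positivity
    linarith)
  unfold secondLength
  cases h : trivialParam N (l, n)
  · have h4 := logb_degBound k Λ (l, n) (by simp only; omega) (hΛ h)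
    have h5 := colorBits_le (degBound k Λ) (l, n)
      (degBound_pos k Λ (l, n) (by simp only; omega) (hΛ h))
    simp only [cond_false] at h4 h5 ⊢
    linarith
  · simp only [cond_true, Nat.cast_zero]
    positivity

theorem disjoint_syndromes (hk : 0 < k) {e : ℕ × ℕ}
    (hsol : trivialParam N e = false → Solves k φ solve Λ e) {x x' y : Bits}
    (hx : x.length = e.2) (hx' : x'.length = e.2) (hy : y ∈ channel e.1 k x)
    (hy' : y ∈ channel e.1 k x') (hne : x ≠ x') (h1 : firstSynd N φ e x = firstSynd N φ e x') :
    secondSynd k N φ solve Λ e x ≠ secondSynd k N φ solve Λ e x' := by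
  unfold firstSynd at h1
  unfold secondSynd
  cases h : trivialParam N e
  · rw [h] at h1
    exact syndColor_ne_of_channel (hsol h) hk (trivialParam_eq_false.1 h).1 hx hx' hy hy' h1 hne
  · rw [h] at h1
    exact absurd h1 hne

theorem sz_received_le {l n : ℕ} {x y : Bits} (hx : x.length = n) (hy : y ∈ channel l k x)
    (hl : l < n) : sz y ≤ (2 * k + 2) * n := by
  have h1 := sz_bits_le y
  have h2 := channel_length_le hy
  have h3 := Nat.mul_le_mul_left k hl.le
  rw [hx] at h2
  nlinarith

/-- The systematic code given by the concatenation of the two parts. -/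
theorem exists_systematic_code (hk : 0 < k) (l : ℕ → ℕ) (hφ : PolyC φ) (hs : PolyC solve)
    (hΛ : PolyC Λ) (hr : PolyC r) (hlen : ∀ e x, x.length = e.2 → (φ (e, x)).length = r e)
    (hsol : ∀ n, N ≤ n → l n < n → Solves k φ solve Λ (l n, n))
    (hbound : ∀ n, N ≤ n → l n < n →
      (r (l n, n) : ℝ) + 2 * Real.logb 2 (Λ (l n, n)) ≤ 4 * k * l n) :
    ∃ (ρ : ℕ → ℕ) (Φ : ∀ n, Word n → Word (ρ n)),
      (∃ c : ℝ, ∀ n : ℕ, 3 ≤ n →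
        (ρ n : ℝ) ≤ 4 * k * Real.logb 2 n + 4 * k * l n + 8 * k * Real.logb 2 (l n + 1)
          + c * Real.logb 2 (Real.logb 2 n)) ∧
      (∀ n, IsSystematicCode (channel (l n) k) (Φ n)) ∧
      (∀ n, ∃ a : Word (ρ n), Corrects (channel (l n) k) {x : Word n | Φ n x = a} ∧
        redundancy {x : Word n | Φ n x = a} ≤ ρ n) ∧
      HasPolyTimeEncoder l Φ ∧ HasPolyTimeDecoder k l Φ := by
  have hsol' : ∀ n, trivialParam N (l n, n) = false → Solves k φ solve Λ (l n, n) := fun n h =>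
    hsol n (trivialParam_eq_false.1 h).2 (trivialParam_eq_false.1 h).1
  let F : ℕ × ℕ → Bits → Bits := fun e x => firstSynd N φ e x ++ secondSynd k N φ solve Λ e x
  have hF : ∀ n (x : Word n), (F (l n, n) x.toList).length =
      firstLength N r (l n, n) + secondLength k N Λ (l n, n) := fun n x => by
    rw [List.length_append, length_firstSynd hlen (by simp), length_secondSynd]
  let Φ : ∀ n, Word n → Word (firstLength N r (l n, n) + secondLength k N Λ (l n, n)) :=
    fun n x => ⟨F (l n, n) x.toList, hF n x⟩
  have hΦ : ∀ n x, (Φ n x).toList = F (l n, n) x.toList := fun n x => rfl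
  have hFpoly : PolyC (fun p : ℕ × Bits => F (p.1, p.2.length) p.2) :=
    .append (hφ.firstSynd (by fun_prop) (by fun_prop))
      (hφ.secondSynd hs hΛ (by fun_prop) (by fun_prop))
  have hFmin : ∀ l n x, F (min l n, n) x = F (l, n) x := fun l n x => by
    simp only [F, firstSynd_min, secondSynd_min]
  have hcode : ∀ n, IsSystematicCode (channel (l n) k) (Φ n) := by
    intro n x x' y hne hy hy' h
    have h1 : F (l n, n) x.toList = F (l n, n) x'.toList := congrArg (·.toList) h
    obtain ⟨h2, h3⟩ := List.append_inj h1 (by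
      rw [length_firstSynd hlen (by simp), length_firstSynd hlen (by simp)])
    exact disjoint_syndromes hk (hsol' n) (by simp) (by simp) hy hy'
      (fun h => hne (List.Vector.eq _ _ h)) h2 h3
  refine ⟨_, Φ, ?_, hcode, ?_, ?_, ?_⟩
  · refine ⟨(N + (4 * k * Real.logb 2 (2 * k + 1) + 8)) / Real.logb 2 (Real.logb 2 3),
      fun n hn => ?_⟩
    have h3 : 0 ≤ Real.logb 2 (2 * k + 1 : ℝ) := Real.logb_nonneg (by norm_num) (by
      have : (0 : ℝ) ≤ k := by positivity
      linarith)
    have h4 := le_mul_logb_logb (A := N + (4 * k * Real.logb 2 (2 * k + 1) + 8)) (by positivity) hn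
    have h5 := secondLength_le (N := N) (Λ := Λ) hk (fun h => (hsol' n h).pos) hn
    -- In the trivial case the word itself is stored, and `n ≤ l n + N`. The term `N` goes into the
    -- constant, so the bound holds for all `n ≥ 3`.
    have h6 : (firstLength N r (l n, n) : ℝ) +
        (bif trivialParam N (l n, n) then 0 else 2 * Real.logb 2 (Λ (l n, n))) ≤
          4 * k * l n + N := by
      have hk1 : (1 : ℝ) ≤ k := by exact_mod_cast hk
      unfold firstLength
      cases h : trivialParam N (l n, n)
      · have := hbound n (trivialParam_eq_false.1 h).2 (trivialParam_eq_false.1 h).1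
        simp only [cond_false]
        have : (0 : ℝ) ≤ N := by positivity
        linarith
      · have h7 : n ≤ l n + N := by
          simp only [trivialParam, Bool.or_eq_true, decide_eq_true_eq] at h
          omega
        have h8 : (n : ℝ) ≤ l n + N := by exact_mod_cast h7
        simp only [cond_true, add_zero]
        nlinarith [(by positivity : (0 : ℝ) ≤ l n)]
    push_cast
    linarith
  · intro n
    obtain ⟨a, ha⟩ := exists_color_class (Φ n)
    refine ⟨a, fun x hx x' hx' hne => ?_, ha⟩
    rw [Set.disjoint_left]
    exact fun y hy hy' => hcode n x x' y hne hy hy' (Eq.trans hx (Eq.symm hx'))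
  · obtain ⟨P, p, hP⟩ := exists_clipped (PolyC.mk PolyC.snd' hFpoly)
    refine ⟨P, p, fun n x => ?_⟩
    have := hP (l n) x.toList
    simp only [List.Vector.toList_length, hFmin] at this
    rw [enc_pair, enc_bits, enc_bits] at this
    exact this
  · have ⟨_, q, hq⟩ := hFpoly
    obtain ⟨P, p, hP⟩ := exists_clipped_decoder (γ := Bits) (c := fun e => !trivialParam N e)
      (g := fun a => decoder k φ solve Λ a.1 a.2.1 (a.2.2.take (r a.1)) (a.2.2.drop (r a.1)))
      (by fun_prop) (hφ.decoder hs hΛ (by fun_prop) (by fun_prop) (by fun_prop) (by fun_prop))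
      (H := .skip) (h := fun w => w) (T := 1) (fun w => ⟨1, le_rfl, .skip _⟩)
      ((2 * Polynomial.C k + 2) * Polynomial.X + q.comp (3 * Polynomial.X + 1))
    refine ⟨P, p, fun n x y hy => ?_⟩
    -- The received data have to be short only in the nontrivial case, where `l n < n` makes `y`
    -- linear in `n`.
    have h1 := hP n (l n) y (Φ n x).toList (fun hc => by
      have h2 : l n < n := by
        simp only [trivialParam_min, Bool.not_eq_true', trivialParam_eq_false] at hc
        exact hc.1
      have h3 := sz_received_le (x := x.toList) (by simp) hy h2
      have h4 := (hq (l n, x.toList)).2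
      have h5 : sz (l n, x.toList) ≤ 3 * n + 1 := by
        have := sz_bits_le x.toList
        simp only [sz_pair, sz_nat, List.Vector.toList_length] at this ⊢
        omega
      have h6 := h4.trans (eval_mono q h5)
      simp only [List.Vector.toList_length] at h6
      simp only [Polynomial.eval_add, Polynomial.eval_comp, Polynomial.eval_mul, Polynomial.eval_X,
        Polynomial.eval_one, Polynomial.eval_ofNat, Polynomial.eval_C]
      exact add_le_add h3 h6)
    rw [enc_bits] at h1
    convert h1 using 2
    rw [trivialParam_min, hΦ]
    cases h : trivialParam N (l n, n)
    · have h2 := (trivialParam_eq_false.1 h).1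
      simp only [F, firstSynd, secondSynd, h, Bool.not_false, cond_true, cond_false]
      simp only at h2
      rw [min_eq_left h2.le, List.take_left' (hlen _ _ (by simp)),
        List.drop_left' (hlen _ _ (by simp))]
      exact (decoder_eq (hsol' n h) hk h2 (by simp) hy).symm
    · simp [F, firstSynd, secondSynd, h]

/-- The syndrome in two parts. -/
theorem exists_two_syndromes (hk : 0 < k) (l : ℕ → ℕ) (hN : 3 ≤ N) (hφ : PolyC φ)
    (hs : PolyC solve) (hΛ : PolyC Λ) (hlen : ∀ e x, x.length = e.2 → (φ (e, x)).length = r e)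
    (hsol : ∀ n, N ≤ n → l n < n → Solves k φ solve Λ (l n, n))
    (hr : ∀ n, N ≤ n → l n < n → r (l n, n) ≤ 4 * k * l n)
    (hΛ1 : ∀ n, N ≤ n → l n < n → Λ (l n, n) = 1)
    (hburst : ∀ n, N ≤ n → l n < n → ∀ x x' : Word n, AgreeOutsideBursts (2 * k) (l n) x x' →
      φ ((l n, n), x.toList) = φ ((l n, n), x'.toList) → x = x') :
    ∃ (N : ℕ) (c : ℝ) (ρ₁ ρ₂ : ℕ → ℕ)
      (φ₁ : ∀ n, Word n → Word (ρ₁ n)) (φ₂ : ∀ n, Word n → Word (ρ₂ n)),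
      (∀ n ≥ N,
        ρ₁ n ≤ 4 * k * l n ∧
        (ρ₂ n : ℝ) ≤ 4 * k * Real.logb 2 n + 8 * k * Real.logb 2 (l n + 1)
          + c * Real.logb 2 (Real.logb 2 n) ∧
        CorrectsBurstErasures (2 * k) (l n) (φ₁ n) ∧
        IsColoring (reducedGraph (channel (l n) k) (φ₁ n)) (φ₂ n)) ∧
      PolyTimeComputable l N φ₁ ∧ PolyTimeComputable l N φ₂ ∧
      HasPolyTimeRecovery k l N φ₁ φ₂ := by
  have hsol' : ∀ n, trivialParam N (l n, n) = false → Solves k φ solve Λ (l n, n) := fun n h =>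
    hsol n (trivialParam_eq_false.1 h).2 (trivialParam_eq_false.1 h).1
  let φ₁ : ∀ n, Word n → Word (firstLength N r (l n, n)) :=
    fun n x => ⟨firstSynd N φ (l n, n) x.toList, length_firstSynd hlen (by simp)⟩
  let φ₂ : ∀ n, Word n → Word (secondLength k N Λ (l n, n)) :=
    fun n x => ⟨secondSynd k N φ solve Λ (l n, n) x.toList, length_secondSynd _ _⟩
  have h₁ : ∀ n x, (φ₁ n x).toList = firstSynd N φ (l n, n) x.toList := fun n x => rfl
  have h₂ : ∀ n x, (φ₂ n x).toList = secondSynd k N φ solve Λ (l n, n) x.toList := fun n x => rfl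
  have hp₁ : PolyC (fun p : ℕ × Bits => firstSynd N φ (p.1, p.2.length) p.2) :=
    hφ.firstSynd (by fun_prop) (by fun_prop)
  have hp₂ : PolyC (fun p : ℕ × Bits => secondSynd k N φ solve Λ (p.1, p.2.length) p.2) :=
    hφ.secondSynd hs hΛ (by fun_prop) (by fun_prop)
  refine ⟨N, (4 * k * Real.logb 2 (2 * k + 1) + 8) / Real.logb 2 (Real.logb 2 3), _, _, φ₁, φ₂,
    fun n hn => ⟨?_, ?_, ?_, ?_⟩, ?_, ?_, ?_⟩
  · unfold firstLength
    cases h : trivialParam N (l n, n)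
    · exact hr n hn (trivialParam_eq_false.1 h).1
    · simp only [trivialParam, Bool.or_eq_true, decide_eq_true_eq] at h
      have h' : n ≤ l n := by omega
      exact h'.trans (Nat.le_mul_of_pos_left _ (by omega))
  · have h3 : 0 ≤ Real.logb 2 (2 * k + 1 : ℝ) := Real.logb_nonneg (by norm_num) (by
      have : (0 : ℝ) ≤ k := by positivity
      linarith)
    have h4 := le_mul_logb_logb (A := 4 * k * Real.logb 2 (2 * k + 1) + 8) (by positivity)
      (hN.trans hn)
    have h5 := secondLength_le (N := N) (Λ := Λ) hk (fun h => (hsol' n h).pos) (hN.trans hn)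
    have h6 : (bif trivialParam N (l n, n) then 0 else 2 * Real.logb 2 (Λ (l n, n))) = 0 := by
      cases h : trivialParam N (l n, n)
      · rw [cond_false, hΛ1 n hn (trivialParam_eq_false.1 h).1]
        simp
      · rfl
    linarith
  · intro x x' hb h
    have h1 : firstSynd N φ (l n, n) x.toList = firstSynd N φ (l n, n) x'.toList :=
      congrArg (·.toList) h
    unfold firstSynd at h1
    cases h : trivialParam N (l n, n)
    · rw [h] at h1
      exact hburst n hn (trivialParam_eq_false.1 h).1 x x' hb h1
    · rw [h] at h1
      exact List.Vector.eq _ _ h1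
  · rintro x x' ⟨⟨hne, y, hy, hy'⟩, h1⟩ h2
    exact disjoint_syndromes hk (hsol' n) (by simp) (by simp) hy hy'
      (fun h => hne (List.Vector.eq _ _ h)) (congrArg (·.toList) h1) (congrArg (·.toList) h2)
  · obtain ⟨P, p, hP⟩ := exists_clipped hp₁
    refine ⟨P, p, fun n _ x => ?_⟩
    have := hP (l n) x.toList
    simp only [List.Vector.toList_length, firstSynd_min] at this
    rwa [enc_bits] at this
  · obtain ⟨P, p, hP⟩ := exists_clipped hp₂
    refine ⟨P, p, fun n _ x => ?_⟩
    have := hP (l n) x.toList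
    simp only [List.Vector.toList_length, secondSynd_min] at this
    rwa [enc_bits] at this
  · have ⟨_, q₁, hq₁⟩ := hp₁
    have ⟨_, q₂, hq₂⟩ := hp₂
    obtain ⟨P, p, hP⟩ := exists_clipped_decoder (γ := Bits × Bits)
      (c := fun e => !trivialParam N e)
      (g := fun a => decoder k φ solve Λ a.1 a.2.1 a.2.2.1 a.2.2.2)
      (by fun_prop) (hφ.decoder hs hΛ (by fun_prop) (by fun_prop) (by fun_prop) (by fun_prop))
      (H := .hd) (h := fun w => w.1) (T := 1) (fun w => ⟨1, le_rfl, .hd_cons _ _⟩)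
      ((2 * Polynomial.C k + 2) * Polynomial.X + ((q₁ + q₂).comp (3 * Polynomial.X + 1) + 1))
    refine ⟨P, p, fun n hn x y hy => ?_⟩
    have h1 := hP n (l n) y ((φ₁ n x).toList, (φ₂ n x).toList) (fun hc => by
      have h2 : l n < n := by
        simp only [trivialParam_min, Bool.not_eq_true', trivialParam_eq_false] at hc
        exact hc.1
      have h3 := sz_received_le (x := x.toList) (by simp) hy h2
      have h4 := (hq₁ (l n, x.toList)).2
      have h4' := (hq₂ (l n, x.toList)).2
      have h5 : sz (l n, x.toList) ≤ 3 * n + 1 := by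
        have := sz_bits_le x.toList
        simp only [sz_pair, sz_nat, List.Vector.toList_length] at this ⊢
        omega
      have h6 := h4.trans (eval_mono q₁ h5)
      have h6' := h4'.trans (eval_mono q₂ h5)
      simp only [List.Vector.toList_length] at h6 h6'
      simp only [Polynomial.eval_add, Polynomial.eval_comp, Polynomial.eval_mul, Polynomial.eval_X,
        Polynomial.eval_one, Polynomial.eval_ofNat, Polynomial.eval_C, sz_pair]
      refine add_le_add h3 ?_
      rw [h₁, h₂]
      omega)
    rw [enc_pair, enc_bits, enc_bits] at h1
    convert h1 using 2
    rw [trivialParam_min]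
    simp only [h₁, h₂]
    cases h : trivialParam N (l n, n)
    · have h2 := (trivialParam_eq_false.1 h).1
      simp only [firstSynd, secondSynd, h, Bool.not_false, cond_true, cond_false]
      simp only at h2
      rw [min_eq_left h2.le]
      exact (decoder_eq (hsol' n h) hk h2 (by simp) hy).symm
    · simp [firstSynd, h]

end

/-! ### Growth of the edit length -/

theorem logb_le_log_add_one {n : ℕ} (hn : 0 < n) : Real.logb 2 n ≤ Nat.log 2 n + 1 := by
  have h0 : (0 : ℝ) < n := by exact_mod_cast hn
  have h1 : (n : ℝ) ≤ 2 ^ (Nat.log 2 n + 1) := by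
    exact_mod_cast (Nat.lt_pow_succ_log_self (by norm_num) n).le
  have h2 := Real.logb_le_logb_of_le (b := 2) (by norm_num) h0 h1
  rw [Real.logb_pow, Real.logb_self_eq_one (by norm_num)] at h2
  push_cast at h2
  linarith

/-- Eventually `l n ≤ a (log n + 1)`, which gives the exponent `2ka`; the sum inside `K` takes care
of the finitely many other `n`. -/
theorem exists_poly_bound {l : ℕ → ℕ} (k : ℕ)
    (h : (fun n : ℕ => (l n : ℝ)) =O[atTop] fun n : ℕ => Real.logb 2 (n : ℝ)) :
    ∃ K C : ℕ, ∀ n, 2 ^ (2 * k * l n) ≤ K * (n + 1) ^ C := by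
  obtain ⟨c, hc⟩ := h.bound
  obtain ⟨N, hN⟩ := eventually_atTop.1 hc
  obtain ⟨a, ha⟩ := exists_nat_ge c
  refine ⟨2 ^ (2 * k * a) + ∑ i ∈ Finset.range (N + 1), 2 ^ (2 * k * l i), 2 * k * a, fun n => ?_⟩
  rw [add_mul]
  rcases Nat.lt_or_ge n (N + 1) with hn | hn
  · have h1 := Finset.single_le_sum (f := fun i => 2 ^ (2 * k * l i)) (fun _ _ => Nat.zero_le _)
      (Finset.mem_range.2 hn)
    exact (h1.trans (Nat.le_mul_of_pos_right _ (by positivity))).trans (Nat.le_add_left _ _)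
  · refine le_trans ?_ (Nat.le_add_right _ _)
    have h1 := hN n (by omega)
    have hn1 : (1 : ℝ) ≤ n := by exact_mod_cast (show 1 ≤ n by omega)
    have h2 : 0 ≤ Real.logb 2 (n : ℝ) := Real.logb_nonneg (by norm_num) hn1
    rw [Real.norm_of_nonneg (by positivity), Real.norm_of_nonneg h2] at h1
    have h3 := logb_le_log_add_one (n := n) (by omega)
    have h4 : (l n : ℝ) ≤ a * (Nat.log 2 n + 1) :=
      h1.trans (mul_le_mul ha h3 h2 (by positivity))
    have h5 : l n ≤ a * (Nat.log 2 n + 1) := by exact_mod_cast h4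
    have h6 : 2 ^ (Nat.log 2 n + 1) ≤ 2 * (n + 1) := by
      have := Nat.pow_log_le_self 2 (x := n) (by omega)
      rw [pow_succ]
      omega
    calc 2 ^ (2 * k * l n) ≤ 2 ^ ((Nat.log 2 n + 1) * (2 * k * a)) :=
          Nat.pow_le_pow_right (by norm_num) (by nlinarith [Nat.mul_le_mul_left (2 * k) h5])
      _ = (2 ^ (Nat.log 2 n + 1)) ^ (2 * k * a) := pow_mul _ _ _
      _ ≤ (2 * (n + 1)) ^ (2 * k * a) := Nat.pow_le_pow_left h6 _
      _ = _ := by rw [mul_pow]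

/-- With `B = 4k - 1`, block length `m` and `q = l / m`, the left side is `B q m + B q + B (2m +
2)`. The first term is at most `B l`. The others are at most `l / 2` each: the second since `m ≥
8k`, the third since `l ≥ 32 k log n` for large `n`. -/
theorem exists_burst_bound {l : ℕ → ℕ} {k : ℕ} (hk : 0 < k)
    (h : (fun n : ℕ => Real.logb 2 (n : ℝ)) =o[atTop] fun n : ℕ => (l n : ℝ)) :
    ∃ N, 3 ≤ N ∧ ∀ n, N ≤ n →
      depth (l n, n) * ((4 * k - 1) * (Nat.clog 2 n + 1)) ≤ 4 * k * l n := by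
  have hk0 : (0 : ℝ) < k := by exact_mod_cast hk
  obtain ⟨N, hN⟩ := eventually_atTop.1 (h.bound (c := 1 / (32 * k)) (by positivity))
  refine ⟨N + 2 ^ (8 * k), ?_, fun n hn => ?_⟩
  · have := Nat.pow_le_pow_right (n := 2) (by norm_num) (show 2 ≤ 8 * k by omega)
    omega
  · have h1 := hN n ((Nat.le_add_right _ _).trans hn)
    have hn8 : 2 ^ (8 * k) ≤ n := (Nat.le_add_left _ _).trans hn
    have hm8 : 8 * k ≤ Nat.log 2 n := Nat.le_log_of_pow_le (by norm_num) hn8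
    have hm8' : 8 * k ≤ Nat.clog 2 n := hm8.trans (Nat.log_le_clog 2 n)
    have hm : Nat.clog 2 n ≤ Nat.log 2 n + 1 :=
      Nat.clog_le_of_le_pow (Nat.lt_pow_succ_log_self (by norm_num) n).le
    have h2 : (Nat.log 2 n : ℝ) ≤ Real.logb 2 n := by
      have hn0 : (0 : ℝ) < n := by
        exact_mod_cast (show 0 < n from lt_of_lt_of_le (by positivity) hn8)
      rw [Real.le_logb_iff_rpow_le (by norm_num) hn0, Real.rpow_natCast]
      exact_mod_cast Nat.pow_log_le_self 2 (x := n) (by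
        have : 0 < 2 ^ (8 * k) := by positivity
        omega)
    rw [Real.norm_of_nonneg (le_trans (by positivity) h2), Real.norm_of_nonneg (by positivity)] at h1
    have h3 : (32 * k * Nat.log 2 n : ℝ) ≤ l n := by
      have := h2.trans h1
      rw [div_mul_eq_mul_div, one_mul, le_div_iff₀ (by positivity)] at this
      linarith
    have h4 : 32 * k * Nat.log 2 n ≤ l n := by exact_mod_cast h3
    have h5 : 8 * k * (2 * Nat.clog 2 n + 2) ≤ l n := by
      have : 2 * Nat.clog 2 n + 2 ≤ 4 * Nat.log 2 n := by omega
      calc _ ≤ 8 * k * (4 * Nat.log 2 n) := Nat.mul_le_mul_left _ this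
        _ = 32 * k * Nat.log 2 n := by ring
        _ ≤ _ := h4
    unfold depth
    simp only
    set m := Nat.clog 2 n
    set q := l n / m
    have h6 : q * m ≤ l n := Nat.div_mul_le_self _ _
    have h7 : 8 * k * q ≤ l n := by
      calc _ ≤ m * q := Nat.mul_le_mul_right _ hm8'
        _ = q * m := mul_comm _ _
        _ ≤ _ := h6
    obtain ⟨B, hB⟩ : ∃ B, 4 * k = B + 1 := ⟨4 * k - 1, by omega⟩
    rw [hB, Nat.add_sub_cancel]
    have h8 : 2 * ((B + 1) * q) ≤ l n := by rw [← hB]; linarith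
    have h9 : 2 * ((B + 1) * (2 * m + 2)) ≤ l n := by rw [← hB]; linarith
    have h10 : B * (q * m) ≤ B * l n := Nat.mul_le_mul_left _ h6
    nlinarith

/-- The checks are designed for `4k - 1` windows, which is at least `2k` since `k ≥ 1`. -/
theorem eq_of_agreeOutsideBursts {k : ℕ} (hk : 0 < k) {l n : ℕ} (hn : 2 ≤ n) {x x' : Word n}
    (h : AgreeOutsideBursts (2 * k) l x x')
    (hs : burstSynd (4 * k - 1) (l, n) x.toList = burstSynd (4 * k - 1) (l, n) x'.toList) :
    x = x' := by
  obtain ⟨s, hs'⟩ := h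
  refine List.Vector.eq _ _ (eq_of_burstSynd_eq (e := (l, n)) hn (by simp) (by simp)
    (S := Finset.univ.image s) ?_ (fun i hi hne => ?_) hs)
  · refine Finset.card_image_le.trans ?_
    rw [Finset.card_univ, Fintype.card_fin]
    omega
  · by_contra hno
    refine hne ?_
    have := hs' ⟨i, hi⟩ fun j hj => hno ⟨s j, Finset.mem_image_of_mem _ (Finset.mem_univ _), hj⟩
    simpa [List.Vector.get_eq_get_toList, List.getD_eq_getElem?_getD, hi] using this

end SubstringEdits

/-! ### The theorem, from the two schemes. -/

open SubstringEdits
theorem theorem5 (k : ℕ) (hk : 0 < k) (l : ℕ → ℕ) :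
    -- the code, for `l = O(log n)` or `l = ω(log n)`
    ((((fun n : ℕ => (l n : ℝ)) =O[atTop] fun n : ℕ => Real.logb 2 (n : ℝ)) ∨
        ((fun n : ℕ => Real.logb 2 (n : ℝ)) =o[atTop] fun n : ℕ => (l n : ℝ))) →
      ∃ (ρ : ℕ → ℕ) (Φ : ∀ n, Word n → Word (ρ n)),
        (∃ c : ℝ, ∀ n : ℕ, 3 ≤ n →
          (ρ n : ℝ) ≤ 4 * k * Real.logb 2 n + 4 * k * l n + 8 * k * Real.logb 2 (l n + 1)
            + c * Real.logb 2 (Real.logb 2 n)) ∧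
        (∀ n, IsSystematicCode (channel (l n) k) (Φ n)) ∧
        (∀ n, ∃ a : Word (ρ n), Corrects (channel (l n) k) {x : Word n | Φ n x = a} ∧
          redundancy {x : Word n | Φ n x = a} ≤ ρ n) ∧
        HasPolyTimeEncoder l Φ ∧ HasPolyTimeDecoder k l Φ) ∧
    -- the two-part syndrome, for `l = ω(log n)`
    (((fun n : ℕ => Real.logb 2 (n : ℝ)) =o[atTop] fun n : ℕ => (l n : ℝ)) →
      ∃ (N : ℕ) (c : ℝ) (ρ₁ ρ₂ : ℕ → ℕ)
        (φ₁ : ∀ n, Word n → Word (ρ₁ n)) (φ₂ : ∀ n, Word n → Word (ρ₂ n)),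
        (∀ n ≥ N,
          ρ₁ n ≤ 4 * k * l n ∧
          (ρ₂ n : ℝ) ≤ 4 * k * Real.logb 2 n + 8 * k * Real.logb 2 (l n + 1)
            + c * Real.logb 2 (Real.logb 2 n) ∧
          CorrectsBurstErasures (2 * k) (l n) (φ₁ n) ∧
          IsColoring (reducedGraph (channel (l n) k) (φ₁ n)) (φ₂ n)) ∧
        PolyTimeComputable l N φ₁ ∧ PolyTimeComputable l N φ₂ ∧
        HasPolyTimeRecovery k l N φ₁ φ₂) := by
  refine ⟨?_, fun h => ?_⟩
  · rintro (h | h)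
    · obtain ⟨K, C, hKC⟩ := exists_poly_bound k h
      refine exists_systematic_code (N := 0) (r := fun _ => 0) hk l (.const []) ?_ ?_
        (.const 0) (fun _ _ _ => rfl) (fun n _ _ => solves_fills (e := (l n, n)) (hKC n))
        (fun n _ _ => ?_)
      · fun_prop
      · fun_prop
      -- The first syndrome is empty, and the term `4kl` of the redundancy is exactly `2 log Λ` with
      -- `Λ = 2 ^ (2kl)`.
      · simp only
        rw [min_eq_right (hKC n), Nat.cast_zero, Nat.cast_pow, Nat.cast_ofNat, Real.logb_pow,
          Real.logb_self_eq_one (by norm_num)]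
        push_cast
        linarith
    · obtain ⟨N, hN, hb⟩ := exists_burst_bound hk h
      refine exists_systematic_code (N := N)
        (r := fun e => depth e * ((4 * k - 1) * (Nat.clog 2 e.2 + 1))) hk l ?_ ?_ (.const 1) ?_
        (fun e x _ => length_burstSynd _ _ _)
        (fun n hn _ => solves_burstSolve (e := (l n, n)) (show 2 ≤ n by omega))
        (fun n hn _ => ?_)
      · fun_prop
      · fun_prop
      · fun_prop
      · rw [Nat.cast_one, Real.logb_one, mul_zero, add_zero]
        exact_mod_cast hb n hn
  · obtain ⟨N, hN, hb⟩ := exists_burst_bound hk h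
    refine exists_two_syndromes (N := N)
      (r := fun e => depth e * ((4 * k - 1) * (Nat.clog 2 e.2 + 1))) hk l hN ?_ ?_ (.const 1)
      (fun e x _ => length_burstSynd _ _ _)
      (fun n hn _ => solves_burstSolve (e := (l n, n)) (show 2 ≤ n by omega))
      (fun n hn _ => hb n hn) (fun _ _ _ => rfl)
      (fun n hn _ x x' => eq_of_agreeOutsideBursts hk (show 2 ≤ n by omega))
    · fun_prop
    · fun_prop
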